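/- Let $(W,S)$ be a Coxeter system with Coxeter matrix $(m_{st})$. Its nerve $L$ is the simplicial complex with vertex set $S$ whose simplices are the nonempty spherical subsets of $S$, where $T\subseteq S$ is spherical if the subgroup $W_T=\langle T\rangle$ is finite. Let $A$ be the associated Artin group, that is, the group with generators $a_s$ ($s\in S$) and relations $a_sa_ta_s\cdots=a_ta_sa_t\cdots$ ($m_{st}$ letters on each side) for all $s\neq t$ with $m_{st}<\infty$. Suppose that $\dim L=d$ for an integer $d\geq 0$. (1) The cohomological dimension of $A$ (the projective dimension of the trivial module $\mathbb Z$ over $\mathbb Z[A]$) is at least $d+1$. (2) If the $K(\pi,1)$-Conjecture holds for $A$, then the geometric dimension of $A$ (the smallest dimension of a CW complex that is a classifying space $BA$) equals $d+1$. Here the $K(\pi,1)$-Conjecture for $A$ is the statement that the Salvetti complex is a classifying space for $A$. The Salvetti complex is the CW complex with one cell of dimension $\operatorname{Card} T$ for each spherical subset $T\subseteq S$ (including $\emptyset$). Up to barycentric subdivision, it is the quotient by the left action of $W$ of the geometric realization of the poset of pairs $(w,T)$, with $w\in W$ and $T$ spherical, ordered by: $(u,X)\leq(v,Y)$ if and only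 if $X\subseteq Y$, $v^{-1}u\in W_Y$, and $v^{-1}u$ is the shortest element of its coset $v^{-1}uW_X$. -/

import Mathlib

open CategoryTheory

universe u

namespace CoxeterMatrix

variable {B : Type u} (M : CoxeterMatrix B)

/-- The special subgroup `W_T` of the Coxeter group `W` of `M`, generated by the simple
reflections in `T`.  (In Mathlib an entry `0` of a Coxeter matrix stands for `∞`.) -/
def specialSubgroup (T : Set B) : Subgroup M.Group :=
  Subgroup.closure (M.simple '' T)

/-- A subset `T` of the set of generators is spherical if `W_T` is finite.
(A spherical subset is automatically a finite set.) -/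
def IsSpherical (T : Finset B) : Prop :=
  Finite (M.specialSubgroup (T : Set B))

variable {M} in
theorem specialSubgroup_mono {T T' : Set B} (h : T ⊆ T') :
    M.specialSubgroup T ≤ M.specialSubgroup T' :=
  Subgroup.closure_mono (Set.image_mono h)

variable {M} in
theorem IsSpherical.subset {T T' : Finset B} (h : M.IsSpherical T') (hT : T ⊆ T') :
    M.IsSpherical T := by
  have : Finite (M.specialSubgroup (T' : Set B)) := h
  exact Finite.of_injective
    (Subgroup.inclusion (specialSubgroup_mono (M := M) (Finset.coe_subset.2 hT)))
    (Subgroup.inclusion_injective _)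

theorem isSpherical_singleton (s : B) : M.IsSpherical {s} := by
  have h : IsOfFinOrder (M.simple s) :=
    isOfFinOrder_iff_pow_eq_one.2 ⟨2, two_pos, by
      have := M.toCoxeterSystem.simple_sq s
      rwa [CoxeterMatrix.toCoxeterSystem_simple] at this⟩
  have := h.finite_zpowers
  unfold IsSpherical specialSubgroup
  rw [Finset.coe_singleton, Set.image_singleton, ← Subgroup.zpowers_eq_closure]
  exact this

/-- The nerve `L` of the Coxeter system: the simplicial complex with vertex set the set of
generators, whose simplices are the nonempty spherical subsets. -/
def nerve : AbstractSimplicialComplex B where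
  faces := {T | T.Nonempty ∧ M.IsSpherical T}
  isRelLowerSet_faces := fun _ h => ⟨h.1, fun _ hT hne => ⟨hne, h.2.subset hT⟩⟩
  singleton_mem s := ⟨Finset.singleton_nonempty s, M.isSpherical_singleton s⟩

/-- The Artin relators `(a_s a_t ⋯) (a_t a_s ⋯)⁻¹` with `m_{st}` letters in each factor.  For
`m_{st} = ∞` (encoded as `0`) and for `s = t` the relator is trivial. -/
def artinRelators : Set (FreeGroup B) :=
  {r | ∃ s t : B,
    r = ((CoxeterSystem.braidWord M s t).map FreeGroup.of).prod *
      (((CoxeterSystem.braidWord M t s).map FreeGroup.of).prod)⁻¹}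

/-- The Artin group `A` associated to the Coxeter matrix `M`. -/
abbrev ArtinGroup : Type u := PresentedGroup M.artinRelators

/-! ### The Salvetti complex -/

/-- `x` is the shortest element of its coset `x W_T`, expressed as
`ℓ (x w) = ℓ x + ℓ w` for all `w` in `W_T`. -/
def IsMinimalIn (x : M.Group) (T : Finset B) : Prop :=
  ∀ w ∈ M.specialSubgroup (T : Set B),
    M.toCoxeterSystem.length (x * w) = M.toCoxeterSystem.length x + M.toCoxeterSystem.length w

/-- The elements of the Salvetti poset: pairs `(w, T)` with `w` in the Coxeter group and `T` a
(possibly empty) spherical subset.  They index the cells of the covering of the Salvetti complex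
that corresponds to the pure Artin group, the cell of `(w, T)` having dimension `Card T`. -/
@[ext]
structure SalvettiPoset where
  elt : M.Group
  type : Finset B
  spherical : M.IsSpherical type

namespace SalvettiPoset

variable {M}

/-- `(u, X) ≤ (v, Y)` if and only if `X ⊆ Y`, `v⁻¹ u ∈ W_Y`, and `v⁻¹ u` is the shortest element
of `v⁻¹ u W_X`. -/
instance : LE (SalvettiPoset M) where
  le a b := a.type ⊆ b.type ∧ b.elt⁻¹ * a.elt ∈ M.specialSubgroup (b.type : Set B) ∧
    M.IsMinimalIn (b.elt⁻¹ * a.elt) a.type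

theorem le_def {a b : SalvettiPoset M} : a ≤ b ↔ a.type ⊆ b.type ∧
    b.elt⁻¹ * a.elt ∈ M.specialSubgroup (b.type : Set B) ∧
    M.IsMinimalIn (b.elt⁻¹ * a.elt) a.type := Iff.rfl

instance : PartialOrder (SalvettiPoset M) where
  le_refl a := by
    refine ⟨subset_rfl, by simp [one_mem], fun w _ => by simp⟩
  le_trans a b c := by
    rintro ⟨h₁, h₂, h₃⟩ ⟨k₁, k₂, k₃⟩
    have e : c.elt⁻¹ * a.elt = (c.elt⁻¹ * b.elt) * (b.elt⁻¹ * a.elt) := by group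
    have h₂' := specialSubgroup_mono (M := M) (Finset.coe_subset.2 k₁) h₂
    refine ⟨h₁.trans k₁, e ▸ mul_mem k₂ h₂', fun w hw => ?_⟩
    have hw' := specialSubgroup_mono (M := M) (Finset.coe_subset.2 h₁) hw
    rw [e, mul_assoc, k₃ _ (mul_mem h₂ hw'), h₃ w hw, k₃ _ h₂, add_assoc]
  le_antisymm a b := by
    rintro ⟨h₁, h₂, h₃⟩ ⟨k₁, k₂, k₃⟩
    have ht : a.type = b.type := h₁.antisymm k₁
    have h := h₃ (b.elt⁻¹ * a.elt)⁻¹ (inv_mem (ht ▸ h₂))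
    rw [mul_inv_cancel, M.toCoxeterSystem.length_one] at h
    have h0 : M.toCoxeterSystem.length (b.elt⁻¹ * a.elt) = 0 := by omega
    have h1 := M.toCoxeterSystem.length_eq_zero_iff.1 h0
    exact SalvettiPoset.ext (inv_mul_eq_one.1 h1).symm ht

/-- Left translation of the Salvetti poset by an element of the Coxeter group. -/
def translate (g : M.Group) : SalvettiPoset M →o SalvettiPoset M where
  toFun a := ⟨g * a.elt, a.type, a.spherical⟩
  monotone' a b h := by
    have e : (g * b.elt)⁻¹ * (g * a.elt) = b.elt⁻¹ * a.elt := by group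
    exact ⟨h.1, by simpa only [e] using h.2.1, by simpa only [e] using h.2.2⟩

end SalvettiPoset

/-- The simplicial set of chains in the Salvetti poset. -/
abbrev salvettiChains : SSet.{u} := CategoryTheory.nerve (SalvettiPoset M)

/-- The action of an element of the Coxeter group on chains in the Salvetti poset. -/
def salvettiTranslate (g : M.Group) : M.salvettiChains ⟶ M.salvettiChains :=
  nerveMap (SalvettiPoset.translate g).monotone.functor

/-- The quotient, by the free action of the Coxeter group `W`, of the simplicial set of chains in
the Salvetti poset.  Its realization is the barycentric subdivision of the complex with one
`(Card T)`-dimensional cell for each spherical subset `T`: that cell is the Coxeter polytope of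
`W_T`, and for `T' ⊆ T` each of its faces of type `T'`, which corresponds to a coset `x W_{T'}`
with `x` shortest, is glued to the cell of `T'` by translation by `x⁻¹`. -/
def salvettiSSet : SSet.{u} where
  obj n := Quot fun x y : M.salvettiChains.obj n => ∃ g, (M.salvettiTranslate g).app n x = y
  map f := ↾ Quot.map (M.salvettiChains.map f) (by
    rintro x y ⟨g, rfl⟩
    exact ⟨g, NatTrans.naturality_apply (M.salvettiTranslate g) f x⟩)
  map_id n := by
    ext x
    induction x using Quot.ind with
    | _ x => exact congrArg (Quot.mk _) (M.salvettiChains.map_id_apply _ x)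
  map_comp f g := by
    ext x
    induction x using Quot.ind with
    | _ x => exact congrArg (Quot.mk _) (M.salvettiChains.map_comp_apply f g x)

/-- The Salvetti complex of the Coxeter system, as a topological space. -/
noncomputable def salvettiComplex : TopCat.{u} :=
  SSet.toTop.obj M.salvettiSSet

end CoxeterMatrix

/-- The dimension of a simplicial complex: the supremum of the dimensions `Card σ - 1` of its
simplices `σ` (it is `⊥` for the complex without simplices). -/
noncomputable def AbstractSimplicialComplex.dim {V : Type u} (K : AbstractSimplicialComplex V) :
    WithBot ℕ∞ :=
  ⨆ σ : K.faces, (((σ : Finset V).card - 1 : ℕ) : WithBot ℕ∞)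

/-- `X` is a classifying space for the discrete group `G`: it is the quotient of a contractible
space by a free action of `G` for which the quotient map is a covering map.  Equivalently for a
CW complex `X`: it is connected, its fundamental group is isomorphic to `G`, and its universal
cover is contractible. -/
def IsClassifyingSpace (G : Type u) [Group G] (X : TopCat.{u}) : Prop :=
  ∃ (E : Type u) (_ : TopologicalSpace E) (_ : MulAction G E) (p : E → X),
    ContractibleSpace E ∧ IsQuotientCoveringMap p G

/-- The geometric dimension of a group: the smallest dimension of a CW complex that is a
classifying space for the group (`⊤` if there is no finite-dimensional one). -/
noncomputable def geometricDimension (G : Type u) [Group G] : ℕ∞ :=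
  sInf {n : ℕ∞ | ∃ (X : TopCat.{u}) (c : TopCat.CWComplex X),
    IsClassifyingSpace G X ∧ ∀ e : c.Cells, (e.j : ℕ∞) ≤ n}

/-- The cohomological dimension of a group `G`: the projective dimension of `ℤ`, with trivial
action, in the category of `ℤ[G]`-modules. -/
noncomputable def cohomologicalDimension (G : Type u) [Group G] : WithBot ℕ∞ :=
  projectiveDimension (Rep.trivial.{u} ℤ G (ULift.{u} ℤ))

/-- The `K(π,1)`-Conjecture holds for the Artin group of `M`: the Salvetti complex is a
classifying space for the Artin group. -/
def CoxeterMatrix.KPiOneConjecture {B : Type u} (M : CoxeterMatrix B) : Prop :=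
  IsClassifyingSpace M.ArtinGroup M.salvettiComplex

/-! The dimension of the nerve yields a spherical `T` with `d + 1` elements, and the lower bounds
come from a free abelian subgroup of rank `d + 1` in `A`. Filter `T` by subsets `U 0 ⊂ U 1 ⊂ ⋯`,
each with one element more than the previous one. For each `k` the longest element of the finite
group generated by `U k` lifts to `A` by Matsumoto's theorem (`prod_map_eq_of_isReduced`). A power
of the lift lies in the pure Artin group and commutes with the generators in `U k`
(`exists_central_word`), so these powers commute with each other. Counting how often a reflection
occurs as an inversion is an integral character of the pure Artin group. The characters of the
simple reflections in `T`, evaluated on these elements, form a triangular matrix with positive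
diagonal (`hasDetectedTorus_artinGroup`).

Both lower bounds evaluate a cup product of such characters on the fundamental cycle of a
triangulated torus; the value is the determinant of the matrix of periods (`sum_kuhn_cup`), which is
not zero. If the projective dimension were less than `d + 1`, the cup product would be an invariant
coboundary, and coboundaries evaluate to zero (`sum_kuhn_coboundary`). This gives
`HasDetectedTorus.le_cohomologicalDimension`.

For the geometric dimension, a covering of an `n`-dimensional CW complex has sections over `n + 1`
open sets that cover the base (`exists_sections`). A contractible total space receives an
equivariant map from `ℝ^(d+1)` (`EquivariantMap.exists_continuous`). If `n ≤ d`, comparing this map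
with the sections produces functions with the same periods as the characters, at least one of which
is constant on each sufficiently small simplex. All cup products then vanish, which contradicts the
determinant (`HasDetectedTorus.le_of_isClassifyingSpace`).

The upper bound uses the Salvetti complex itself: the realization of a simplicial set is a CW
complex whose cells are the nondegenerate simplices (`toTopCWComplex`), and a strict chain of
Salvetti pairs has strictly increasing types, hence at most `d + 2` members. -/

/-! ### Inversion sequences and the exchange condition -/

namespace CoxeterSystem

variable {B W : Type*} [Group W] {M : CoxeterMatrix B} (cs : CoxeterSystem M W)

theorem simple_mul_pow_eq (i j : B) (k : ℕ) :
    ((cs.simple i * cs.simple j) ^ k)⁻¹ * cs.simple j =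
      cs.simple j * (cs.simple i * cs.simple j) ^ k := by
  induction k with
  | zero => simp
  | succ k ih =>
    rw [pow_succ', mul_inv_rev, mul_assoc, mul_inv_rev, cs.inv_simple, cs.inv_simple]
    have : cs.simple j * cs.simple i * cs.simple j = cs.simple j * (cs.simple i * cs.simple j) :=
      mul_assoc _ _ _
    rw [this, ← mul_assoc, ih, mul_assoc, ← pow_succ, pow_succ']

/-- With `q = sᵢ sⱼ`, an alternating word has product `q ^ (m / 2)` or `sⱼ q ^ (m / 2)` by parity.
Conjugating the next letter by it gives `sⱼ q ^ m`, because `sⱼ` inverts `q`. -/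
theorem rightInvSeq_alternatingWord (i j : B) (m : ℕ) :
    cs.rightInvSeq (alternatingWord i j m) =
      ((List.range m).map fun k ↦ cs.simple j * (cs.simple i * cs.simple j) ^ k).reverse := by
  induction m with
  | zero => rfl
  | succ m ih =>
    rw [alternatingWord_succ', rightInvSeq, ih, List.range_succ, List.map_append,
      List.reverse_append]
    simp only [List.map_cons, List.map_nil, List.reverse_cons, List.reverse_nil, List.nil_append,
      List.cons_append, List.cons.injEq, and_true]
    rw [prod_alternatingWord_eq_mul_pow]
    have key := cs.simple_mul_pow_eq i j (m / 2)
    rcases Nat.even_or_odd m with h | h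
    · simp only [h, if_true, one_mul]
      rw [key, mul_assoc, ← pow_add]
      obtain ⟨r, rfl⟩ := h
      congr 2; omega
    · simp only [Nat.not_even_iff_odd.2 h, if_false, mul_inv_rev, cs.inv_simple]
      rw [key]
      obtain ⟨r, rfl⟩ := h
      have e : (2 * r + 1) / 2 = r := by omega
      rw [e]
      calc _ = cs.simple j * ((cs.simple i * cs.simple j) ^ r *
              (cs.simple i * cs.simple j) * (cs.simple i * cs.simple j) ^ r) := by
            simp only [mul_assoc]
        _ = _ := by rw [← pow_succ, ← pow_add]; congr 2; omega

section InversionAction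

open Classical in
/-- The action of a simple reflection on pairs of a group element and an accumulated count. -/
noncomputable def countPerm (Z : Type*) [AddGroupWithOne Z] (i : B) : Equiv.Perm (W × Z) where
  toFun p := (cs.simple i * p.1 * cs.simple i, p.2 + if p.1 = cs.simple i then 1 else 0)
  invFun p := (cs.simple i * p.1 * cs.simple i, p.2 - if p.1 = cs.simple i then 1 else 0)
  left_inv p := by
    have : cs.simple i * p.1 * cs.simple i = cs.simple i ↔ p.1 = cs.simple i := by
      rw [mul_assoc, mul_eq_left, mul_eq_one_iff_eq_inv, inv_simple]
    exact Prod.ext (by simp [mul_assoc]) (by simp only [this]; simp)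
  right_inv p := by
    have : cs.simple i * p.1 * cs.simple i = cs.simple i ↔ p.1 = cs.simple i := by
      rw [mul_assoc, mul_eq_left, mul_eq_one_iff_eq_inv, inv_simple]
    exact Prod.ext (by simp [mul_assoc]) (by simp only [this]; simp)

open Classical in
-- Prepending `i` to `ω` adds the inversion `ω⁻¹ sᵢ ω`, and this is `t` exactly when the conjugate
-- `ω t ω⁻¹` is `sᵢ`. The values `Z = ZMod 2` and `Z = ℤ` serve the Coxeter group and the Artin
-- group respectively.
theorem prod_map_countPerm_apply (Z : Type*) [AddGroupWithOne Z] (ω : List B) (t : W) (z : Z) :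
    (ω.map (cs.countPerm Z)).prod (t, z) =
      (cs.wordProd ω * t * (cs.wordProd ω)⁻¹, z + ((cs.rightInvSeq ω).count t : Z)) := by
  induction ω with
  | nil => simp
  | cons i ω ih =>
    rw [List.map_cons, List.prod_cons, Equiv.Perm.mul_apply, ih, rightInvSeq, List.count_cons]
    have : cs.wordProd ω * t * (cs.wordProd ω)⁻¹ = cs.simple i ↔
        ((cs.wordProd ω)⁻¹ * cs.simple i * cs.wordProd ω == t) = true := by
      rw [beq_iff_eq]
      constructor <;> rintro h
      · rw [← h]; group
      · rw [← h]; group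
    refine Prod.ext (by simp [countPerm, wordProd_cons, mul_assoc]) ?_
    simp only [countPerm, Equiv.coe_fn_mk, this, Nat.cast_add, Nat.cast_ite, Nat.cast_one,
      Nat.cast_zero, add_assoc]

end InversionAction

theorem prod_map_alternatingWord {N : Type*} [Monoid N] (f : B → N) (i j : B) (m : ℕ) :
    ((alternatingWord i j (2 * m)).map f).prod = (f i * f j) ^ m := by
  induction m with
  | zero => simp [alternatingWord]
  | succ m ih =>
    rw [show 2 * (m + 1) = 2 * m + 1 + 1 by ring, alternatingWord_succ', alternatingWord_succ']
    simp [ih, pow_succ', mul_assoc]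

theorem wordProd_eq_one_of_even (i j : B) :
    cs.wordProd (alternatingWord i j (2 * M i j)) = 1 := by
  rw [wordProd, prod_map_alternatingWord, cs.simple_mul_simple_pow]

open Classical in
-- The inversions `sⱼ q ^ k`, `k < 2 m`, of the relator repeat after `m` terms since `q ^ m = 1`, so
-- every count is even.
theorem isLiftable_countPerm : M.IsLiftable (cs.countPerm (ZMod 2)) := by
  intro i j
  rw [← prod_map_alternatingWord]
  ext1 ⟨t, z⟩
  rw [prod_map_countPerm_apply, wordProd_eq_one_of_even, rightInvSeq_alternatingWord,
    List.count_reverse, two_mul, List.range_add, List.map_append, List.count_append, List.map_map]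
  have : (fun k ↦ cs.simple j * (cs.simple i * cs.simple j) ^ k) ∘ (fun k ↦ M i j + k) =
      fun k ↦ cs.simple j * (cs.simple i * cs.simple j) ^ k := by
    ext k; simp [pow_add]
  rw [this, ← two_mul]
  simp [show (2 : ZMod 2) = 0 from rfl]

open Classical in
-- The action on pairs factors through `W`, so the parity of an inversion count does not depend on
-- the word.
theorem natCast_count_rightInvSeq_eq {ω ω' : List B} (h : cs.wordProd ω = cs.wordProd ω') (t : W) :
    ((cs.rightInvSeq ω).count t : ZMod 2) = (cs.rightInvSeq ω').count t := by
  have key (ω : List B) : (ω.map (cs.countPerm (ZMod 2))).prod =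
      cs.lift ⟨_, cs.isLiftable_countPerm⟩ (cs.wordProd ω) := by
    rw [wordProd, map_list_prod, List.map_map]
    congr 1
    refine List.map_congr_left fun i _ ↦ ?_
    simp
  have h1 := cs.prod_map_countPerm_apply (ZMod 2) ω t 0
  rw [key, h, ← key, prod_map_countPerm_apply] at h1
  simpa using (congrArg Prod.snd h1).symm

/-- The strong exchange condition. -/
theorem IsRightInversion.mem_rightInvSeq {ω : List B} {t : W}
    (h : cs.IsRightInversion (cs.wordProd ω) t) : t ∈ cs.rightInvSeq ω := by
  classical
  obtain ⟨⟨u, i, rfl⟩, hlt⟩ := h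
  set t := u * cs.simple i * u⁻¹ with ht
  by_contra hmem
  obtain ⟨ν, rfl⟩ := cs.wordProd_surjective u
  set ρ := ν ++ i :: ν.reverse with hρdef
  have hρ : cs.wordProd ρ = t := by
    rw [hρdef, wordProd_append, wordProd_cons, wordProd_reverse, ht, mul_assoc]
  have key (ω : List B) (s : W) (z : ZMod 2) := cs.prod_map_countPerm_apply (ZMod 2) ω s z
  -- the count of `t` in a palindromic word for `t` is odd
  have hρc : ((cs.rightInvSeq ρ).count t : ZMod 2) = 1 := by
    have h1 := key ν.reverse t 0
    have h2 := key [i] (cs.simple i) ((cs.rightInvSeq ν.reverse).count t)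
    have h3 := key ν (cs.simple i) ((cs.rightInvSeq ν.reverse).count t + 1)
    have h4 := key (ν ++ ν.reverse) t 0
    have h5 := key ρ t 0
    have e1 : (cs.wordProd ν)⁻¹ * t * cs.wordProd ν = cs.simple i := by rw [ht]; group
    simp only [wordProd_reverse, inv_inv, e1, zero_add] at h1
    have e4 : cs.wordProd (ν ++ ν.reverse) = cs.wordProd [] := by
      simp [wordProd_append, wordProd_reverse]
    rw [cs.natCast_count_rightInvSeq_eq e4, List.map_append, List.prod_append,
      Equiv.Perm.mul_apply, h1, key ν] at h4
    rw [List.map_append, List.prod_append, List.map_cons, List.prod_cons,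
      Equiv.Perm.mul_apply, Equiv.Perm.mul_apply, h1] at h5
    simp only [List.map_cons, List.map_nil, List.prod_singleton, wordProd_singleton, inv_simple,
      simple_mul_simple_self, one_mul, rightInvSeq_singleton, List.count_singleton_self,
      Nat.cast_one] at h2
    rw [h2, key ν] at h5
    have h4' := congrArg Prod.snd h4
    have h5' := congrArg Prod.snd h5
    simp only [rightInvSeq_nil, List.count_nil, Nat.cast_zero, zero_add] at h4' h5'
    rw [← h5', add_right_comm, h4']
    simp
  -- If `t` does not occur for `ω`, it has odd count for `ω ++ ρ`, hence for every word of `ω t`. It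
  -- is then an inversion of `ω t`, so that multiplying back by `t` shortens, contrary to `hlt`.
  obtain ⟨ω', hω', hw⟩ := cs.exists_isReduced (cs.wordProd ω * t)
  have hw' : cs.wordProd ω' = cs.wordProd (ω ++ ρ) := by rw [← hw, wordProd_append, hρ]
  have hc : ((cs.rightInvSeq ω').count t : ZMod 2) = 1 := by
    rw [cs.natCast_count_rightInvSeq_eq hw']
    have h1 := key (ω ++ ρ) t 0
    rw [List.map_append, List.prod_append, Equiv.Perm.mul_apply, key ρ, hρ, mul_inv_cancel_right,
      key ω, hρc] at h1
    have h1' := congrArg Prod.snd h1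
    simp only [zero_add, List.count_eq_zero_of_not_mem hmem] at h1'
    simpa using h1'.symm
  have hmem' : t ∈ cs.rightInvSeq ω' := by
    by_contra hn
    rw [List.count_eq_zero_of_not_mem hn] at hc
    simp at hc
  have := (cs.isRightInversion_of_mem_rightInvSeq hω' hmem').2
  have htt : t * t = 1 := (show cs.IsReflection t from ⟨_, _, ht⟩).mul_self
  rw [← hw, mul_assoc, htt, mul_one] at this
  omega

/-- The exchange condition: right multiplication by a right inversion deletes a letter. -/
theorem IsRightInversion.exists_eraseIdx {ω : List B} {t : W}
    (h : cs.IsRightInversion (cs.wordProd ω) t) :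
    ∃ k < ω.length, t = (cs.rightInvSeq ω).getD k 1 ∧
      cs.wordProd ω * t = cs.wordProd (ω.eraseIdx k) := by
  obtain ⟨k, hk, e⟩ := List.mem_iff_getElem.1 (IsRightInversion.mem_rightInvSeq cs h)
  have e' : t = (cs.rightInvSeq ω).getD k 1 := by
    rw [List.getD_eq_getElem _ _ hk, e]
  refine ⟨k, by simpa using hk, e', ?_⟩
  rw [e', cs.wordProd_mul_getD_rightInvSeq]

end CoxeterSystem

/-! ### The geometric representation and the orders of products of two generators -/

namespace CoxeterMatrix

open Real Polynomial.Chebyshev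

variable {B : Type*} (M : CoxeterMatrix B)

/-- The linear form `2 B(α_i, ·)` of the standard bilinear form; an entry `0` of the Coxeter matrix
gives the value `-2` since then `π / 0 = 0`. -/
noncomputable def simpleCoroot (i : B) : Module.Dual ℝ (B →₀ ℝ) :=
  Finsupp.lift ℝ ℝ B fun j ↦ -2 * cos (π / M i j)

theorem simpleCoroot_single (i j : B) :
    M.simpleCoroot i (Finsupp.single j 1) = -2 * cos (π / M i j) := by
  simp [simpleCoroot]

theorem simpleCoroot_self (i : B) : M.simpleCoroot i (Finsupp.single i 1) = 2 := by
  rw [simpleCoroot_single, M.diagonal]; simp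

/-- The simple reflections of the standard geometric representation. -/
noncomputable def simpleReflection (i : B) : (B →₀ ℝ) ≃ₗ[ℝ] (B →₀ ℝ) :=
  Module.reflection (M.simpleCoroot_self i)

theorem simpleCoroot_mul (i j : B) :
    M.simpleCoroot i (Finsupp.single j 1) * M.simpleCoroot j (Finsupp.single i 1) - 2 =
      2 * cos (2 * (π / M i j)) := by
  rw [simpleCoroot_single, simpleCoroot_single, M.symmetric j i, cos_two_mul]; ring

theorem isLiftable_simpleReflection : M.IsLiftable M.simpleReflection := by
  intro i j
  by_cases hij : i = j
  · subst hij
    rw [M.diagonal, pow_one]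
    ext1 v
    exact Module.involutive_reflection (M.simpleCoroot_self i) v
  have h1 : M i j ≠ 1 := M.off_diagonal i j hij
  by_cases h0 : M i j = 0
  · rw [h0, pow_zero]
  have ht := (M.simpleCoroot_mul i j).symm
  ext1 v
  rw [simpleReflection, simpleReflection,
    Module.reflection_mul_reflection_pow_apply (M.simpleCoroot_self i) (M.simpleCoroot_self j)
      (M i j) v _ ht]
  -- Here the angle `x` below would be `π`, and the quotient by `sin x` would not make sense.
  by_cases h2 : M i j = 2
  · have hc : cos (2 * (π / (2 : ℕ))) = -1 := by
      rw [show 2 * (π / ((2 : ℕ) : ℝ)) = π by push_cast; ring, cos_pi]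
    have hz (a b : B) (h : M a b = 2) : M.simpleCoroot a (Finsupp.single b 1) = 0 := by
      rw [simpleCoroot_single, h]; simp
    rw [h2, hc, hz i j h2, hz j i (by rw [M.symmetric, h2])]
    norm_num [S_zero, S_one, S_neg_one]
    module
  have hm : 3 ≤ M i j := by omega
  set m := M i j with hmdef
  set x := 2 * (π / m) with hx
  have hm0 : (0 : ℝ) < m := by positivity
  have hxpos : 0 < x := by positivity
  have hxpi : x < π := by
    rw [hx, ← mul_div_assoc, div_lt_iff₀ hm0]
    have : (3 : ℝ) ≤ m := by exact_mod_cast hm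
    nlinarith [pi_pos]
  have hs : sin x ≠ 0 := (sin_pos_of_pos_of_lt_pi hxpos hxpi).ne'
  have hmx : m * x = 2 * π := by rw [hx]; field_simp
  -- The powers of the product are given by Chebyshev polynomials at `2 cos x` with `m x = 2 π`.
  -- Each coefficient of the deviation from the identity contains a factor that vanishes: `S (h -
  -- 1)` if `m = 2 h`, and `S h + S (h - 1)` if `m = 2 h + 1`.
  have S_of (n : ℤ) : (S ℝ n).eval (2 * cos x) = sin ((n + 1) * x) / sin x := by
    rw [eq_div_iff hs, S_two_mul_real_cos]
  rcases Nat.even_or_odd' m with ⟨h, hh | hh⟩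
  · have e1 : ((m : ℤ) - 2) / 2 = h - 1 := by omega
    have e2 : ((m : ℤ) - 1) / 2 = h - 1 := by omega
    have hz : (S ℝ (h - 1)).eval (2 * cos x) = 0 := by
      have : h * x = π := by
        rw [hh] at hmx; push_cast at hmx; linarith
      rw [S_of]; push_cast
      rw [sub_add_cancel, this, sin_pi, zero_div]
    rw [e1, e2, hz]; simp
  · have e1 : ((m : ℤ) - 1) / 2 = h := by omega
    have e2 : ((m : ℤ) - 3) / 2 = h - 1 := by omega
    have e3 : ((m : ℤ) - 2) / 2 = h - 1 := by omega
    have e4 : (m : ℤ) / 2 = h := by omega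
    have hz : (S ℝ h).eval (2 * cos x) + (S ℝ (h - 1)).eval (2 * cos x) = 0 := by
      have : ((h : ℝ) + 1) * x = 2 * π - h * x := by
        rw [hh] at hmx; push_cast at hmx; linarith
      rw [S_of, S_of]; push_cast
      rw [sub_add_cancel, this, sin_two_pi_sub]; ring
    rw [e1, e2, e3, e4, hz]; simp

end CoxeterMatrix

namespace CoxeterSystem

open Real Polynomial.Chebyshev

variable {B W : Type*} [Group W] {M : CoxeterMatrix B} (cs : CoxeterSystem M W)

/-- The product of two simple reflections has order given by the Coxeter matrix. -/
theorem dvd_of_simple_mul_simple_pow_eq_one {i j : B} {k : ℕ}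
    (h : (cs.simple i * cs.simple j) ^ k = 1) : M i j ∣ k := by
  by_cases hij : i = j
  · subst hij; rw [M.diagonal]; exact one_dvd _
  have h1 : M i j ≠ 1 := M.off_diagonal i j hij
  have hr := congrArg (cs.lift ⟨_, M.isLiftable_simpleReflection⟩) h
  rw [map_pow, map_mul, lift_apply_simple, lift_apply_simple, map_one] at hr
  have hv := DFunLike.congr_fun hr (Finsupp.single i 1)
  have ht := (M.simpleCoroot_mul i j).symm
  rw [CoxeterMatrix.simpleReflection, CoxeterMatrix.simpleReflection,
    Module.reflection_mul_reflection_pow_apply_self (M.simpleCoroot_self i) (M.simpleCoroot_self j)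
      k _ ht, M.simpleCoroot_single j i, M.symmetric j i] at hv
  have hi := DFunLike.congr_fun hv i
  have hj := DFunLike.congr_fun hv j
  simp only [Finsupp.add_apply, Finsupp.smul_apply, Finsupp.single_eq_same, smul_eq_mul, mul_one,
    Finsupp.single_eq_of_ne hij, Finsupp.single_eq_of_ne (Ne.symm hij), mul_zero, add_zero,
    zero_add, LinearEquiv.coe_one, id_eq] at hi hj
  -- For `m = ∞` the argument is `2`, where `S n` takes the value `n + 1`; the coefficient of `αᵢ`
  -- is then `2 k + 1`, which is `1` only for `k = 0`.
  by_cases h0 : M i j = 0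
  · simp only [h0, Nat.cast_zero, div_zero, mul_zero, cos_zero, mul_one, S_eval_two] at hi
    push_cast at hi
    have : (k : ℝ) = 0 := by linarith
    rw [h0, Nat.cast_eq_zero.1 this]
  by_cases h2 : M i j = 2
  · have hc : cos (2 * (π / (2 : ℕ))) = -1 := by
      rw [show 2 * (π / ((2 : ℕ) : ℝ)) = π by push_cast; ring, cos_pi]
    rw [h2, hc, mul_neg_one, S_eval_neg_two, S_eval_neg_two] at hi
    rw [h2, ← even_iff_two_dvd]
    by_contra hodd
    have ho := Nat.not_even_iff_odd.1 hodd
    rw [Int.negOnePow_odd _ (by exact_mod_cast ho), Int.negOnePow_even ((k : ℤ) - 1)] at hi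
    · push_cast at hi; norm_num at hi
    · obtain ⟨r, hr⟩ := ho
      exact ⟨r, by omega⟩
  have hm : 3 ≤ M i j := by omega
  set m := M i j with hmdef
  set x := 2 * (π / m) with hx
  have hm0 : (0 : ℝ) < m := by positivity
  have h3 : (3 : ℝ) ≤ m := by exact_mod_cast hm
  have hxpos : 0 < x := by positivity
  have hxpi : x < π := by
    rw [hx, ← mul_div_assoc, div_lt_iff₀ hm0]
    nlinarith [pi_pos]
  have hs : sin x ≠ 0 := (sin_pos_of_pos_of_lt_pi hxpos hxpi).ne'
  have hcos : cos (π / m) ≠ 0 := (cos_pos_of_mem_Ioo ⟨by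
    have : 0 < π / m := by positivity
    linarith [pi_pos], by linarith⟩).ne'
  -- The coefficient of `αⱼ` yields `sin (k x) = 0`, and that of `αᵢ` then yields `cos (k x) = 1`;
  -- so `k x` is a multiple of `2 π = m x`.
  have hk0 : (S ℝ ((k : ℤ) - 1)).eval (2 * cos x) = 0 := by
    rcases mul_eq_zero.1 hj with h | h
    · exact h
    · exact absurd h (by simpa using hcos)
  rw [hk0, add_zero] at hi
  have a1 := S_two_mul_real_cos x ((k : ℤ) - 1)
  have a2 := S_two_mul_real_cos x (k : ℤ)
  rw [hk0, zero_mul] at a1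
  rw [hi, one_mul] at a2
  push_cast at a1 a2
  rw [sub_add_cancel] at a1
  rw [add_mul, one_mul, sin_add, ← a1, zero_mul, zero_add] at a2
  have hck : cos (k * x) = 1 := by
    have : (cos (k * x) - 1) * sin x = 0 := by linarith
    rcases mul_eq_zero.1 this with h | h
    · linarith
    · exact absurd h hs
  obtain ⟨n, hn⟩ := (cos_eq_one_iff _).1 hck
  have : (n : ℝ) * m = k := by
    rw [hx] at hn
    have hpi := pi_pos.ne'
    field_simp at hn
    linarith
  have hZ : n * (m : ℤ) = k := by exact_mod_cast this
  exact Int.natCast_dvd_natCast.1 ⟨n, by rw [← hZ, mul_comm]⟩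

theorem simple_inj : Function.Injective cs.simple := by
  intro i j hij
  by_contra hne
  have : (cs.simple i * cs.simple j) ^ 1 = 1 := by rw [hij]; simp
  exact M.off_diagonal i j hne (Nat.dvd_one.1 (cs.dvd_of_simple_mul_simple_pow_eq_one this))

end CoxeterSystem

/-! ### Matsumoto's theorem and reduced words in special subgroups -/

namespace CoxeterSystem

variable {B W : Type*} [Group W] {M : CoxeterMatrix B} (cs : CoxeterSystem M W)

/-- If `w` has a reduced word ending in `ω` and `i` is a right descent of `w` that is not a right
inversion of `ω`, then `w` has a reduced word ending in `ω i`. -/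
theorem exists_isReduced_append_concat {ρ ω : List B} {i : B} (hred : cs.IsReduced (ρ ++ ω))
    (hi : cs.IsRightDescent (cs.wordProd (ρ ++ ω)) i) (hω : cs.simple i ∉ cs.rightInvSeq ω) :
    ∃ ρ', cs.IsReduced (ρ' ++ ω.concat i) ∧
      cs.wordProd (ρ' ++ ω.concat i) = cs.wordProd (ρ ++ ω) := by
  obtain ⟨k, hk, hkt, he⟩ := IsRightInversion.exists_eraseIdx cs
    ((cs.isRightInversion_simple_iff_isRightDescent _ _).2 hi)
  have hkρ : k < ρ.length := by
    by_contra hge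
    apply hω
    have h1 := cs.rightInvSeq_drop (ρ ++ ω) ρ.length
    rw [List.drop_left] at h1
    have hk' : k < (cs.rightInvSeq (ρ ++ ω)).length := by simpa using hk
    rw [h1, hkt, List.getD_eq_getElem _ _ hk', List.mem_iff_getElem]
    refine ⟨k - ρ.length, ?_, ?_⟩
    · rw [List.length_drop]; omega
    · rw [List.getElem_drop]; congr 1; omega
  rw [List.eraseIdx_append_of_lt_length hkρ] at he
  have hw : cs.wordProd (ρ.eraseIdx k ++ ω.concat i) = cs.wordProd (ρ ++ ω) := by
    rw [List.concat_eq_append, ← List.append_assoc, wordProd_append, ← he, wordProd_singleton,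
      simple_mul_simple_cancel_right]
  refine ⟨ρ.eraseIdx k, ?_, hw⟩
  rw [IsReduced, hw, hred.eq]
  simp only [List.concat_eq_append, List.length_append, List.length_eraseIdx_of_lt hkρ,
    List.length_singleton]
  omega

/-- The tail grows on the right one letter at a time, with `i` and `j` exchanged at each step. The
next letter could only fail by being an inversion of the present tail, and that would force `(sⱼ sᵢ)
^ (r + 1) = 1` with `r + 1` smaller than the order. -/
theorem exists_isReduced_append_alternatingWord {w : W} (k : ℕ) {i j : B} (hij : i ≠ j)
    (hi : cs.IsRightDescent w i) (hj : cs.IsRightDescent w j) (hk : M i j = 0 ∨ k ≤ M i j) :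
    ∃ ρ, cs.IsReduced (ρ ++ alternatingWord i j k) ∧
      cs.wordProd (ρ ++ alternatingWord i j k) = w := by
  induction k generalizing i j with
  | zero =>
    obtain ⟨ω, hω, rfl⟩ := cs.exists_isReduced w
    exact ⟨ω, by simpa [alternatingWord] using hω, by simp [alternatingWord]⟩
  | succ k ih =>
    obtain ⟨ρ, hρ, rfl⟩ := ih hij.symm hj hi (by rw [M.symmetric]; omega)
    refine cs.exists_isReduced_append_concat hρ hj fun hmem ↦ ?_
    rw [rightInvSeq_alternatingWord, List.mem_reverse, List.mem_map] at hmem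
    obtain ⟨r, hr, e⟩ := hmem
    rw [List.mem_range] at hr
    have h1 : (cs.simple j * cs.simple i) ^ (r + 1) = 1 := by
      rw [pow_succ', mul_assoc, e, simple_mul_simple_self]
    have h2 := cs.dvd_of_simple_mul_simple_pow_eq_one h1
    rw [M.symmetric] at h2
    rcases hk with hk | hk
    · rw [hk] at h2; simp at h2
    · exact absurd (Nat.le_of_dvd (Nat.succ_pos _) h2) (by omega)

/-- Matsumoto's theorem: a function to a monoid that satisfies the braid relations takes the same
value on all reduced words of an element. -/
theorem prod_map_eq_of_isReduced {N : Type*} [Monoid N] (f : B → N)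
    (hf : ∀ i j, ((braidWord M i j).map f).prod = ((braidWord M j i).map f).prod)
    {ω ω' : List B} (hω : cs.IsReduced ω) (hω' : cs.IsReduced ω')
    (h : cs.wordProd ω = cs.wordProd ω') : (ω.map f).prod = (ω'.map f).prod := by
  induction hn : ω.length using Nat.strong_induction_on generalizing ω ω' with
  | _ n ih =>
  have hlen : ω'.length = ω.length := by rw [← hω.eq, ← hω'.eq, h]
  -- Words with a common last letter reduce to the induction hypothesis by cancelling it.
  have same {α α' : List B} {i : B} (hα : cs.IsReduced (α ++ [i])) (hα' : cs.IsReduced (α' ++ [i]))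
      (hl : (α ++ [i]).length = n)
      (hp : cs.wordProd (α ++ [i]) = cs.wordProd (α' ++ [i])) :
      ((α ++ [i]).map f).prod = ((α' ++ [i]).map f).prod := by
    have r1 : cs.IsReduced α := by simpa using hα.take α.length
    have r2 : cs.IsReduced α' := by simpa using hα'.take α'.length
    rw [wordProd_append, wordProd_append, mul_left_inj] at hp
    simp only [List.map_append, List.prod_append]
    rw [ih α.length (by simp at hl; omega) r1 r2 hp rfl]
  rcases List.eq_nil_or_concat ω with rfl | ⟨α, i, rfl⟩
  · rw [List.length_eq_zero_iff.1 hlen]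
  rcases List.eq_nil_or_concat ω' with rfl | ⟨α', j, rfl⟩
  · simp at hlen
  simp only [List.concat_eq_append] at *
  by_cases hij : i = j
  · subst hij; exact same hω hω' hn h
  have desc {α : List B} {i : B} (hα : cs.IsReduced (α ++ [i])) :
      cs.IsRightDescent (cs.wordProd (α ++ [i])) i := by
    rw [IsRightDescent, hα.eq, wordProd_append, wordProd_singleton, simple_mul_simple_cancel_right]
    exact lt_of_le_of_lt (cs.length_wordProd_le α) (by simp)
  have di := desc hω
  have dj := desc hω'
  rw [← h] at dj
  set w := cs.wordProd (α ++ [i]) with hw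
  -- With infinite order, `w` would have a reduced word with a tail longer than `w` itself.
  have hM : M i j ≠ 0 := by
    intro h0
    obtain ⟨ρ, hρ, hρw⟩ := cs.exists_isReduced_append_alternatingWord (cs.length w + 1) hij di dj
      (Or.inl h0)
    have := hρ.eq
    rw [hρw, List.length_append, length_alternatingWord] at this
    omega
  -- Since both letters are descents, `w` has reduced words ending in either braid word. One of them
  -- shares its last letter with `ω` and the other with `ω'`; the two are linked by the braid
  -- relation and induction on the remaining prefixes.
  obtain ⟨ρ, hρ, hρw⟩ := cs.exists_isReduced_append_alternatingWord (M i j) hij di dj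
    (Or.inr le_rfl)
  obtain ⟨σ, hσ, hσw⟩ := cs.exists_isReduced_append_alternatingWord (M j i) (Ne.symm hij) dj di
    (Or.inr le_rfl)
  obtain ⟨m, hm⟩ := Nat.exists_eq_succ_of_ne_zero hM
  have last (a b : B) (hab : M a b = m.succ) (τ : List B) : τ ++ alternatingWord a b (M a b) =
      (τ ++ alternatingWord b a m) ++ [b] := by
    rw [hab, Nat.succ_eq_add_one, alternatingWord_succ]; simp
  have eω : ((α ++ [i]).map f).prod = ((σ ++ alternatingWord j i (M j i)).map f).prod := by
    have e := last j i (by rw [M.symmetric, hm]) σ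
    rw [e] at hσ hσw ⊢
    exact same hω hσ hn (by rw [hσw])
  have eω' : ((α' ++ [j]).map f).prod = ((ρ ++ alternatingWord i j (M i j)).map f).prod := by
    have e := last i j hm ρ
    rw [e] at hρ hρw ⊢
    exact same hω' hρ (by omega) (by rw [hρw, h])
  rw [eω, eω']
  have hprod : cs.wordProd σ = cs.wordProd ρ := by
    have := hσw.trans hρw.symm
    rw [wordProd_append, wordProd_append, cs.wordProd_braidWord_eq j i, mul_left_inj] at this
    exact this
  have hl : σ.length < n := by
    have := hσ.eq
    rw [hσw, hw, hω.eq, List.length_append (as := σ), length_alternatingWord, M.symmetric] at this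
    omega
  have rσ : cs.IsReduced σ := by simpa using hσ.take σ.length
  have rρ : cs.IsReduced ρ := by simpa using hρ.take ρ.length
  rw [List.map_append, List.map_append, List.prod_append, List.prod_append,
    ih σ.length hl rσ rρ hprod rfl]
  congr 1
  exact hf j i

/-- At the first letter where a prefix stops being reduced, the exchange condition removes that
letter and an earlier one. No new letters appear, so words in a subset `T` stay in `T`. -/
theorem exists_shorter_of_not_isReduced {ω : List B} (h : ¬ cs.IsReduced ω) :
    ∃ ω', ω' ⊆ ω ∧ ω'.length < ω.length ∧ cs.wordProd ω' = cs.wordProd ω := by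
  induction ω using List.reverseRecOn with
  | nil => simp [IsReduced] at h
  | append_singleton α i ih =>
    by_cases hα : cs.IsReduced α
    · have hd : cs.IsRightDescent (cs.wordProd α) i := by
        by_contra hd
        rw [not_isRightDescent_iff, hα.eq] at hd
        exact h (by rw [IsReduced, wordProd_append, wordProd_singleton, hd]; simp)
      obtain ⟨k, hk, -, he⟩ := IsRightInversion.exists_eraseIdx cs
        ((cs.isRightInversion_simple_iff_isRightDescent _ _).2 hd)
      refine ⟨α.eraseIdx k, fun x hx ↦ List.mem_append_left _ (List.mem_of_mem_eraseIdx hx), ?_, ?_⟩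
      · rw [List.length_eraseIdx_of_lt hk]; simp
      · rw [← he, wordProd_append, wordProd_singleton]
    · obtain ⟨ω', h1, h2, h3⟩ := ih hα
      refine ⟨ω' ++ [i], ?_, by simpa using h2, by rw [wordProd_append, h3, wordProd_append]⟩
      intro x hx
      rcases List.mem_append.1 hx with hx | hx
      · exact List.mem_append_left _ (h1 hx)
      · exact List.mem_append_right _ hx

theorem exists_isReduced_of_mem_closure {T : Set B} {w : W}
    (hw : w ∈ Subgroup.closure (cs.simple '' T)) :
    ∃ ω, cs.IsReduced ω ∧ (∀ i ∈ ω, i ∈ T) ∧ cs.wordProd ω = w := by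
  have hex : ∃ n, ∃ ω : List B, ω.length = n ∧ (∀ i ∈ ω, i ∈ T) ∧ cs.wordProd ω = w := by
    suffices ∃ ω : List B, (∀ i ∈ ω, i ∈ T) ∧ cs.wordProd ω = w by
      obtain ⟨ω, h⟩ := this; exact ⟨_, ω, rfl, h⟩
    induction hw using Subgroup.closure_induction with
    | mem x hx =>
      obtain ⟨i, hi, rfl⟩ := hx
      exact ⟨[i], by simpa using hi, by simp⟩
    | one => exact ⟨[], by simp, by simp⟩
    | mul x y _ _ hx hy =>
      obtain ⟨ω, h1, rfl⟩ := hx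
      obtain ⟨ω', h1', rfl⟩ := hy
      refine ⟨ω ++ ω', fun i hi ↦ ?_, by rw [wordProd_append]⟩
      exact (List.mem_append.1 hi).elim (h1 i) (h1' i)
    | inv x _ hx =>
      obtain ⟨ω, h1, rfl⟩ := hx
      exact ⟨ω.reverse, by simpa using h1, by rw [wordProd_reverse]⟩
  classical
  obtain ⟨ω, h1, h2, h3⟩ := Nat.find_spec hex
  refine ⟨ω, ?_, h2, h3⟩
  by_contra hred
  obtain ⟨ω', h4, h5, h6⟩ := cs.exists_shorter_of_not_isReduced hred
  exact Nat.find_min hex (h1 ▸ h5) ⟨ω', rfl, fun i hi ↦ h2 i (h4 hi), h6.trans h3⟩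

/-- A reduced word in `T` for `sᵢ` has a single letter, and distinct generators are distinct
elements. -/
theorem simple_mem_closure_iff {T : Set B} {i : B} :
    cs.simple i ∈ Subgroup.closure (cs.simple '' T) ↔ i ∈ T := by
  refine ⟨fun h ↦ ?_, fun h ↦ Subgroup.subset_closure ⟨i, h, rfl⟩⟩
  obtain ⟨ω, h1, h2, h3⟩ := cs.exists_isReduced_of_mem_closure h
  have := h1.eq
  rw [h3, length_simple] at this
  obtain ⟨j, rfl⟩ := List.length_eq_one_iff.1 this.symm
  rw [wordProd_singleton] at h3
  rw [← cs.simple_inj h3]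
  exact h2 j (by simp)

theorem wordProd_mem_closure {T : Set B} {ω : List B} (h : ∀ i ∈ ω, i ∈ T) :
    cs.wordProd ω ∈ Subgroup.closure (cs.simple '' T) := by
  induction ω with
  | nil => simp [one_mem]
  | cons i ω ih =>
    rw [wordProd_cons]
    exact mul_mem (Subgroup.subset_closure ⟨i, h i (by simp), rfl⟩)
      (ih fun j hj ↦ h j (by simp [hj]))

theorem mem_closure_of_mem_rightInvSeq {T : Set B} {ω : List B} (h : ∀ i ∈ ω, i ∈ T) {t : W}
    (ht : t ∈ cs.rightInvSeq ω) : t ∈ Subgroup.closure (cs.simple '' T) := by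
  induction ω with
  | nil => simp at ht
  | cons i ω ih =>
    have hω : ∀ j ∈ ω, j ∈ T := fun j hj ↦ h j (by simp [hj])
    rw [rightInvSeq, List.mem_cons] at ht
    rcases ht with rfl | ht
    · have := cs.wordProd_mem_closure hω
      exact mul_mem (mul_mem (inv_mem this) (Subgroup.subset_closure ⟨i, h i (by simp), rfl⟩)) this
    · exact ih hω ht

end CoxeterSystem

/-! ### Longest elements and central words -/

namespace CoxeterSystem

variable {B W : Type*} [Group W] {M : CoxeterMatrix B} (cs : CoxeterSystem M W)

/-- If all generators in `T` are right descents of `w₀`, then every reduced word in `T` is the tail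
of a reduced word of `w₀`. -/
theorem exists_isReduced_append {T : Set B} {w₀ : W}
    (h₀ : ∀ i ∈ T, cs.IsRightDescent w₀ i) {ω : List B} (hω : cs.IsReduced ω)
    (hT : ∀ i ∈ ω, i ∈ T) :
    ∃ ρ, cs.IsReduced (ρ ++ ω) ∧ cs.wordProd (ρ ++ ω) = w₀ := by
  induction ω using List.reverseRecOn with
  | nil =>
    obtain ⟨ω, hω, rfl⟩ := cs.exists_isReduced w₀
    exact ⟨ω, by simpa using hω, by simp⟩
  | append_singleton ω i ih =>
    have rω : cs.IsReduced ω := by simpa using hω.take ω.length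
    obtain ⟨ρ, hρ, rfl⟩ := ih rω fun j hj ↦ hT j (by simp [hj])
    rw [← List.concat_eq_append]
    -- If `sᵢ` were an inversion of `ω`, the word `ω ++ [i]` would not be reduced.
    refine cs.exists_isReduced_append_concat hρ (h₀ i (hT i (by simp))) fun hmem ↦ ?_
    have := (cs.isRightInversion_of_mem_rightInvSeq rω hmem).2
    rw [← wordProd_singleton, ← wordProd_append, hω.eq, rω.eq] at this
    simp at this

/-- A reduced word of `u` is the tail of a reduced word of `w₀`, and a prefix of a reduced word is
reduced. -/
theorem length_mul_inv_add {T : Set B} {w₀ : W} (h₀ : ∀ i ∈ T, cs.IsRightDescent w₀ i) {u : W}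
    (hu : u ∈ Subgroup.closure (cs.simple '' T)) :
    cs.length (w₀ * u⁻¹) + cs.length u = cs.length w₀ := by
  obtain ⟨ω, h1, h2, rfl⟩ := cs.exists_isReduced_of_mem_closure hu
  obtain ⟨ρ, hρ, rfl⟩ := cs.exists_isReduced_append h₀ h1 h2
  have rρ : cs.IsReduced ρ := by simpa using hρ.take ρ.length
  rw [wordProd_append, mul_inv_cancel_right, rρ.eq, h1.eq, ← wordProd_append, hρ.eq,
    List.length_append]

/-- If `W_T` is finite, then there is a word in `T` with trivial product in the Coxeter group which
is central in the image of `T` under any function satisfying the braid relations, and whose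
inversion sequence contains all generators in `T`. -/
theorem exists_central_word {T : Set B} [Finite (Subgroup.closure (cs.simple '' T))] :
    ∃ ω : List B, (∀ i ∈ ω, i ∈ T) ∧ cs.wordProd ω = 1 ∧
      (∀ i ∈ T, cs.simple i ∈ cs.rightInvSeq ω) ∧
      ∀ {G : Type u} [Group G] (f : B → G),
        (∀ i j, ((braidWord M i j).map f).prod = ((braidWord M j i).map f).prod) →
        ∀ i ∈ T, Commute (f i) (ω.map f).prod := by
  set WT := Subgroup.closure (cs.simple '' T) with hWT
  obtain ⟨⟨w₀, hw₀⟩, hmax⟩ := Finite.exists_max fun w : WT ↦ cs.length (w : W)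
  have hsT {i : B} (hi : i ∈ T) : cs.simple i ∈ WT := Subgroup.subset_closure ⟨i, hi, rfl⟩
  have h₀ : ∀ i ∈ T, cs.IsRightDescent w₀ i := fun i hi ↦
    lt_of_le_of_ne (hmax ⟨_, mul_mem hw₀ (hsT hi)⟩) (cs.length_mul_simple_ne _ _)
  have h₀' : ∀ i ∈ T, cs.length (cs.simple i * w₀) + 1 = cs.length w₀ := fun i hi ↦ by
    have h1 : cs.length (cs.simple i * w₀) ≤ cs.length w₀ := hmax ⟨_, mul_mem (hsT hi) hw₀⟩
    have := cs.length_simple_mul w₀ i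
    omega
  -- Conjugation by the longest element permutes the generators in `T`: the conjugate `t` satisfies
  -- `ℓ (w₀ t) = ℓ w₀ - ℓ t` and `w₀ t = sᵢ w₀` has length `ℓ w₀ - 1`, so `ℓ t = 1`.
  have hconj : ∀ i ∈ T, ∃ j ∈ T, cs.simple i * w₀ = w₀ * cs.simple j := by
    intro i hi
    set t := w₀⁻¹ * cs.simple i * w₀ with ht
    have hwt : cs.simple i * w₀ = w₀ * t := by rw [ht]; group
    have htt : t⁻¹ = t := by rw [ht]; simp [mul_assoc]
    have htT : t ∈ WT := mul_mem (mul_mem (inv_mem hw₀) (hsT hi)) hw₀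
    have h1 := cs.length_mul_inv_add h₀ htT
    have h2 := h₀' i hi
    rw [htt] at h1
    rw [hwt] at h2
    obtain ⟨j, hj⟩ := cs.length_eq_one_iff.1 (show cs.length t = 1 by omega)
    exact ⟨j, cs.simple_mem_closure_iff.1 (hj ▸ htT), by rw [hwt, hj]⟩
  obtain ⟨δ, hδ, hδT, hδw⟩ := cs.exists_isReduced_of_mem_closure hw₀
  have hfin : IsOfFinOrder w₀ := by
    have := isOfFinOrder_of_finite (⟨w₀, hw₀⟩ : WT)
    exact Submonoid.isOfFinOrder_coe.2 this
  -- The `N`-fold repetition of `δ` has trivial product in `W`, and the permutation of `T` that it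
  -- induces is trivial as well.
  obtain ⟨N, hN, hwN⟩ := isOfFinOrder_iff_pow_eq_one.1 hfin
  have hpow {G : Type u} [Group G] (f : B → G) (n : ℕ) :
      ((List.replicate n δ).flatten.map f).prod = (δ.map f).prod ^ n := by
    simp [List.map_flatten, List.prod_flatten]
  have hpowW (n : ℕ) : cs.wordProd (List.replicate n δ).flatten = w₀ ^ n := by
    rw [← hδw]; simp [wordProd, List.map_flatten, List.prod_flatten]
  refine ⟨(List.replicate N δ).flatten, ?_, by rw [hpowW, hwN], ?_, ?_⟩
  · intro i hi
    obtain ⟨l, hl, hil⟩ := List.mem_flatten.1 hi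
    rw [List.eq_of_mem_replicate hl] at hil
    exact hδT i hil
  · intro i hi
    obtain ⟨n, rfl⟩ := Nat.exists_eq_succ_of_ne_zero hN.ne'
    have h1 : cs.simple i ∈ cs.rightInvSeq δ := IsRightInversion.mem_rightInvSeq cs
      ((cs.isRightInversion_simple_iff_isRightDescent _ _).2 (hδw ▸ h₀ i hi))
    rw [List.replicate_succ', List.flatten_append, List.flatten_singleton]
    have h2 := cs.rightInvSeq_drop ((List.replicate n δ).flatten ++ δ)
      (List.replicate n δ).flatten.length
    rw [List.drop_left] at h2
    rw [h2] at h1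
    exact List.mem_of_mem_drop h1
  · intro G _ f hf i hi
    rw [hpow]
    set D := (δ.map f).prod with hD
    -- With `η` reduced for `sᵢ w₀ = w₀ sⱼ`, both `i η` and `η j` are reduced words of `w₀`.
    -- Matsumoto's theorem gives `D = f i · η = η · f j` in the target, whence `f i · D = D · f j`.
    have step : ∀ i ∈ T, ∃ j ∈ T, cs.simple i * w₀ = w₀ * cs.simple j ∧ f i * D = D * f j := by
      intro i hi
      obtain ⟨j, hj, hij⟩ := hconj i hi
      refine ⟨j, hj, hij, ?_⟩
      obtain ⟨η, hη, hηw⟩ := cs.exists_isReduced (cs.simple i * w₀)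
      have e1 : cs.wordProd (i :: η) = w₀ := by
        rw [wordProd_cons, ← hηw, simple_mul_simple_cancel_left]
      have e2 : cs.wordProd (η ++ [j]) = w₀ := by
        rw [wordProd_append, ← hηw, hij, wordProd_singleton, simple_mul_simple_cancel_right]
      have hl : η.length + 1 = cs.length w₀ := by rw [← hη.eq, ← hηw, h₀' i hi]
      have r1 : cs.IsReduced (i :: η) := by rw [IsReduced, e1, ← hl]; simp
      have r2 : cs.IsReduced (η ++ [j]) := by rw [IsReduced, e2, ← hl]; simp
      have p1 := cs.prod_map_eq_of_isReduced f hf hδ r1 (hδw.trans e1.symm)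
      have p2 := cs.prod_map_eq_of_isReduced f hf hδ r2 (hδw.trans e2.symm)
      rw [← hD] at p1 p2
      rw [List.map_cons, List.prod_cons] at p1
      rw [List.map_append, List.prod_append, List.map_singleton, List.prod_singleton] at p2
      conv_lhs => rw [p2]
      rw [← mul_assoc, ← p1]
    have steps (n : ℕ) : ∀ i ∈ T, ∃ j ∈ T,
        cs.simple i * w₀ ^ n = w₀ ^ n * cs.simple j ∧ f i * D ^ n = D ^ n * f j := by
      induction n with
      | zero => exact fun i hi ↦ ⟨i, hi, by simp, by simp⟩
      | succ n ih =>
        intro i hi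
        obtain ⟨j, hj, h1, h2⟩ := ih i hi
        obtain ⟨k, hk, h3, h4⟩ := step j hj
        refine ⟨k, hk, ?_, ?_⟩
        · rw [pow_succ, ← mul_assoc, h1, mul_assoc, h3, mul_assoc]
        · rw [pow_succ, ← mul_assoc, h2, mul_assoc, h4, mul_assoc]
    obtain ⟨j, -, h1, h2⟩ := steps N i hi
    rw [hwN, mul_one, one_mul] at h1
    rw [← cs.simple_inj h1] at h2
    exact h2

end CoxeterSystem

/-! ### Free abelian subgroups of pure Artin groups and their characters -/

/-- A free abelian subgroup of rank `m` of `G`, parametrised by `θ`, which is detected by integral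
characters `φ i` of a subgroup `H` that contains it. -/
def HasDetectedTorus (G : Type u) [Group G] (m : ℕ) : Prop :=
  ∃ (H : Subgroup G) (θ : Multiplicative (Fin m → ℤ) →* H) (φ : Fin m → H →* Multiplicative ℤ),
    (Matrix.of fun i j : Fin m ↦
      (φ i (θ (Multiplicative.ofAdd (Pi.single j 1)))).toAdd).det ≠ 0

namespace CoxeterMatrix

open CoxeterSystem

variable {B : Type u} (M : CoxeterMatrix B)

/-- The homomorphism from the Artin group given by images of the generators that satisfy the braid
relations. -/
def artinLift {G : Type*} [Group G] (f : B → G)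
    (hf : ∀ i j, ((braidWord M i j).map f).prod = ((braidWord M j i).map f).prod) :
    M.ArtinGroup →* G :=
  PresentedGroup.toGroup (f := f) (by
    rintro _ ⟨i, j, rfl⟩
    rw [map_mul, map_inv, map_list_prod, map_list_prod, List.map_map, List.map_map]
    have : (FreeGroup.lift f : FreeGroup B → G) ∘ FreeGroup.of = f := by ext; simp
    rw [this, hf, mul_inv_cancel])

theorem artinLift_of {G : Type*} [Group G] (f : B → G)
    (hf : ∀ i j, ((braidWord M i j).map f).prod = ((braidWord M j i).map f).prod) (i : B) :
    M.artinLift f hf (PresentedGroup.of i) = f i :=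
  PresentedGroup.toGroup.of _

theorem artinLift_prod {G : Type*} [Group G] (f : B → G)
    (hf : ∀ i j, ((braidWord M i j).map f).prod = ((braidWord M j i).map f).prod) (ω : List B) :
    M.artinLift f hf ((ω.map PresentedGroup.of).prod) = (ω.map f).prod := by
  rw [map_list_prod, List.map_map]
  congr 1
  exact List.map_congr_left fun i _ ↦ M.artinLift_of f hf i

theorem artin_braid (i j : B) :
    ((braidWord M i j).map (PresentedGroup.of (rels := M.artinRelators))).prod =
      ((braidWord M j i).map PresentedGroup.of).prod := by
  have h : PresentedGroup.mk M.artinRelators (((braidWord M i j).map FreeGroup.of).prod *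
      (((braidWord M j i).map FreeGroup.of).prod)⁻¹) = 1 :=
    PresentedGroup.one_of_mem ⟨i, j, rfl⟩
  rw [map_mul, map_inv, mul_inv_eq_one, map_list_prod, map_list_prod, List.map_map,
    List.map_map] at h
  exact h

/-- The projection from the Artin group to the Coxeter group. -/
def artinToCoxeter : M.ArtinGroup →* M.Group :=
  M.artinLift M.toCoxeterSystem.simple M.toCoxeterSystem.wordProd_braidWord_eq

theorem artinToCoxeter_of (i : B) :
    M.artinToCoxeter (PresentedGroup.of i) = M.toCoxeterSystem.simple i :=
  M.artinLift_of _ _ i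

theorem artinToCoxeter_prod (ω : List B) :
    M.artinToCoxeter ((ω.map PresentedGroup.of).prod) = M.toCoxeterSystem.wordProd ω :=
  M.artinLift_prod _ _ ω

open Classical in
-- Both braid words list the same dihedral reflections, in opposite orders. The integral count is
-- therefore invariant under braid relations, whereas only its parity survives `sᵢ² = 1`.
theorem count_rightInvSeq_braidWord (i j : B) (t : M.Group) :
    (M.toCoxeterSystem.rightInvSeq (braidWord M i j)).count t =
      (M.toCoxeterSystem.rightInvSeq (braidWord M j i)).count t := by
  set cs := M.toCoxeterSystem
  rw [braidWord, braidWord, rightInvSeq_alternatingWord, rightInvSeq_alternatingWord,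
    List.count_reverse, ← List.map_reverse, M.symmetric j i]
  congr 1
  refine List.ext_getElem (by simp) fun k hk _ ↦ ?_
  simp only [List.length_map, List.length_range] at hk
  simp only [List.getElem_map, List.getElem_range, List.getElem_reverse, List.length_range]
  obtain ⟨q, hq⟩ : ∃ q, q = cs.simple i * cs.simple j := ⟨_, rfl⟩
  have h1 : cs.simple i = cs.simple j * q⁻¹ := by simp [hq]
  have h2 : cs.simple j * cs.simple i = q⁻¹ := by simp [hq]
  have h3 : q ^ M i j = 1 := hq ▸ cs.simple_mul_simple_pow i j
  rw [h2, ← hq, h1, mul_assoc, ← pow_succ', inv_pow, mul_right_inj, eq_inv_iff_mul_eq_one,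
    ← pow_add, show k + (M i j - 1 - k + 1) = M i j by omega, h3]

/-- The action of the Artin group on pairs of an element of the Coxeter group and an integer, the
latter counting inversions. -/
noncomputable def artinCount : M.ArtinGroup →* Equiv.Perm (M.Group × ℤ) :=
  M.artinLift (M.toCoxeterSystem.countPerm ℤ) fun i j ↦ by
    ext1 ⟨t, z⟩
    classical
    rw [prod_map_countPerm_apply, prod_map_countPerm_apply, wordProd_braidWord_eq,
      count_rightInvSeq_braidWord]

theorem artinCount_of (i : B) :
    M.artinCount (PresentedGroup.of i) = M.toCoxeterSystem.countPerm ℤ i :=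
  M.artinLift_of _ _ i

theorem artinCount_prod (ω : List B) : M.artinCount ((ω.map PresentedGroup.of).prod) =
    (ω.map (M.toCoxeterSystem.countPerm ℤ)).prod :=
  M.artinLift_prod _ _ ω

/-- The action commutes with translations of the integer. Elements of the kernel of `artinToCoxeter`
fix `t`, so on them the increment is additive. -/
theorem artinCount_apply (a : M.ArtinGroup) (t : M.Group) (z : ℤ) :
    M.artinCount a (t, z) = (M.artinToCoxeter a * t * (M.artinToCoxeter a)⁻¹,
      z + (M.artinCount a (t, 0)).2) := by
  have ha : a ∈ Subgroup.closure (Set.range (PresentedGroup.of (rels := M.artinRelators))) := by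
    rw [PresentedGroup.closure_range_of]; trivial
  induction ha using Subgroup.closure_induction generalizing t z with
  | mem x hx =>
    obtain ⟨i, rfl⟩ := hx
    simp only [artinCount_of, artinToCoxeter_of, countPerm, Equiv.coe_fn_mk, zero_add,
      inv_simple]
  | one => simp
  | mul x y _ _ hx hy =>
    rw [map_mul, Equiv.Perm.mul_apply, Equiv.Perm.mul_apply, hy t z, hy t 0, hx,
      hx _ (0 + _)]
    refine Prod.ext ?_ ?_
    · simp [mul_assoc]
    · simp [add_assoc]
  | inv x _ hx =>
    have key : ∀ t z, M.artinCount x⁻¹ (t, z) =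
        ((M.artinToCoxeter x)⁻¹ * t * M.artinToCoxeter x,
          z - (M.artinCount x ((M.artinToCoxeter x)⁻¹ * t * M.artinToCoxeter x, 0)).2) := by
      intro t z
      rw [map_inv, Equiv.Perm.inv_eq_iff_eq, hx]
      refine Prod.ext ?_ (by simp)
      simp only; group
    rw [key, key t 0]
    refine Prod.ext (by simp) (by simp [sub_eq_add_neg])

/-- For a fixed element `t` of the Coxeter group, the number of times that `t` occurs as an
inversion is a character of the pure Artin group. -/
noncomputable def pureArtinCharacter (t : M.Group) : M.artinToCoxeter.ker →* Multiplicative ℤ where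
  toFun h := Multiplicative.ofAdd (M.artinCount h (t, 0)).2
  map_one' := by simp
  map_mul' x y := by
    have hy : M.artinToCoxeter y = 1 := y.2
    rw [Subgroup.coe_mul, map_mul, Equiv.Perm.mul_apply, M.artinCount_apply y, hy,
      M.artinCount_apply x, ← ofAdd_add]
    simp [add_comm]

/-- For `j ≤ k` the letters of the central word of `U j` lie in `U k`, so the central words of a
flag of subsets commute. Their inversion counts at the simple reflections of `T` form the matrix to
be tested. -/
theorem hasDetectedTorus_artinGroup {T : Finset B} (hT : M.IsSpherical T) :
    HasDetectedTorus M.ArtinGroup T.card := by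
  classical
  set cs := M.toCoxeterSystem with hcs
  have hsimple : M.simple = cs.simple := by
    ext i; exact (congrFun (M.toCoxeterSystem_simple) i).symm
  let e : Fin T.card ≃ T := T.equivFin.symm
  let U (k : Fin T.card) : Set B := {b | ∃ j ≤ k, (e j : B) = b}
  have hUT (k : Fin T.card) : U k ⊆ T := by rintro _ ⟨j, -, rfl⟩; exact (e j).2
  have heU (j k : Fin T.card) : (e j : B) ∈ U k ↔ j ≤ k := by
    refine ⟨?_, fun h ↦ ⟨j, h, rfl⟩⟩
    rintro ⟨i, hi, h⟩
    rwa [← e.injective (Subtype.ext h)]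
  have hfin (k : Fin T.card) : Finite (Subgroup.closure (cs.simple '' U k)) := by
    have : Finite (M.specialSubgroup (T : Set B)) := hT
    have hle : Subgroup.closure (cs.simple '' U k) ≤ M.specialSubgroup (T : Set B) := by
      rw [specialSubgroup, hsimple]
      exact Subgroup.closure_mono (Set.image_mono (hUT k))
    exact Finite.of_injective _ (Subgroup.inclusion_injective hle)
  choose ω hω1 hω2 hω3 hω4 using fun k ↦ by
    have := hfin k
    exact cs.exists_central_word.{u} (T := U k)
  let a : B → M.ArtinGroup := PresentedGroup.of
  let g (k : Fin T.card) : M.artinToCoxeter.ker := ⟨((ω k).map a).prod, by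
    rw [MonoidHom.mem_ker, artinToCoxeter_prod]; exact hω2 k⟩
  have hcomm' (j k : Fin T.card) (hjk : j ≤ k) : Commute (g j) (g k) := by
    refine Subtype.ext ?_
    change Commute ((ω j).map a).prod ((ω k).map a).prod
    refine Commute.list_prod_left _ _ ?_
    intro x hx
    obtain ⟨i, hi, rfl⟩ := List.mem_map.1 hx
    obtain ⟨l, hl, rfl⟩ := hω1 j i hi
    exact hω4 k a M.artin_braid _ ⟨l, hl.trans hjk, rfl⟩
  have hcomm (j k : Fin T.card) : Commute (g j) (g k) :=
    (le_total j k).elim (hcomm' j k) fun h ↦ (hcomm' k j h).symm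
  let θ' : (Fin T.card → Multiplicative ℤ) →* M.artinToCoxeter.ker :=
    MonoidHom.noncommPiCoprod (fun k ↦ zpowersHom _ (g k)) (by
      intro j k _ x y
      simp only [zpowersHom_apply]
      exact (hcomm j k).zpow_zpow _ _)
  let τ : Multiplicative (Fin T.card → ℤ) →* (Fin T.card → Multiplicative ℤ) :=
    { toFun := fun v k ↦ Multiplicative.ofAdd (v.toAdd k)
      map_one' := rfl
      map_mul' := fun _ _ ↦ rfl }
  refine ⟨M.artinToCoxeter.ker, θ'.comp τ, fun i ↦ M.pureArtinCharacter (cs.simple (e i)), ?_⟩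
  have hτ (j : Fin T.card) : τ (Multiplicative.ofAdd (Pi.single j 1)) =
      Pi.mulSingle j (Multiplicative.ofAdd 1) := by
    ext k
    change (Pi.single j 1 : Fin T.card → ℤ) k = _
    by_cases h : k = j
    · subst h; simp
    · simp [h]
  have hentry (i j : Fin T.card) : (M.pureArtinCharacter (cs.simple (e i))
      ((θ'.comp τ) (Multiplicative.ofAdd (Pi.single j 1)))).toAdd =
      (cs.rightInvSeq (ω j)).count (cs.simple (e i)) := by
    have hθ : θ' (Pi.mulSingle j (Multiplicative.ofAdd 1)) = g j := by
      refine (MonoidHom.noncommPiCoprod_mulSingle _ _ _).trans ?_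
      simp
    rw [MonoidHom.comp_apply, hτ, hθ]
    change (M.artinCount ((ω j).map PresentedGroup.of).prod (_, 0)).2 = _
    rw [artinCount_prod, prod_map_countPerm_apply, zero_add]
  -- Inversions of a word in `U j` lie in the subgroup generated by `U j`, which contains the simple
  -- reflection of `e i` only for `i ≤ j`.
  have htri : (Matrix.of fun i j : Fin T.card ↦ (M.pureArtinCharacter (cs.simple (e i))
      ((θ'.comp τ) (Multiplicative.ofAdd (Pi.single j 1)))).toAdd).BlockTriangular id := by
    intro i j hij
    rw [Matrix.of_apply, hentry, Nat.cast_eq_zero, List.count_eq_zero]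
    intro hmem
    have := (cs.simple_mem_closure_iff).1 (cs.mem_closure_of_mem_rightInvSeq (hω1 j) hmem)
    exact absurd ((heU i j).1 this) (not_le.2 hij)
  rw [Matrix.det_of_isUpperTriangular htri, Finset.prod_ne_zero_iff]
  intro i _
  rw [Matrix.of_apply, hentry, Nat.cast_ne_zero, ← pos_iff_ne_zero, List.count_pos_iff]
  exact hω3 i _ ((heU i i).2 le_rfl)

end CoxeterMatrix

/-! ### Cup products of coboundaries on a triangulated torus -/

namespace DiscreteCochain

variable {P : Type*}

/-- The simplicial coboundary of a function of `k` points. -/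
def coboundary {k : ℕ} (c : (Fin k → P) → ℤ) (p : Fin (k + 1) → P) : ℤ :=
  ∑ j : Fin (k + 1), (-1) ^ (j : ℕ) * c (p ∘ j.succAbove)

/-- The cup product of the coboundaries of `m` functions. -/
def cup {m : ℕ} (Ψ : Fin m → P → ℤ) (p : Fin (m + 1) → P) : ℤ :=
  ∏ i : Fin m, (Ψ i (p i.succ) - Ψ i (p i.castSucc))

/-- The cup product of the coboundary of a function with a cochain. -/
def differenceCup {k : ℕ} (ψ : P → ℤ) (b : (Fin (k + 1) → P) → ℤ) (p : Fin (k + 2) → P) : ℤ :=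
  (ψ (p 1) - ψ (p 0)) * b (p ∘ Fin.succ)

/-- The cup product of a function with a cochain. -/
def smulCup {k : ℕ} (f : P → ℤ) (b : (Fin (k + 1) → P) → ℤ) (p : Fin (k + 1) → P) : ℤ :=
  f (p 0) * b p

theorem cup_succ {m : ℕ} (Ψ : Fin (m + 1) → P → ℤ) :
    cup Ψ = differenceCup (Ψ 0) (cup fun i ↦ Ψ i.succ) := by
  ext p
  rw [cup, Fin.prod_univ_succ]
  rfl

theorem coboundary_succ {k : ℕ} (c : (Fin k → P) → ℤ) (p : Fin (k + 1) → P) :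
    coboundary c p = c (p ∘ Fin.succ) -
      ∑ j : Fin k, (-1) ^ (j : ℕ) * c (p ∘ j.succ.succAbove) := by
  rw [coboundary, Fin.sum_univ_succ, sub_eq_add_neg, ← Finset.sum_neg_distrib]
  congr 1
  · simp [Fin.succAbove_zero]
  · exact Finset.sum_congr rfl fun j _ ↦ by simp [pow_succ]

/-- The Leibniz rule for the cocycle `dψ`. The faces omitting points `0` and `1` combine through
`(ψ₂ - ψ₁) - (ψ₂ - ψ₀) = -(ψ₁ - ψ₀)` to the first face of `b`. -/
theorem coboundary_differenceCup {k : ℕ} (ψ : P → ℤ) (b : (Fin (k + 1) → P) → ℤ) :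
    coboundary (differenceCup ψ b) = -differenceCup ψ (coboundary b) := by
  ext p
  have h (i : Fin (k + 1)) : differenceCup ψ b (p ∘ i.succ.succ.succAbove) =
      (ψ (p 1) - ψ (p 0)) * b ((p ∘ Fin.succ) ∘ i.succ.succAbove) := by
    have h1 : i.succ.succ.succAbove 1 = 1 := by
      rw [← Fin.succ_zero_eq_one, Fin.succ_succAbove_succ, Fin.succ_succAbove_zero]; rfl
    simp only [differenceCup, Function.comp_apply, Fin.succ_succAbove_zero, h1]
    congr 2
    ext l
    simp [Fin.succ_succAbove_succ]
  have e1 : (p ∘ (1 : Fin (k + 3)).succAbove) ∘ Fin.succ = (p ∘ Fin.succ) ∘ Fin.succ := by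
    ext l
    change p ((Fin.succ (0 : Fin (k + 2))).succAbove l.succ) = _
    simp
  have e2 : (1 : Fin (k + 3)).succAbove 1 = 2 := by
    change (Fin.succ (0 : Fin (k + 2))).succAbove (Fin.succ 0) = _
    rw [Fin.succ_succAbove_succ]; rfl
  have e4 : (1 : Fin (k + 3)).succAbove 0 = 0 := rfl
  have e3 : (Fin.succ (1 : Fin (k + 2))) = 2 := rfl
  rw [coboundary_succ, Fin.sum_univ_succ, Pi.neg_apply]
  conv_rhs => rw [differenceCup, coboundary_succ, mul_sub, Finset.mul_sum]
  simp only [h]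
  simp only [differenceCup, Function.comp_apply, Fin.succ_zero_eq_one, e1, e2, e4, Fin.val_zero, Fin.val_succ, pow_succ, pow_zero, e3, one_mul]
  rw [Finset.sum_congr rfl fun (i : Fin (k + 1)) _ ↦ show
    (-1 : ℤ) ^ (i : ℕ) * -1 * ((ψ (p 1) - ψ (p 0)) * b ((p ∘ Fin.succ) ∘ i.succ.succAbove)) =
      -((ψ (p 1) - ψ (p 0)) * ((-1) ^ (i : ℕ) * b ((p ∘ Fin.succ) ∘ i.succ.succAbove))) by ring,
    Finset.sum_neg_distrib]
  ring

theorem coboundary_smulCup {k : ℕ} (f : P → ℤ) (b : (Fin (k + 1) → P) → ℤ) :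
    coboundary (smulCup f b) = differenceCup f b + smulCup f (coboundary b) := by
  ext p
  rw [coboundary_succ, Pi.add_apply]
  conv_rhs => rw [smulCup, coboundary_succ, mul_sub, Finset.mul_sum]
  simp only [smulCup, differenceCup, Function.comp_apply, Fin.succ_succAbove_zero,
    Fin.succ_zero_eq_one]
  rw [Finset.sum_congr rfl fun (i : Fin (k + 1)) _ ↦ mul_left_comm _ (f (p 0)) _]
  ring

theorem coboundary_cup {m : ℕ} (Ψ : Fin m → P → ℤ) : coboundary (cup Ψ) = 0 := by
  induction m with
  | zero => ext p; simp [coboundary, cup, Fin.sum_univ_two]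
  | succ m ih =>
    rw [cup_succ, coboundary_differenceCup, ih]
    ext p; simp [differenceCup]

theorem coboundary_sub {k : ℕ} (b c : (Fin k → P) → ℤ) :
    coboundary (b - c) = coboundary b - coboundary c := by
  ext p; simp [coboundary, mul_sub]

/-- Two cup products of coboundaries of functions with invariant pairwise differences are
cohomologous through an invariant cochain. -/
theorem exists_cup_sub_cup_eq_coboundary {I : Type*} (act : I → P → P) {m : ℕ}
    (Ψ Ψ' : Fin (m + 1) → P → ℤ)
    (h : ∀ i γ a b, Ψ i (act γ a) - Ψ i (act γ b) = Ψ i a - Ψ i b)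
    (h' : ∀ i γ a b, Ψ' i (act γ a) - Ψ' i (act γ b) = Ψ' i a - Ψ' i b)
    (hf : ∀ i γ a, Ψ i (act γ a) - Ψ' i (act γ a) = Ψ i a - Ψ' i a) :
    ∃ c : (Fin (m + 1) → P) → ℤ, (∀ γ p, c (act γ ∘ p) = c p) ∧
      cup Ψ - cup Ψ' = coboundary c := by
  -- The factors are exchanged one at a time. Changing the first costs the coboundary of `(Ψ₀ -
  -- Ψ'₀)` times a cocycle, invariant since the difference is; the others are handled by induction.
  have key {m : ℕ} (Ψ Ψ' : Fin (m + 1) → P → ℤ) : cup Ψ - cup Ψ' =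
      differenceCup (Ψ 0) (cup (fun i ↦ Ψ i.succ) - cup (fun i ↦ Ψ' i.succ)) +
        coboundary (smulCup (Ψ 0 - Ψ' 0) (cup fun i ↦ Ψ' i.succ)) := by
    rw [cup_succ, cup_succ, coboundary_smulCup, coboundary_cup]
    ext p
    simp [differenceCup, smulCup]
    ring
  have hinv {m : ℕ} (Ψ : Fin m → P → ℤ)
      (h : ∀ i γ a b, Ψ i (act γ a) - Ψ i (act γ b) = Ψ i a - Ψ i b) (γ : I)
      (p : Fin (m + 1) → P) : cup Ψ (act γ ∘ p) = cup Ψ p :=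
    Finset.prod_congr rfl fun i _ ↦ h _ _ _ _
  have hinv' {m : ℕ} (Ψ Ψ' : Fin (m + 1) → P → ℤ)
      (h' : ∀ i γ a b, Ψ' i (act γ a) - Ψ' i (act γ b) = Ψ' i a - Ψ' i b)
      (hf : ∀ i γ a, Ψ i (act γ a) - Ψ' i (act γ a) = Ψ i a - Ψ' i a) (γ : I)
      (p : Fin (m + 1) → P) : smulCup (Ψ 0 - Ψ' 0) (cup fun i ↦ Ψ' i.succ) (act γ ∘ p) =
        smulCup (Ψ 0 - Ψ' 0) (cup fun i ↦ Ψ' i.succ) p := by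
    rw [smulCup, hinv _ fun i ↦ h' i.succ]
    simp [smulCup, hf]
  induction m with
  | zero =>
    refine ⟨_, hinv' Ψ Ψ' h' hf, (key Ψ Ψ').trans ?_⟩
    rw [add_eq_right]
    ext p; simp [differenceCup, cup]
  | succ m ih =>
    obtain ⟨c, hc, hc'⟩ := ih (fun i ↦ Ψ i.succ) (fun i ↦ Ψ' i.succ) (fun i ↦ h i.succ)
      (fun i ↦ h' i.succ) (fun i ↦ hf i.succ)
    refine ⟨smulCup (Ψ 0 - Ψ' 0) (cup fun i ↦ Ψ' i.succ) - differenceCup (Ψ 0) c, ?_, ?_⟩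
    · intro γ p
      rw [Pi.sub_apply, Pi.sub_apply, hinv' Ψ Ψ' h' hf γ p, differenceCup, differenceCup,
        Function.comp_assoc, hc]
      simp only [Function.comp_apply, h]
    · rw [key, hc', coboundary_sub, coboundary_differenceCup, sub_neg_eq_add]
      abel

/-- The vertices of the simplex of Kuhn's triangulation of the cube based at `x` that is given by
the permutation `σ`. -/
def kuhn {m : ℕ} (x : Fin m → ℤ) (σ : Equiv.Perm (Fin m)) (i : Fin (m + 1)) (k : Fin m) : ℤ :=
  x k + if (σ.symm k : ℕ) < i then 1 else 0

theorem kuhn_add {m : ℕ} (x v : Fin m → ℤ) (σ : Equiv.Perm (Fin m)) (i : Fin (m + 1)) :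
    kuhn (x + v) σ i = kuhn x σ i + v := by
  ext k; simp [kuhn]; ring

/-- The vector in the period box of side `N`. -/
def boxPoint {m N : ℕ} (x : Fin m → Fin N) (k : Fin m) : ℤ := (x k : ℕ)

/-- A periodic function is summed over the residues modulo `N`, which a translation permutes. -/
theorem sum_boxPoint_add {m N : ℕ} [NeZero N] (g : (Fin m → ℤ) → ℤ)
    (hg : ∀ x v, g (x + N • v) = g x) (w : Fin m → ℤ) :
    ∑ x : Fin m → Fin N, g (boxPoint x + w) = ∑ x : Fin m → Fin N, g (boxPoint x) := by
  let w' : Fin m → Fin N := fun k ↦ Fin.ofNat N (w k % N).toNat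
  refine Fintype.sum_equiv (Equiv.addRight w') _ _ fun x ↦ ?_
  have hN : (0 : ℤ) < N := by exact_mod_cast Nat.pos_of_ne_zero (NeZero.ne N)
  have : boxPoint x + w = boxPoint (x + w') + N • fun k ↦ (((x k : ℕ) : ℤ) + w k) / N := by
    ext k
    have h1 : (((w k % N).toNat : ℕ) : ℤ) = w k % N := Int.toNat_of_nonneg (Int.emod_nonneg _ hN.ne')
    have h2 := Int.emod_add_mul_ediv ((x k : ℕ) + w k : ℤ) N
    simp only [boxPoint, Pi.add_apply, Pi.mul_apply, Pi.natCast_apply, Fin.val_add, w', Fin.ofNat, Nat.cast_add,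
      Int.natCast_mod, h1, Int.emod_emod, Int.add_emod_emod, nsmul_eq_mul]
    linarith
  rw [this, hg]; rfl

/-- The fundamental chain of the torus, subdivided, is a cycle. -/
theorem sum_kuhn_coboundary {m N : ℕ} [NeZero N] (c : (Fin (m + 1) → Fin (m + 1) → ℤ) → ℤ)
    (hc : ∀ p v, c (fun i ↦ p i + N • v) = c p) :
    ∑ x : Fin (m + 1) → Fin N, ∑ σ : Equiv.Perm (Fin (m + 1)),
      (σ.sign : ℤ) * coboundary c (kuhn (boxPoint x) σ) = 0 := by
  -- A face that omits an intermediate vertex belongs to two simplices of the same cube, whose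
  -- permutations differ by a transposition; the signs cancel.
  have inner (x : Fin (m + 1) → ℤ) (j : Fin m) :
      ∑ σ : Equiv.Perm (Fin (m + 1)),
        (σ.sign : ℤ) * c (kuhn x σ ∘ j.castSucc.succ.succAbove) = 0 := by
    have hne : j.castSucc ≠ j.succ := (Fin.castSucc_lt_succ).ne
    have := Fintype.sum_equiv (Equiv.mulRight (Equiv.swap j.castSucc j.succ))
      (fun σ : Equiv.Perm (Fin (m + 1)) ↦
        -((σ.sign : ℤ) * c (kuhn x σ ∘ j.castSucc.succ.succAbove)))
      (fun σ ↦ (σ.sign : ℤ) * c (kuhn x σ ∘ j.castSucc.succ.succAbove)) (fun σ ↦ by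
        simp only [Equiv.coe_mulRight, Equiv.Perm.sign_mul, Equiv.Perm.sign_swap hne]
        have : kuhn x (σ * Equiv.swap j.castSucc j.succ) ∘ j.castSucc.succ.succAbove =
            kuhn x σ ∘ j.castSucc.succ.succAbove := by
          ext l k
          have hl := Fin.succAbove_ne j.castSucc.succ l
          simp only [kuhn, Function.comp_apply]
          generalize j.castSucc.succ.succAbove l = i at hl
          have hi : (i : ℕ) ≠ j + 1 := fun h ↦ hl (Fin.ext (by simpa using h))
          congr 1
          have e : (σ * Equiv.swap j.castSucc j.succ).symm k =
            Equiv.swap j.castSucc j.succ (σ.symm k) := rfl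
          rw [e]
          generalize σ.symm k = a
          refine if_congr ?_ rfl rfl
          rw [Equiv.swap_apply_def]
          split_ifs with h1 h2
          · subst h1; simp; omega
          · subst h2; simp; omega
          · rfl
        rw [this]; simp)
    rw [Finset.sum_neg_distrib] at this
    omega
  -- The face opposite the first vertex is the face opposite the last vertex of a simplex in the
  -- cube shifted by the unit vector of `σ 0`. The permutation changes by a rotation of sign `(-1) ^
  -- m`.
  have outer : ∑ x : Fin (m + 1) → Fin N, ∑ σ : Equiv.Perm (Fin (m + 1)),
      (σ.sign : ℤ) * c (kuhn (boxPoint x) σ ∘ Fin.succ) =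
      (-1) ^ m * ∑ x : Fin (m + 1) → Fin N, ∑ σ : Equiv.Perm (Fin (m + 1)),
      (σ.sign : ℤ) * c (kuhn (boxPoint x) σ ∘ Fin.castSucc) := by
    rw [Finset.sum_comm, Finset.sum_comm (f := fun (x : Fin (m + 1) → Fin N)
      (σ : Equiv.Perm (Fin (m + 1))) ↦ (σ.sign : ℤ) * c (kuhn (boxPoint x) σ ∘ Fin.castSucc)),
      Finset.mul_sum]
    refine Fintype.sum_equiv (Equiv.mulRight (finRotate (m + 1))) _ _ fun σ ↦ ?_
    simp only [Equiv.coe_mulRight]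
    set σ' := σ * finRotate (m + 1)
    have hs (x : Fin (m + 1) → ℤ) : kuhn x σ ∘ Fin.succ =
        kuhn (x + Pi.single (σ 0) 1) σ' ∘ Fin.castSucc := by
      ext l k
      simp only [kuhn, Function.comp_apply, Pi.add_apply]
      obtain ⟨a, rfl⟩ : ∃ a, k = σ' a := ⟨_, (σ'.apply_symm_apply k).symm⟩
      have e : σ.symm (σ' a) = finRotate (m + 1) a := by simp [σ']
      have e2 : (Pi.single (σ 0) 1 : Fin (m + 1) → ℤ) (σ' a) =
          if finRotate (m + 1) a = 0 then 1 else 0 := by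
        rw [Pi.single_apply]
        exact if_congr (by simp [σ']) rfl rfl
      rw [e, e2, Equiv.symm_apply_apply]
      rcases eq_or_ne a (Fin.last m) with rfl | ha
      · simp; omega
      · have h1 : ((finRotate (m + 1) a : Fin (m + 1)) : ℕ) = a + 1 :=
          coe_finRotate_of_ne_last ha
        have h2 : finRotate (m + 1) a ≠ 0 := fun h ↦ by rw [h] at h1; simp at h1
        rw [if_neg h2, h1]
        simp
    have ht := sum_boxPoint_add (N := N) (fun x ↦ c (kuhn x σ' ∘ Fin.castSucc)) (by
      intro x v
      rw [← hc (kuhn x σ' ∘ Fin.castSucc) v]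
      congr 1
      ext l : 1
      exact kuhn_add _ _ _ _) (Pi.single (σ 0) 1)
    simp only [hs]
    rw [← Finset.mul_sum, ht, ← Finset.mul_sum, Equiv.Perm.sign_mul, sign_finRotate]
    have : ((-1 : ℤ) ^ m) * (-1) ^ m = 1 := by rw [← pow_add, ← two_mul, pow_mul]; simp
    push_cast
    linear_combination (-(σ.sign : ℤ) * ∑ x : Fin (m + 1) → Fin N,
      c (kuhn (boxPoint x) σ' ∘ Fin.castSucc)) * this
  have expand (x : Fin (m + 1) → ℤ) (σ : Equiv.Perm (Fin (m + 1))) :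
      (σ.sign : ℤ) * coboundary c (kuhn x σ) =
      (σ.sign : ℤ) * c (kuhn x σ ∘ Fin.succ) +
        (∑ j : Fin m, (-1) ^ (j + 1 : ℕ) *
          ((σ.sign : ℤ) * c (kuhn x σ ∘ j.castSucc.succ.succAbove)) +
        (-1) ^ (m + 1) * ((σ.sign : ℤ) * c (kuhn x σ ∘ Fin.castSucc))) := by
    rw [coboundary, Fin.sum_univ_succ, Fin.sum_univ_castSucc, mul_add, mul_add, Finset.mul_sum]
    congr 1
    · simp [Fin.succAbove_zero]
    congr 1
    · refine Finset.sum_congr rfl fun j _ ↦ ?_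
      simp only [Fin.val_succ, Fin.val_castSucc]; ring
    · have : (Fin.last m).succ.succAbove = Fin.castSucc := by
        rw [Fin.succ_last]; exact Fin.succAbove_last
      rw [this]
      simp only [Fin.val_succ, Fin.val_last]; ring
  have inner' (x : Fin (m + 1) → ℤ) : ∑ σ : Equiv.Perm (Fin (m + 1)),
      ∑ j : Fin m, (-1) ^ (j + 1 : ℕ) *
          ((σ.sign : ℤ) * c (kuhn x σ ∘ j.castSucc.succ.succAbove)) = 0 := by
    rw [Finset.sum_comm]
    refine Finset.sum_eq_zero fun j _ ↦ ?_
    rw [← Finset.mul_sum, inner, mul_zero]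
  simp only [expand, Finset.sum_add_distrib, inner', outer, ← Finset.mul_sum]
  simp [pow_succ]

/-- The cup product of the coboundaries of quasi-periodic functions evaluates on the fundamental
class of the torus to the determinant of the matrix of periods. -/
theorem sum_kuhn_cup {m N : ℕ} [NeZero N] (D : Matrix (Fin (m + 1)) (Fin (m + 1)) ℤ)
    (Ψ : Fin (m + 1) → (Fin (m + 1) → ℤ) → ℤ)
    (hΨ : ∀ i x v, Ψ i (x + N • v) = Ψ i x + ∑ j, D i j * v j) :
    ∑ x : Fin (m + 1) → Fin N, ∑ σ : Equiv.Perm (Fin (m + 1)),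
      (σ.sign : ℤ) * cup Ψ (kuhn (boxPoint x) σ) = D.det := by
  have hN : (0 : ℤ) < N := by exact_mod_cast Nat.pos_of_ne_zero (NeZero.ne N)
  -- A staircase with the same periods, which may replace `Ψ` up to an invariant coboundary. It
  -- jumps only when a coordinate passes from `N - 1` to `N`, so only the last cube contributes, and
  -- its simplices give the Leibniz expansion of the determinant.
  let Ψ' (i : Fin (m + 1)) (x : Fin (m + 1) → ℤ) : ℤ := ∑ j, D i j * (x j / N)
  have hΨ' : ∀ i x v, Ψ' i (x + N • v) = Ψ' i x + ∑ j, D i j * v j := by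
    intro i x v
    rw [← Finset.sum_add_distrib]
    refine Finset.sum_congr rfl fun j _ ↦ ?_
    have : (x + N • v) j = x j + N * v j := by simp
    rw [this, Int.add_mul_ediv_left _ _ hN.ne', mul_add]
  obtain ⟨c, hc, hcob⟩ := exists_cup_sub_cup_eq_coboundary
    (fun (v : Fin (m + 1) → ℤ) x ↦ x + N • v) Ψ Ψ' (fun i γ a b ↦ by simp only [hΨ]; ring)
    (fun i γ a b ↦ by simp only [hΨ']; ring) (fun i γ a ↦ by simp only [hΨ, hΨ']; ring)
  have h0 := sum_kuhn_coboundary (N := N) c (fun p v ↦ hc v p)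
  have h1 : cup Ψ = cup Ψ' + coboundary c := by rw [← hcob]; simp
  rw [h1]
  simp only [Pi.add_apply, mul_add, Finset.sum_add_distrib, h0, add_zero]
  rw [← Matrix.det_transpose, Matrix.det_apply']
  let x₀ : Fin (m + 1) → Fin N := fun _ ↦ ⟨N - 1, Nat.sub_lt (Nat.pos_of_ne_zero (NeZero.ne N)) one_pos⟩
  have hdiff (x : Fin (m + 1) → Fin N) (σ : Equiv.Perm (Fin (m + 1))) (i : Fin (m + 1)) :
      Ψ' i (kuhn (boxPoint x) σ i.succ) - Ψ' i (kuhn (boxPoint x) σ i.castSucc) =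
        if (x (σ i) : ℕ) = N - 1 then D i (σ i) else 0 := by
    rw [← Finset.sum_sub_distrib, Finset.sum_eq_single (σ i)]
    · simp only [kuhn, Equiv.symm_apply_apply, Fin.val_succ, Fin.val_castSucc, lt_irrefl,
        if_false, lt_add_one, if_true, add_zero, boxPoint]
      have hx := (x (σ i)).2
      have e1 : (((x (σ i) : ℕ) : ℤ)) / N = 0 := Int.ediv_eq_zero_of_lt (by omega) (by omega)
      rw [e1]
      split_ifs with h
      · rw [show (((x (σ i) : ℕ) : ℤ)) + 1 = N by omega, Int.ediv_self hN.ne']; ring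
      · rw [Int.ediv_eq_zero_of_lt (by omega) (by omega)]; ring
    · intro k _ hk
      have : (σ.symm k : ℕ) ≠ i := fun h ↦ hk (by rw [← Fin.ext h]; simp)
      have e : ((σ.symm k : ℕ) < (i.succ : Fin (m + 2))) ↔
        ((σ.symm k : ℕ) < (i.castSucc : Fin (m + 2))) := by
        simp; omega
      simp only [kuhn, e, sub_self]
    · simp
  rw [Finset.sum_eq_single x₀]
  · refine Finset.sum_congr rfl fun σ _ ↦ ?_
    congr 1
    refine Finset.prod_congr rfl fun i _ ↦ ?_
    rw [hdiff]; simp [x₀]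
  · intro x _ hx
    refine Finset.sum_eq_zero fun σ _ ↦ ?_
    obtain ⟨k, hk⟩ := Function.ne_iff.1 hx
    rw [cup, Finset.prod_eq_zero (Finset.mem_univ (σ.symm k)), mul_zero]
    rw [hdiff, if_neg]
    rw [Equiv.apply_symm_apply]
    exact fun h ↦ hk (Fin.ext h)
  · simp

end DiscreteCochain

/-! ### Projective dimension and restriction to subgroups -/

section ProjectiveDimension

open Limits

/-- An exact functor that preserves projective objects does not increase the projective
dimension. -/
theorem CategoryTheory.Functor.hasProjectiveDimensionLT_obj {C D : Type*} [Category C] [Category D]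
    [Abelian C] [Abelian D] [EnoughProjectives C] (F : C ⥤ D) [F.Additive]
    [PreservesFiniteLimits F] [PreservesFiniteColimits F] [F.PreservesProjectiveObjects]
    (X : C) (n : ℕ) [hX : HasProjectiveDimensionLT X n] : HasProjectiveDimensionLT (F.obj X) n := by
  rcases n with _ | n
  · rw [hasProjectiveDimensionLT_zero_iff_isZero] at hX ⊢
    exact F.map_isZero hX
  induction n generalizing X with
  | zero =>
    have : Projective X := projective_iff_hasProjectiveDimensionLT_one.2 hX
    have : Projective (F.obj X) := F.projective_obj X
    infer_instance
  | succ n ih =>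
    let S : ShortComplex C := ShortComplex.mk (kernel.ι (Projective.π X)) (Projective.π X)
      (kernel.condition _)
    have hS : S.ShortExact := { exact := ShortComplex.exact_kernel _ }
    have h1 := (hS.hasProjectiveDimensionLT_X₃_iff n
      (inferInstanceAs (Projective (Projective.over X)))).1 hX
    have h2 := ih S.X₁ (hX := h1)
    have hP : Projective (F.obj (Projective.over X)) := F.projective_obj _
    exact ((hS.map_of_exact F).hasProjectiveDimensionLT_X₃_iff n hP).2 h2

end ProjectiveDimension

namespace Rep

section ChangeScalars

variable {k k' : Type*} [CommRing k] [CommRing k'] (e : k' →+* k) (G : Type*) [Group G]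

/-- Restriction of scalars of representations. -/
def restrictScalars : Rep.{u} k G ⥤ Rep.{u} k' G where
  obj A := letI : Module k' A.V := Module.compHom A.V e
    Rep.of (X := A.V) (k := k')
      { toFun g := { (A.ρ g).toAddMonoidHom with map_smul' r x := (A.ρ g).map_smul (e r) x }
        map_one' := by ext x; exact congrArg (fun f : A.V →ₗ[k] A.V ↦ f x) (map_one A.ρ)
        map_mul' g h := by ext x; exact congrArg (fun f : A.V →ₗ[k] A.V ↦ f x) (map_mul A.ρ g h) }
  map {A B} f := letI : Module k' A.V := Module.compHom A.V e
    letI : Module k' B.V := Module.compHom B.V e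
    Rep.ofHom ⟨{ f.hom.toLinearMap.toAddMonoidHom with
      map_smul' r x := f.hom.toLinearMap.map_smul (e r) x }, fun g ↦ by
        refine LinearMap.ext fun x ↦ ?_
        exact hom_comm_apply f g x⟩

instance : (restrictScalars.{u} e G).Faithful where
  map_injective {A B f g} h := by
    refine Rep.hom_ext (DFunLike.ext _ _ fun x ↦ ?_)
    exact congrArg (fun q : (restrictScalars e G).obj A ⟶ (restrictScalars e G).obj B ↦ q.hom x) h

instance : (restrictScalars.{u} e G).Additive where
  map_add {_ _ _ _} := rfl

/-- Restriction along the inverse bijection undoes it. It allows `ℤ` to be exchanged for `ULift ℤ`,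
which lives in the universe of the group. -/
theorem restrictScalars_isEquivalence (he : Function.Bijective e) :
    (restrictScalars.{u} e G).IsEquivalence where
  full := ⟨fun {A B} f ↦ ⟨Rep.ofHom ⟨{ f.hom.toLinearMap.toAddMonoidHom with
      map_smul' r x := by
        obtain ⟨r, rfl⟩ := he.2 r
        exact f.hom.toLinearMap.map_smul r x }, fun g ↦ LinearMap.ext fun x ↦ by
          exact hom_comm_apply f g x⟩, rfl⟩⟩
  essSurj := ⟨fun B ↦ by
    let e' := (RingEquiv.ofBijective e he).symm
    let X := (restrictScalars.{u} e G).obj ((restrictScalars (e' : k →+* k') G).obj B)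
    let l : X.V ≃ₗ[k'] B.V :=
      { toFun := fun x ↦ x
        invFun := fun x ↦ x
        map_add' := fun _ _ ↦ rfl
        map_smul' := fun r x ↦ by
          change e' (e r) • (show B.V from x) = r • (show B.V from x)
          rw [show e' (e r) = r from (RingEquiv.ofBijective e he).symm_apply_apply r]
        left_inv := fun _ ↦ rfl
        right_inv := fun _ ↦ rfl }
    exact ⟨(restrictScalars (e' : k →+* k') G).obj B, ⟨Rep.mkIso (ρ := X.ρ) (σ := B.ρ)
      (Representation.Equiv.mk l fun g ↦ LinearMap.ext fun x ↦ rfl)⟩⟩⟩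

end ChangeScalars

instance enoughProjectives_int (G : Type u) [Group G] : EnoughProjectives (Rep.{u} ℤ G) :=
  have := restrictScalars_isEquivalence.{u} (ULift.ringEquiv : ULift.{u} ℤ ≃+* ℤ).toRingHom G
    ULift.ringEquiv.bijective
  (restrictScalars.{u} (ULift.ringEquiv : ULift.{u} ℤ ≃+* ℤ).toRingHom
    G).asEquivalence.enoughProjectives_iff.2 inferInstance

/-- Restriction to a subgroup is exact and preserves projectives, the group ring of `G` being free
over that of `H`. -/
theorem hasProjectiveDimensionLT_trivial_subgroup (G : Type u) [Group G] (H : Subgroup G) (m : ℕ)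
    (h : HasProjectiveDimensionLT (Rep.trivial.{u} ℤ G (ULift.{u} ℤ)) m) :
    HasProjectiveDimensionLT (Rep.trivial.{u} (ULift.{u} ℤ) H (ULift.{u} ℤ)) m := by
  have := restrictScalars_isEquivalence.{u} (ULift.ringEquiv : ULift.{u} ℤ ≃+* ℤ).toRingHom H
    ULift.ringEquiv.bijective
  have := (Rep.resFunctor H.subtype).hasProjectiveDimensionLT_obj
    (Rep.trivial.{u} ℤ G (ULift.{u} ℤ)) m
  have := (restrictScalars.{u} (ULift.ringEquiv : ULift.{u} ℤ ≃+* ℤ).toRingHom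
    H).hasProjectiveDimensionLT_obj _ m (hX := this)
  exact this

end Rep

/-! ### Invariant cochains and the lower bound for the cohomological dimension -/

namespace Rep

open DiscreteCochain

variable {k H : Type u} [CommRing k] [Group H]

/-- The morphism from a term of the standard resolution to the trivial representation that is given
by an invariant cochain. -/
noncomputable def ofInvariantCochain {n : ℕ} (c : (Fin (n + 1) → H) → k)
    (hc : ∀ (h : H) p, c (h • p) = c p) :
    (standardComplex k H).X n ⟶ Rep.trivial k H k :=
  Rep.ofHom (ρ := Representation.ofMulAction k H (Fin (n + 1) → H))
    ⟨(Finsupp.linearCombination k c) ∘ₗ (MonoidAlgebra.coeffLinearEquiv k).toLinearMap, fun h ↦ by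
      refine MonoidAlgebra.lhom_ext' fun p ↦ LinearMap.ext_ring ?_
      simp [hc]⟩

theorem ofInvariantCochain_single {n : ℕ} (c : (Fin (n + 1) → H) → k)
    (hc : ∀ (h : H) p, c (h • p) = c p) (p : Fin (n + 1) → H) (r : k) :
    (ofInvariantCochain c hc).hom (MonoidAlgebra.single p r) = r * c p := by
  change Finsupp.linearCombination k c (MonoidAlgebra.coeffLinearEquiv k
    (MonoidAlgebra.single p r)) = _
  simp

/-- The value of a morphism on a basis element. -/
noncomputable def toInvariantCochain {n : ℕ} (f : (standardComplex k H).X n ⟶ Rep.trivial k H k)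
    (p : Fin (n + 1) → H) : k :=
  f.hom (MonoidAlgebra.single p (1 : k))

theorem toInvariantCochain_smul {n : ℕ} (f : (standardComplex k H).X n ⟶ Rep.trivial k H k)
    (h : H) (p : Fin (n + 1) → H) : toInvariantCochain f (h • p) = toInvariantCochain f p := by
  have := hom_comm_apply f h (MonoidAlgebra.single p (1 : k))
  refine Eq.trans ?_ this
  refine congrArg f.hom ?_
  exact (Representation.ofMulAction_single h p (1 : k)).symm

theorem d_comp_single {n : ℕ} (f : (standardComplex k H).X n ⟶ Rep.trivial k H k)
    (p : Fin (n + 2) → H) :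
    ((standardComplex k H).d (n + 1) n ≫ f).hom (MonoidAlgebra.single p (1 : k)) =
      ∑ j : Fin (n + 2), (-1) ^ (j : ℕ) * toInvariantCochain f (p ∘ j.succAbove) := by
  have h1 : ((standardComplex k H).d (n + 1) n ≫ f).hom (MonoidAlgebra.single p (1 : k)) =
      f.hom.toLinearMap (standardComplex.d k H (n + 1) (MonoidAlgebra.single p 1)) :=
    congrArg f.hom (standardComplex.d_apply k H _)
  rw [h1, standardComplex.d_of, map_sum]
  refine Finset.sum_congr rfl fun j _ ↦ ?_
  have h2 : (MonoidAlgebra.single (p ∘ j.succAbove) ((-1) ^ (j : ℕ)) :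
      MonoidAlgebra k (Fin (n + 1) → H)) = ((-1) ^ (j : ℕ) : k) •
        MonoidAlgebra.single (p ∘ j.succAbove) 1 := by
    rw [MonoidAlgebra.smul_single, smul_eq_mul, mul_one]
  rw [h2]
  exact f.hom.toLinearMap.map_smul _ _

theorem standardComplex_hom_ext {n : ℕ} {f g : (standardComplex k H).X n ⟶ Rep.trivial k H k}
    (h : ∀ p, f.hom (MonoidAlgebra.single p (1 : k)) = g.hom (MonoidAlgebra.single p (1 : k))) :
    f = g := by
  refine Rep.hom_ext (Representation.IntertwiningMap.ext ?_)
  have : (f.hom.toLinearMap : MonoidAlgebra k (Fin (n + 1) → H) →ₗ[k] k) = g.hom.toLinearMap :=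
    MonoidAlgebra.lhom_ext' fun p ↦ LinearMap.ext_ring (h p)
  exact this

/-- If the projective dimension of the trivial representation is less than `n`, then invariant
cocycles of degree `n` are coboundaries of invariant cochains. -/
theorem exists_eq_coboundary_of_hasProjectiveDimensionLT {n : ℕ}
    (h : HasProjectiveDimensionLT (Rep.trivial (ULift.{u} ℤ) H (ULift.{u} ℤ)) (n + 1))
    (c : (Fin (n + 2) → H) → ℤ) (hc : ∀ (h : H) p, c (h • p) = c p) (hδ : coboundary c = 0) :
    ∃ b : (Fin (n + 1) → H) → ℤ, (∀ (h : H) p, b (h • p) = b p) ∧ c = coboundary b := by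
  let := HasExt.standard (Rep.{u} (ULift.{u} ℤ) H)
  let f := ofInvariantCochain (k := ULift.{u} ℤ) (fun p ↦ ULift.up (c p))
    (fun h p ↦ by rw [hc])
  have hf1 (p) : toInvariantCochain f p = ULift.up (c p) := by
    rw [toInvariantCochain, ofInvariantCochain_single, one_mul]
  have hsum {m : ℕ} (a : Fin m → ULift.{u} ℤ) : (∑ i, a i).down = ∑ i, (a i).down :=
    map_sum (ULift.ringEquiv : ULift.{u} ℤ ≃+* ℤ) a Finset.univ
  have hf : (standardComplex (ULift.{u} ℤ) H).d (n + 2) (n + 1) ≫ f = 0 := by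
    refine standardComplex_hom_ext fun p ↦ ?_
    refine (d_comp_single f p).trans ?_
    refine ULift.ext _ _ ?_
    rw [hsum]
    simp only [hf1]
    exact congrFun hδ p
  -- The cocycle represents an `Ext` class in degree `n + 1`, which vanishes; hence it factors
  -- through the differential of the standard resolution.
  have h0 : (standardResolution (ULift.{u} ℤ) H).extMk f (n + 2) rfl hf = 0 :=
    Abelian.Ext.eq_zero_of_hasProjectiveDimensionLT _ (n + 1) le_rfl
  obtain ⟨(g : (standardComplex (ULift.{u} ℤ) H).X n ⟶ _), hg⟩ := ((standardResolution (ULift.{u} ℤ) H).extMk_eq_zero_iff f (n + 2) rfl hf n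
    rfl).1 h0
  refine ⟨fun p ↦ (toInvariantCochain g p).down, fun h p ↦ congrArg ULift.down (toInvariantCochain_smul g h p), ?_⟩
  ext p
  have h1 := hf1 p
  rw [toInvariantCochain, ← hg] at h1
  have h2 := d_comp_single g p
  have h3 := congrArg ULift.down (h1.symm.trans h2)
  rw [hsum] at h3
  exact h3

end Rep

theorem toAdd_apply_eq_sum {H : Type*} [Group H] {m : ℕ} (φ : H →* Multiplicative ℤ)
    (θ : Multiplicative (Fin m → ℤ) →* H) (x : Fin m → ℤ) :
    (φ (θ (Multiplicative.ofAdd x))).toAdd =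
      ∑ j, (φ (θ (Multiplicative.ofAdd (Pi.single j 1)))).toAdd * x j := by
  let L : (Fin m → ℤ) →ₗ[ℤ] ℤ := (AddMonoidHom.mk'
    (fun x ↦ (φ (θ (Multiplicative.ofAdd x))).toAdd) (by intro x y; simp)).toIntLinearMap
  refine (L.pi_apply_eq_sum_univ x).trans (Finset.sum_congr rfl fun j _ ↦ ?_)
  rw [smul_eq_mul, mul_comm]
  congr 1
  change (φ (θ (Multiplicative.ofAdd _))).toAdd = _
  congr 4
  ext k
  simp [Pi.single_apply, eq_comm]

open DiscreteCochain in
-- In smaller projective dimension the cup product of the characters is the coboundary of an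
-- invariant cochain. Pulled back along `θ` and evaluated on the torus, the former gives the
-- determinant and the latter zero; since characters are additive, a single cube (`N = 1`) suffices.
theorem HasDetectedTorus.le_cohomologicalDimension {G : Type u} [Group G] {m : ℕ}
    (h : HasDetectedTorus G (m + 1)) :
    ((m + 1 : ℕ) : WithBot ℕ∞) ≤ cohomologicalDimension G := by
  obtain ⟨H, θ, φ, hdet⟩ := h
  refine (projectiveDimension_ge_iff _ _).2 fun hd ↦ hdet ?_
  let Φ (i : Fin (m + 1)) (x : H) : ℤ := (φ i x).toAdd
  have hΦ (i : Fin (m + 1)) (x y : H) : Φ i (x * y) = Φ i x + Φ i y := by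
    simp [Φ]
  obtain ⟨b, hb, hb'⟩ := Rep.exists_eq_coboundary_of_hasProjectiveDimensionLT
    (Rep.hasProjectiveDimensionLT_trivial_subgroup G H (m + 1) hd) (cup Φ)
    (fun h p ↦ Finset.prod_congr rfl fun i _ ↦ by
      simp only [Pi.smul_apply, smul_eq_mul, hΦ]; ring) (coboundary_cup Φ)
  set D := Matrix.of fun i j : Fin (m + 1) ↦
      (φ i (θ (Multiplicative.ofAdd (Pi.single j 1)))).toAdd with hD
  let t (x : Fin (m + 1) → ℤ) : H := θ (Multiplicative.ofAdd x)
  have ht (x y) : t (x + y) = t x * t y := by simp [t]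
  have hlin (i : Fin (m + 1)) (x : Fin (m + 1) → ℤ) : Φ i (t x) = ∑ j, D i j * x j :=
    toAdd_apply_eq_sum (φ i) θ x
  have h1 := sum_kuhn_cup (N := 1) D (fun i x ↦ Φ i (t x)) (fun i x v ↦ by
    rw [one_smul, ht, hΦ, hlin i v])
  have h2 := sum_kuhn_coboundary (N := 1) (fun p ↦ b fun i ↦ t (p i)) (fun p v ↦ by
    rw [← hb (t v) (fun i ↦ t (p i))]
    congr 1
    ext i : 1
    rw [one_smul]
    exact (congrArg t (add_comm _ _)).trans (ht _ _))
  rw [← h1, ← h2]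
  refine Finset.sum_congr rfl fun x _ ↦ Finset.sum_congr rfl fun σ _ ↦ ?_
  congr 1
  exact congrFun hb' (fun i ↦ t (kuhn (boxPoint x) σ i))

/-! ### Partially defined maps and lifts to coverings -/

section

open Topology

/-- The points of `E` together with an additional point whose only neighbourhood is the whole space.
Continuous maps to it are the same as continuous maps to `E` that are defined on an open subset. -/
inductive PartialPoint (E : Type u) : Type u
  | undefined : PartialPoint E
  | of (e : E) : PartialPoint E

namespace PartialPoint

theorem exists_of_ne {E : Type u} {x : PartialPoint E} (h : x ≠ undefined) : ∃ e, x = of e := by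
  cases x with
  | undefined => exact absurd rfl h
  | of e => exact ⟨e, rfl⟩

variable {E : Type u} {Y : Type*} [TopologicalSpace E] [TopologicalSpace Y]

instance : TopologicalSpace (PartialPoint E) where
  IsOpen U := (PartialPoint.undefined ∈ U → U = Set.univ) ∧ IsOpen (PartialPoint.of ⁻¹' U : Set E)
  isOpen_univ := ⟨fun _ ↦ rfl, isOpen_univ⟩
  isOpen_inter U V hU hV := ⟨fun h ↦ by rw [hU.1 h.1, hV.1 h.2, Set.univ_inter],
    hU.2.inter hV.2⟩
  isOpen_sUnion S hS := by
    refine ⟨?_, ?_⟩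
    · rintro ⟨U, hU, h⟩
      exact Set.eq_univ_of_univ_subset ((hS U hU).1 h ▸ Set.subset_sUnion_of_mem hU)
    · rw [Set.preimage_sUnion]
      exact isOpen_biUnion fun U hU ↦ (hS U hU).2

theorem isOpen_iff {U : Set (PartialPoint E)} :
    IsOpen U ↔ (PartialPoint.undefined ∈ U → U = Set.univ) ∧ IsOpen (PartialPoint.of ⁻¹' U : Set E) := Iff.rfl

/-- There is no condition where `f` is undefined, since the only neighbourhood of that value is the
whole space. -/
theorem continuous_iff {f : Y → PartialPoint E} : Continuous f ↔
    ∀ y e, f y = PartialPoint.of e → ∀ V ∈ 𝓝 e, ∀ᶠ y' in 𝓝 y, ∃ e' ∈ V, f y' = PartialPoint.of e' := by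
  constructor
  · intro hf y e hy V hV
    obtain ⟨V', hV', hVo, heV⟩ := mem_nhds_iff.1 hV
    have ho : IsOpen (PartialPoint.of '' V' : Set (PartialPoint E)) := by
      rw [isOpen_iff]
      refine ⟨fun ⟨x, _, hx⟩ ↦ by simp at hx, ?_⟩
      rwa [Set.preimage_image_eq _ fun _ _ h ↦ PartialPoint.of.inj h]
    filter_upwards [(ho.preimage hf).mem_nhds (show f y ∈ PartialPoint.of '' V' from
      ⟨e, heV, hy.symm⟩)]
    rintro y' ⟨e', he', h⟩
    exact ⟨e', hV' he', h.symm⟩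
  · intro h
    refine continuous_def.2 fun U hU ↦ ?_
    by_cases hn : PartialPoint.undefined ∈ U
    · rw [hU.1 hn]; exact isOpen_univ
    · refine isOpen_iff_mem_nhds.2 fun y hy ↦ ?_
      rcases hfy : f y with - | e
      · exact absurd (by rw [← hfy]; exact hy) hn
      · filter_upwards [h y e hfy _ (hU.2.mem_nhds (show PartialPoint.of e ∈ U from hfy ▸ hy))]
        rintro y' ⟨e', he', h'⟩
        exact (show f y' ∈ U from h' ▸ he')

theorem continuous_undefined : Continuous (fun _ : Y ↦ (PartialPoint.undefined : PartialPoint E)) := continuous_const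

open Classical in
theorem continuous_restrict {f : Y → E} (hf : Continuous f) {O : Set Y} (hO : IsOpen O) :
    Continuous (fun y ↦ (if y ∈ O then PartialPoint.of (f y) else PartialPoint.undefined : PartialPoint E)) := by
  refine continuous_iff.2 fun y e hy V hV ↦ ?_
  split_ifs at hy with h
  obtain rfl := PartialPoint.of.inj hy
  filter_upwards [hO.mem_nhds h, hf.continuousAt hV] with y' h1 h2
  exact ⟨_, h2, if_pos h1⟩

end PartialPoint

namespace IsQuotientCoveringMap

variable {E : Type u} {X G : Type*} [TopologicalSpace E] [TopologicalSpace X] [Group G] [MulAction G E]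
  {p : E → X} (hp : IsQuotientCoveringMap p G)

include hp

theorem exists_smul_eq {e e' : E} (h : p e = p e') : ∃ g : G, g • e' = e :=
  hp.apply_eq_iff_mem_orbit.1 h

/-- If two continuous local lifts of the same map agree at a point then they agree nearby. -/
theorem eventually_eq {Y : Type*} [TopologicalSpace Y] {a : Y → PartialPoint E} {b : Y → E}
    (ha : Continuous a) {y : Y} (hb : ContinuousAt b y)
    (h : ∀ y e, a y = PartialPoint.of e → p e = p (b y)) (hy : a y = PartialPoint.of (b y)) :
    ∀ᶠ y' in 𝓝 y, a y' = PartialPoint.of (b y') := by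
  obtain ⟨V, hVo, hbV, hinj⟩ := hp.isCoveringMap.isLocalHomeomorph.isLocallyInjective (b y)
  filter_upwards [PartialPoint.continuous_iff.1 ha y _ hy V (hVo.mem_nhds hbV),
    hb (hVo.mem_nhds hbV)]
  rintro y' ⟨e, he, h1⟩ h2
  rw [h1, hinj he h2 (h _ _ h1)]

/-- A continuous map from a contractible space to the base lifts to the covering. -/
theorem exists_lift {D : Type*} [TopologicalSpace D] [ContractibleSpace D] (f : C(D, X)) :
    ∃ F : C(D, E), ∀ z, p (F z) = f z := by
  obtain ⟨z₀, ⟨H⟩⟩ := id_nullhomotopic D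
  obtain ⟨e, he⟩ := hp.surjective (f z₀)
  let H' : C(unitInterval × D, X) := f.comp H.symm.toContinuousMap
  have h0 : ∀ a, H' (0, a) = p ((ContinuousMap.const D e) a) := fun a ↦ by
    simp [H', he]
  refine ⟨(hp.isCoveringMap.liftHomotopy H' (ContinuousMap.const D e) h0).comp
    ((ContinuousMap.const D 1).prodMk (ContinuousMap.id D)), fun z ↦ ?_⟩
  have := congrFun (hp.isCoveringMap.liftHomotopy_lifts H' (ContinuousMap.const D e) h0) (1, z)
  refine this.trans ?_
  simp [H']

/-- Extension of a partial section from the boundary of a cell to a collar. -/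
theorem exists_extension {D S : Type*} [TopologicalSpace D] [TopologicalSpace S] (i : S → D)
    {O : Set D} (hO : IsOpen O) (r : D → S) (hr : ∀ z ∈ O, ContinuousAt r z)
    (hri : ∀ θ, r (i θ) = θ) (hi : Continuous i) (hiO : ∀ θ, i θ ∈ O) (F : C(D, E))
    (σ : S → PartialPoint E) (hσ : Continuous σ) (hpσ : ∀ θ e, σ θ = PartialPoint.of e → p e = p (F (i θ))) :
    ∃ τ : D → PartialPoint E, Continuous τ ∧ (∀ θ, τ (i θ) = σ θ) ∧
      ∀ z e, τ z = PartialPoint.of e → p e = p (F z) := by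
  classical
  choose γ hγ using fun (θ : S) (e : E) (h : σ θ = PartialPoint.of e) ↦ hp.exists_smul_eq (hpσ θ e h)
  -- On the boundary `σ` differs from the lift `F` by a deck transformation `g`, unique by freeness
  -- and locally constant. The extension uses the same `g` along the fibres of the retraction.
  let P (z : D) (e : E) : Prop := z ∈ O ∧ ∃ g : G, σ (r z) = PartialPoint.of (g • F (i (r z))) ∧ e = g • F z
  have hfree := hp.isCancelSMul
  have hP (z e e') (h : P z e) (h' : P z e') : e = e' := by
    obtain ⟨-, g, h1, rfl⟩ := h
    obtain ⟨-, g', h1', rfl⟩ := h'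
    have := PartialPoint.of.inj (h1.symm.trans h1')
    rw [IsCancelSMul.right_cancel _ _ _ this]
  let τ (z : D) : PartialPoint E := if h : ∃ e, P z e then PartialPoint.of h.choose else PartialPoint.undefined
  have hτ (z e) : τ z = PartialPoint.of e ↔ P z e := by
    constructor
    · intro h
      by_cases h' : ∃ e, P z e
      · have h1 : τ z = PartialPoint.of h'.choose := dif_pos h'
        rw [← PartialPoint.of.inj (h1.symm.trans h)]
        exact h'.choose_spec
      · have h1 : τ z = PartialPoint.undefined := dif_neg h'
        exact absurd (h1.symm.trans h) (by simp)
    · intro h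
      have h' : ∃ e, P z e := ⟨e, h⟩
      have h1 : τ z = PartialPoint.of h'.choose := dif_pos h'
      rw [h1, hP z _ _ h'.choose_spec h]
  refine ⟨τ, ?_, fun θ ↦ ?_, ?_⟩
  · refine PartialPoint.continuous_iff.2 fun z e hz V hV ↦ ?_
    obtain ⟨hzO, g, h1, rfl⟩ := (hτ z e).1 hz
    have := hp.toContinuousConstSMul
    have hc1 : Continuous fun θ ↦ g • F (i θ) := (F.continuous.comp hi).const_smul g
    have h2 := hp.eventually_eq hσ hc1.continuousAt (fun θ e h ↦ by
      rw [hpσ θ e h, hp.map_smul]) h1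
    have hc2 : ContinuousAt (fun z ↦ g • F z) z := (F.continuous.const_smul g).continuousAt
    filter_upwards [hO.mem_nhds hzO, (hr z hzO).eventually h2, hc2 hV] with z' h3 h4 h5
    exact ⟨_, h5, (hτ _ _).2 ⟨h3, g, h4, rfl⟩⟩
  · rcases h : σ θ with - | e
    · by_contra h'
      obtain ⟨e, he⟩ := PartialPoint.exists_of_ne h'
      obtain ⟨-, g, h1, -⟩ := (hτ _ _).1 he
      rw [hri, h] at h1
      simp at h1
    · refine (hτ _ _).2 ⟨hiO θ, γ θ e h, ?_, (hγ θ e h).symm⟩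
      rw [hri, h, hγ]
  · intro z e h
    obtain ⟨-, g, -, rfl⟩ := (hτ z e).1 h
    exact hp.map_smul g

end IsQuotientCoveringMap

end

/-! ### Sections of coverings over open sets of a CW complex -/

section

open Topology Limits

namespace HomotopicalAlgebra.AttachCells

theorem inj_g₁_comp {C : Type*} [Category C] {α : Type*} {A B : α → C} {g : ∀ a, A a ⟶ B a}
    {X₁ X₂ : C} {f : X₁ ⟶ X₂} (a : AttachCells g f) (k : a.ι) :
    a.cofan₁.inj k ≫ a.g₁ ≫ f = g (a.π k) ≫ a.cell k := by
  rw [a.isPushout.w, cell_def, ← Category.assoc, a.hm, Category.assoc]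

theorem exists_extend {C : Type*} [Category C] {α : Type*} {A B : α → C} {g : ∀ a, A a ⟶ B a}
    {X₁ X₂ : C} {f : X₁ ⟶ X₂} (a : AttachCells g f) {Z : C} (φ : X₁ ⟶ Z)
    (τ : ∀ k, B (a.π k) ⟶ Z) (h : ∀ k, a.cofan₁.inj k ≫ a.g₁ ≫ φ = g (a.π k) ≫ τ k) :
    ∃ ψ : X₂ ⟶ Z, f ≫ ψ = φ ∧ ∀ k, a.cell k ≫ ψ = τ k := by
  have hw : a.g₁ ≫ φ = a.m ≫ Cofan.IsColimit.desc a.isColimit₂ τ := by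
    refine Cofan.IsColimit.hom_ext a.isColimit₁ _ _ fun k ↦ ?_
    rw [h, ← Category.assoc, a.hm, Category.assoc, Cofan.IsColimit.fac]
  refine ⟨a.isPushout.desc φ _ hw, a.isPushout.inl_desc _ _ _, fun k ↦ ?_⟩
  rw [cell_def, Category.assoc, a.isPushout.inr_desc, Cofan.IsColimit.fac]

/-- Predicates are continuous maps to an indiscrete space, and maps out of `X₂` are determined on
`X₁` and the cells; so the predicate of being hit is constantly true. -/
theorem exists_apply_eq {α : Type*} {A B : α → TopCat.{u}} {g : ∀ a, A a ⟶ B a}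
    {X₁ X₂ : TopCat.{u}} {f : X₁ ⟶ X₂} (a : AttachCells g f) (y : X₂) :
    (∃ x, f x = y) ∨ ∃ k z, a.cell k z = y := by
  let Z : TopCat.{u} := TopCat.trivial.obj (ULift Prop)
  let χ (P : X₂ → Prop) : X₂ ⟶ Z :=
    @TopCat.ofHom X₂ (ULift Prop) _ ⊤ (@ContinuousMap.mk _ _ _ ⊤ (fun y ↦ ULift.up (P y)) continuous_top)
  have : χ (fun y ↦ (∃ x, f x = y) ∨ ∃ k z, a.cell k z = y) = χ fun _ ↦ True := by
    refine a.hom_ext ?_ fun k ↦ ?_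
    · ext x
      refine ULift.ext _ _ ?_
      exact eq_true (Or.inl ⟨x, rfl⟩)
    · ext z
      refine ULift.ext _ _ ?_
      exact eq_true (Or.inr ⟨k, z, rfl⟩)
  have h := congrArg ULift.down (congrArg (fun q : X₂ ⟶ Z ↦ (q y : ULift Prop)) this)
  exact of_eq_true h

end HomotopicalAlgebra.AttachCells

theorem CategoryTheory.TransfiniteCompositionOfShape.exists_incl_apply_eq {X Y : TopCat.{u}}
    {f : X ⟶ Y} (c : TransfiniteCompositionOfShape ℕ f) (y : Y) :
    ∃ j, ∃ x : c.F.obj j, c.incl.app j x = y := by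
  let Z : TopCat.{u} := TopCat.trivial.obj (ULift Prop)
  let χ (P : Y → Prop) : Y ⟶ Z :=
    @TopCat.ofHom Y (ULift Prop) _ ⊤ (@ContinuousMap.mk _ _ _ ⊤ (fun y ↦ ULift.up (P y)) continuous_top)
  have : χ (fun y ↦ ∃ j, ∃ x : c.F.obj j, c.incl.app j x = y) = χ fun _ ↦ True := by
    refine c.isColimit.hom_ext fun j ↦ ?_
    ext x
    refine ULift.ext _ _ ?_
    exact eq_true ⟨j, x, rfl⟩
  have h := congrArg ULift.down (congrArg (fun q : Y ⟶ Z ↦ (q y : ULift Prop)) this)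
  exact of_eq_true h

namespace TopCat

open scoped TopCat

instance (n : ℕ) : ContractibleSpace (𝔻 n : TopCat.{u}) := by
  have : ContractibleSpace (Metric.closedBall (0 : EuclideanSpace ℝ (Fin n)) 1) :=
    (convex_closedBall _ _).contractibleSpace ⟨0, by simp⟩
  exact (Homeomorph.ulift (X := Metric.closedBall (0 : EuclideanSpace ℝ (Fin n)) 1)).contractibleSpace

/-- The complement of the centre of a disk retracts to the boundary. -/
theorem exists_collar (n : ℕ) [hne : Nonempty (∂𝔻 n : TopCat.{u})] :
    ∃ (O : Set (𝔻 n : TopCat.{u})) (r : (𝔻 n : TopCat.{u}) → (∂𝔻 n : TopCat.{u})), IsOpen O ∧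
      (∀ z ∈ O, ContinuousAt r z) ∧ (∀ θ, r (diskBoundaryInclusion n θ) = θ) ∧
      ∀ θ, diskBoundaryInclusion n θ ∈ O := by
  classical
  obtain ⟨θ₀⟩ := hne
  let val : (𝔻 n : TopCat.{u}) → EuclideanSpace ℝ (Fin n) := fun z ↦ z.down.1
  have hval : Continuous val := continuous_subtype_val.comp continuous_uliftDown
  let O : Set (𝔻 n : TopCat.{u}) := {z | val z ≠ 0}
  have hO : IsOpen O := isOpen_ne.preimage hval
  let r : (𝔻 n : TopCat.{u}) → (∂𝔻 n : TopCat.{u}) := fun z ↦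
    if h : val z ≠ 0 then ULift.up ⟨‖val z‖⁻¹ • val z, by
      rw [mem_sphere_zero_iff_norm, norm_smul, norm_inv, norm_norm,
        inv_mul_cancel₀ (norm_ne_zero_iff.2 h)]⟩ else θ₀
  have hsphere (θ : (∂𝔻 n : TopCat.{u})) : ‖val (diskBoundaryInclusion n θ)‖ = 1 :=
    mem_sphere_zero_iff_norm.1 θ.down.2
  have hmem (θ : (∂𝔻 n : TopCat.{u})) : val (diskBoundaryInclusion n θ) ≠ 0 := by
    rw [← norm_ne_zero_iff, hsphere]; exact one_ne_zero
  refine ⟨O, r, hO, fun z hz ↦ ?_, fun θ ↦ ?_, hmem⟩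
  · have hind : IsInducing (fun θ : (∂𝔻 n : TopCat.{u}) ↦ θ.down.1) :=
      IsInducing.subtypeVal.comp (Homeomorph.ulift.isInducing)
    refine hind.continuousAt_iff.2 ?_
    have h1 : ContinuousAt (fun z ↦ ‖val z‖⁻¹ • val z) z :=
      (hval.norm.continuousAt.inv₀ (norm_ne_zero_iff.2 hz)).smul hval.continuousAt
    refine h1.congr ?_
    filter_upwards [hO.mem_nhds hz] with z' hz'
    have : r z' = _ := dif_pos hz'
    simp [this]
  · have : r (diskBoundaryInclusion n θ) = _ := dif_pos (hmem θ)
    rw [this]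
    refine ULift.ext _ _ (Subtype.ext ?_)
    simp only [hsphere, inv_one, one_smul]
    rfl

variable {X : TopCat.{u}} {E G : Type u} [TopologicalSpace E] [Group G] [MulAction G E] {p : E → X}

/-- One step of the extension of partial sections over the skeleta. -/
theorem CWComplex.exists_extend_section (hp : IsQuotientCoveringMap p G) (c : CWComplex X) (j : ℕ)
    (s : c.F.obj j ⟶ TopCat.of (PartialPoint E))
    (hs : ∀ y e, s y = PartialPoint.of e → p e = c.incl.app j y) (i : ℕ)
    (hi : j ≤ i → ∀ y, s y = PartialPoint.undefined) :
    ∃ s' : c.F.obj (j + 1) ⟶ TopCat.of (PartialPoint E),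
      (∀ y e, s' y = PartialPoint.of e → p e = c.incl.app (j + 1) y) ∧
      c.F.map (homOfLE (Nat.le_succ j)) ≫ s' = s ∧
      (j + 1 ≤ i → ∀ y, s' y = PartialPoint.undefined) ∧
      (j = i → ∀ k (z : 𝔻 j), ‖z.down.1‖ < 1 →
        s' ((c.attachCells j (not_isMax j)).cell k z) ≠ PartialPoint.undefined) := by
  classical
  let a := c.attachCells j (not_isMax j)
  have hincl (y) : c.incl.app (j + 1) (c.F.map (homOfLE (Nat.le_succ j)) y) = c.incl.app j y :=
    congrArg (fun q : c.F.obj j ⟶ X ↦ q y) (c.incl.naturality (homOfLE (Nat.le_succ j)))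
  have hmain : ∃ τ : ∀ k, 𝔻 j ⟶ TopCat.of (PartialPoint E),
      (∀ k z e, τ k z = PartialPoint.of e → p e = c.incl.app (j + 1) (a.cell k z)) ∧
      (∀ k, a.cofan₁.inj k ≫ a.g₁ ≫ s = diskBoundaryInclusion j ≫ τ k) ∧
      (j + 1 ≤ i → ∀ k z, τ k z = PartialPoint.undefined) ∧
      (j = i → ∀ k (z : 𝔻 j), ‖z.down.1‖ < 1 → τ k z ≠ PartialPoint.undefined) := by
    choose F hF using fun k ↦ hp.exists_lift (a.cell k ≫ c.incl.app (j + 1)).hom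
    have hbdry (k) (θ : ∂𝔻 j) : c.F.map (homOfLE (Nat.le_succ j)) (a.g₁ (a.cofan₁.inj k θ)) =
        a.cell k (diskBoundaryInclusion j θ) := by
      exact congrArg (fun q : ∂𝔻 j ⟶ c.F.obj (j + 1) ↦ q θ) (a.inj_g₁_comp k)
    -- The section of index `i` is nowhere defined below dimension `i`, starts on the open
    -- `i`-cells, and spreads over a collar of the boundary in every cell of larger dimension.
    rcases lt_trichotomy j i with hji | hji | hji
    · refine ⟨fun k ↦ TopCat.ofHom ⟨fun _ ↦ PartialPoint.undefined,
        PartialPoint.continuous_undefined⟩, ?_, ?_, fun _ _ _ ↦ rfl, fun h ↦ absurd h hji.ne⟩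
      · intro k z e h; exact absurd h (by simp)
      · intro k; ext θ; exact hi hji.le _
    · let val : (𝔻 j : TopCat.{u}) → EuclideanSpace ℝ (Fin j) := fun z ↦ z.down.1
      have hval : Continuous val := continuous_subtype_val.comp continuous_uliftDown
      let O : Set (𝔻 j : TopCat.{u}) := {z | ‖val z‖ < 1}
      have hO : IsOpen O := isOpen_lt hval.norm continuous_const
      refine ⟨fun k ↦ TopCat.ofHom ⟨_, PartialPoint.continuous_restrict (F k).continuous hO⟩,
        ?_, ?_, fun h ↦ absurd h (by omega), ?_⟩
      · intro k z e h
        refine Eq.trans ?_ (hF k z)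
        change (if z ∈ O then PartialPoint.of (F k z) else PartialPoint.undefined) = _ at h
        split_ifs at h
        rw [PartialPoint.of.inj h]
      · intro k
        ext θ
        refine (hi hji.le _).trans (Eq.symm (if_neg ?_))
        have : ‖val (diskBoundaryInclusion j θ)‖ = 1 := mem_sphere_zero_iff_norm.1 θ.down.2
        exact fun h ↦ absurd this (ne_of_lt h)
      · intro _ k z hz
        change (if z ∈ O then PartialPoint.of (F k z) else PartialPoint.undefined) ≠ _
        rw [if_pos (show z ∈ O from hz)]
        simp
    · rcases isEmpty_or_nonempty (∂𝔻 j : TopCat.{u}) with hemp | hne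
      · refine ⟨fun k ↦ TopCat.ofHom ⟨fun _ ↦ PartialPoint.undefined,
          PartialPoint.continuous_undefined⟩, ?_, ?_, fun h ↦ absurd h (by omega),
          fun h ↦ absurd h hji.ne'⟩
        · intro k z e h; exact absurd h (by simp)
        · intro k; ext θ; exact hemp.elim θ
      · obtain ⟨O, r, hO, hr, hri, hiO⟩ := exists_collar.{u} j
        choose τ hτ1 hτ2 hτ3 using fun k ↦ hp.exists_extension (diskBoundaryInclusion j) hO r hr
          hri (diskBoundaryInclusion j).hom.continuous hiO (F k)
          (fun θ ↦ s (a.g₁ (a.cofan₁.inj k θ)))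
          ((a.cofan₁.inj k ≫ a.g₁ ≫ s).hom.continuous) (fun θ e h ↦ by
            rw [hs _ e h, show p (F k _) = _ from hF k _, ← hincl, hbdry]; rfl)
        refine ⟨fun k ↦ TopCat.ofHom ⟨τ k, hτ1 k⟩, ?_, ?_, fun h ↦ absurd h (by omega),
          fun h ↦ absurd h hji.ne'⟩
        · intro k z e h
          rw [hτ3 k z e h]
          exact hF k z
        · intro k; ext θ; exact (hτ2 k θ).symm
  obtain ⟨τ, h1, h2, h3, h4⟩ := hmain
  obtain ⟨s', hs'1, hs'2⟩ := a.exists_extend s τ h2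
  have e1 (y) : s' (c.F.map (homOfLE (Nat.le_succ j)) y) = s y :=
    congrArg (fun q : c.F.obj j ⟶ TopCat.of (PartialPoint E) ↦ q y) hs'1
  have e2 (k) (z : 𝔻 j) : s' (a.cell k z) = τ k z :=
    congrArg (fun q : 𝔻 j ⟶ TopCat.of (PartialPoint E) ↦ q z) (hs'2 k)
  refine ⟨s', fun y e h ↦ ?_, hs'1, fun hji y ↦ ?_, fun hji k z hz ↦ ?_⟩
  · rcases a.exists_apply_eq y with ⟨x, rfl⟩ | ⟨k, z, rfl⟩
    · have h' : s x = PartialPoint.of e := (e1 x).symm.trans h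
      exact (hs x e h').trans (hincl x).symm
    · exact h1 k z e ((e2 k z).symm.trans h)
  · rcases a.exists_apply_eq y with ⟨x, rfl⟩ | ⟨k, z, rfl⟩
    · exact (e1 x).trans (hi (by omega) x)
    · exact (e2 k z).trans (h3 hji k z)
  · exact fun h ↦ h4 hji k z hz ((e2 k z).symm.trans h)

/-- Over an `n`-dimensional CW complex, a covering has sections on `n + 1` open subsets that cover
the base. -/
theorem CWComplex.exists_sections (hp : IsQuotientCoveringMap p G) (c : CWComplex X) (n : ℕ)
    (hn : ∀ e : c.Cells, e.j ≤ n) :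
    ∃ s : ℕ → X → PartialPoint E, (∀ i, Continuous (s i)) ∧
      (∀ i x e, s i x = PartialPoint.of e → p e = x) ∧
      ∀ x, ∃ i ≤ n, s i x ≠ PartialPoint.undefined := by
  let Good (i j : ℕ) : Type u := {s : c.F.obj j ⟶ TopCat.of (PartialPoint E) //
    (∀ y e, s y = PartialPoint.of e → p e = c.incl.app j y) ∧
      (j ≤ i → ∀ y, s y = PartialPoint.undefined)}
  choose f hf1 hf2 hf3 hf4 using fun i j (s : Good i j) ↦
    c.exists_extend_section hp j s.1 s.2.1 i s.2.2
  have hempty : IsEmpty (c.F.obj 0) :=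
    ⟨fun y ↦ (show PEmpty.{u + 1} from (c.isoBot.hom ≫ initial.to (TopCat.of PEmpty.{u + 1})) y).elim⟩
  let S (i j : ℕ) : Good i j := Nat.rec (motive := Good i)
    ⟨TopCat.ofHom ⟨fun _ ↦ PartialPoint.undefined, PartialPoint.continuous_undefined⟩,
      fun y ↦ hempty.elim y, fun _ y ↦ hempty.elim y⟩
    (fun j s ↦ ⟨f i j s, hf1 i j s, hf3 i j s⟩) j
  let t (i : ℕ) : Cocone c.F := ⟨TopCat.of (PartialPoint E),
    NatTrans.ofSequence (fun j ↦ (S i j).1) fun j ↦ (hf2 i j (S i j)).trans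
      (Category.comp_id _).symm⟩
  let s (i : ℕ) : X ⟶ TopCat.of (PartialPoint E) := c.isColimit.desc (t i)
  have hs (i j : ℕ) (y : c.F.obj j) : s i (c.incl.app j y) = (S i j).1 y :=
    congrArg (fun q : c.F.obj j ⟶ TopCat.of (PartialPoint E) ↦ q y) (c.isColimit.fac (t i) j)
  refine ⟨fun i ↦ s i, fun i ↦ (s i).hom.continuous, ?_, ?_⟩
  · intro i x e h
    obtain ⟨j, y, rfl⟩ := c.exists_incl_apply_eq x
    exact (S i j).2.1 y e ((hs i j y).symm.trans h)
  · intro x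
    obtain ⟨j, y, rfl⟩ := c.exists_incl_apply_eq x
    induction j with
    | zero => exact hempty.elim y
    | succ j ih =>
      have hold (x : c.F.obj j) : ∃ i ≤ n, s i (c.incl.app (j + 1)
          (c.F.map (homOfLE (Nat.le_succ j)) x)) ≠ PartialPoint.undefined := by
        have : c.incl.app (j + 1) (c.F.map (homOfLE (Nat.le_succ j)) x) = c.incl.app j x :=
          congrArg (fun q : c.F.obj j ⟶ X ↦ q x) (c.incl.naturality (homOfLE (Nat.le_succ j)))
        rw [this]; exact ih x
      let a := c.attachCells j (not_isMax j)
      rcases a.exists_apply_eq y with ⟨x, rfl⟩ | ⟨k, z, rfl⟩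
      · exact hold x
      -- Interior points of a `j`-cell are covered by section `j`; boundary points come from the
      -- previous stage.
      · rcases lt_or_ge ‖z.down.1‖ 1 with hz | hz
        · refine ⟨j, hn ⟨j, not_isMax j, k⟩, fun h ↦ hf4 j j (S j j) rfl k z hz ?_⟩
          exact (hs j (j + 1) _).symm.trans h
        · have hz' : ‖z.down.1‖ = 1 := le_antisymm (mem_closedBall_zero_iff.1 z.down.2) hz
          let θ : (∂𝔻 j : TopCat.{u}) := ⟨z.down.1, mem_sphere_zero_iff_norm.2 hz'⟩
          have h2 : c.F.map (homOfLE (Nat.le_succ j)) (a.g₁ (a.cofan₁.inj k θ)) = a.cell k z :=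
            congrArg (fun q : ∂𝔻 j ⟶ c.F.obj (j + 1) ↦ q θ) (a.inj_g₁_comp k)
          rw [← h2]
          exact hold _

end TopCat

end

/-! ### Equivariant maps from Euclidean space to a contractible space -/

section

open Topology

namespace EquivariantMap

variable {m : ℕ} {E G : Type*} [TopologicalSpace E] [Group G] [MulAction G E]

/-- The centres of the blocks of a given colour are shifted by a half in some coordinates. -/
noncomputable def shift (a : Fin m → Bool) (i : Fin m) : ℝ := if a i then 1 / 2 else 0

/-- The wave that separates the blocks of a given colour. -/
noncomputable def wave (a : Fin m → Bool) (x : Fin m → ℝ) (i : Fin m) : ℝ :=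
  Real.cos (2 * Real.pi * (x i - shift a i))

/-- The index of the block of a given colour that contains `x`. -/
noncomputable def block (a : Fin m → Bool) (x : Fin m → ℝ) (i : Fin m) : ℤ := ⌊x i - shift a i⌋

/-- A periodic bump function that vanishes between the blocks of a given colour. -/
noncomputable def bump (a : Fin m → Bool) (x : Fin m → ℝ) : unitInterval :=
  ∏ i, Set.projIcc 0 1 zero_le_one (2 - 4 * wave a x i)

theorem continuous_wave (a : Fin m → Bool) (i : Fin m) : Continuous fun x ↦ wave a x i := by
  unfold wave; fun_prop

theorem continuous_bump (a : Fin m → Bool) : Continuous (bump a) := by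
  refine continuous_finsetProd _ fun i _ ↦ continuous_projIcc.comp ?_
  exact continuous_const.sub (continuous_const.mul (continuous_wave a i))

theorem wave_add (a : Fin m → Bool) (x : Fin m → ℝ) (v : Fin m → ℤ) (i : Fin m) :
    wave a (x + fun k ↦ (v k : ℝ)) i = wave a x i := by
  rw [wave, wave, ← Real.cos_add_int_mul_two_pi (2 * Real.pi * (x i - shift a i)) (v i)]
  congr 1
  simp only [Pi.add_apply]; ring

theorem block_add (a : Fin m → Bool) (x : Fin m → ℝ) (v : Fin m → ℤ) :
    block a (x + fun k ↦ (v k : ℝ)) = block a x + v := by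
  ext i
  simp only [block, Pi.add_apply]
  rw [← Int.floor_add_intCast]; congr 1; ring

/-- The floor jumps only where `x i - shift a i` is an integer, and there the wave equals `1`. -/
theorem eventually_block_eq (a : Fin m → Bool) (x : Fin m → ℝ) (h : ∀ i, wave a x i < 1) :
    ∀ᶠ y in 𝓝 x, block a y = block a x := by
  have : ∀ i, ∀ᶠ y in 𝓝 x, block a y i = block a x i := by
    intro i
    have hlt : (block a x i : ℝ) < x i - shift a i := by
      refine lt_of_le_of_ne (Int.floor_le _) fun h' ↦ ?_
      have h1 := h i
      rw [wave, ← h', show 2 * Real.pi * (block a x i : ℝ) = block a x i * (2 * Real.pi) by ring,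
        Real.cos_int_mul_two_pi] at h1
      exact lt_irrefl _ h1
    have hgt : x i - shift a i < block a x i + 1 := Int.lt_floor_add_one _
    have hc : Continuous fun y : Fin m → ℝ ↦ y i - shift a i := by fun_prop
    filter_upwards [hc.continuousAt.eventually_const_lt hlt,
      hc.continuousAt.eventually_lt_const hgt] with y h1 h2
    exact Int.floor_eq_iff.2 ⟨h1.le, h2⟩
  filter_upwards [Filter.eventually_all.2 this] with y hy
  exact funext hy

theorem bump_eq_zero (a : Fin m → Bool) (x : Fin m → ℝ) (i : Fin m) (h : 1 / 2 < wave a x i) :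
    bump a x = 0 := by
  refine Finset.prod_eq_zero (Finset.mem_univ i) ?_
  exact Set.projIcc_of_le_left _ (by linarith)

theorem bump_eq_one (a : Fin m → Bool) (x : Fin m → ℝ) (h : ∀ i, wave a x i < 1 / 4) :
    bump a x = 1 := by
  refine Finset.prod_eq_one fun i _ ↦ ?_
  exact Set.projIcc_of_right_le _ (by linarith [h i])

/-- A shift by one half changes the sign of the cosine, so the cores of the blocks of all `2 ^ m`
colours cover the space. -/
theorem exists_wave_nonpos (x : Fin m → ℝ) : ∃ a : Fin m → Bool, ∀ i, wave a x i ≤ 0 := by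
  have : ∀ i, ∃ b : Bool, Real.cos (2 * Real.pi * (x i - if b then 1 / 2 else 0)) ≤ 0 := by
    intro i
    rcases le_total (Real.cos (2 * Real.pi * x i)) 0 with h | h
    · exact ⟨false, by simpa using h⟩
    · refine ⟨true, ?_⟩
      rw [if_pos rfl, show 2 * Real.pi * (x i - 1 / 2) = 2 * Real.pi * x i - Real.pi by ring,
        Real.cos_sub_pi]
      linarith
  choose a ha using this
  exact ⟨a, ha⟩

/-- Modification of an equivariant map on the blocks of one colour, by which it becomes constant on
the core of each block. -/
theorem exists_continuousAt_of_wave_nonpos [ContractibleSpace E] [ContinuousConstSMul G E]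
    (t : Multiplicative (Fin m → ℤ) →* G) (h : (Fin m → ℝ) → E)
    (hh : ∀ x (v : Fin m → ℤ), h (x + fun k ↦ (v k : ℝ)) = t (Multiplicative.ofAdd v) • h x)
    (a : Fin m → Bool) : ∃ h' : (Fin m → ℝ) → E,
      (∀ x (v : Fin m → ℤ), h' (x + fun k ↦ (v k : ℝ)) = t (Multiplicative.ofAdd v) • h' x) ∧
      (∀ x, ContinuousAt h x → ContinuousAt h' x) ∧
      ∀ x, (∀ i, wave a x i ≤ 0) → ContinuousAt h' x := by
  obtain ⟨e, ⟨H⟩⟩ := id_nullhomotopic E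
  let T (v : Fin m → ℤ) : G := t (Multiplicative.ofAdd v)
  -- Within each block `h` is moved back to the base block, contracted for the time given by the
  -- bump, and moved forward again. Near the walls the bump is `0` and `h` is unchanged; near the
  -- core it is `1` and the value is constant.
  let h' (x : Fin m → ℝ) : E := T (block a x) • H (bump a x, (T (block a x))⁻¹ • h x)
  have hloc (x) (hx : ∀ i, wave a x i < 1) : h' =ᶠ[𝓝 x]
      fun y ↦ T (block a x) • H (bump a y, (T (block a x))⁻¹ • h y) := by
    filter_upwards [eventually_block_eq a x hx] with y hy
    simp only [h', hy]
  refine ⟨h', fun x v ↦ ?_, fun x hx ↦ ?_, fun x hx ↦ ?_⟩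
  · have hT : T (block a x + v) = T v * T (block a x) := by
      rw [add_comm]; simp only [T, ofAdd_add, map_mul]
    have hb : bump a (x + fun k ↦ (v k : ℝ)) = bump a x := by simp only [bump, wave_add]
    simp only [h', block_add, hT, hb, hh, mul_smul, mul_inv_rev]
    rw [show t (Multiplicative.ofAdd v) = T v from rfl, inv_smul_smul]
  · by_cases hw : ∃ i, 1 / 2 < wave a x i
    · obtain ⟨i, hi⟩ := hw
      refine hx.congr ?_
      filter_upwards [(continuous_wave a i).continuousAt.eventually_const_lt hi] with y hy
      simp only [h', bump_eq_zero a y i hy]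
      rw [H.apply_zero, ContinuousMap.id_apply, smul_inv_smul]
    · push Not at hw
      refine ContinuousAt.congr ?_ (hloc x fun i ↦ (hw i).trans_lt (by norm_num)).symm
      have h1 : ContinuousAt (fun y ↦ (bump a y, (T (block a x))⁻¹ • h y)) x :=
        (continuous_bump a).continuousAt.prodMk (hx.const_smul _)
      exact (H.continuous.continuousAt.comp h1).const_smul _
  · refine ContinuousAt.congr (continuousAt_const (y := T (block a x) • e)) ?_
    have hb : ∀ᶠ y in 𝓝 x, ∀ i, wave a y i < 1 / 4 := Filter.eventually_all.2 fun i ↦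
      (continuous_wave a i).continuousAt.eventually_lt_const ((hx i).trans_lt (by norm_num))
    filter_upwards [hloc x fun i ↦ (hx i).trans_lt one_pos, hb] with y h1 h2
    rw [h1, bump_eq_one a y h2, H.apply_one, ContinuousMap.const_apply]

/-- A contractible space with an action of `ℤ^m` receives an equivariant map from `ℝ^m`. -/
theorem exists_continuous [ContractibleSpace E] [ContinuousConstSMul G E]
    (t : Multiplicative (Fin m → ℤ) →* G) : ∃ h : (Fin m → ℝ) → E, Continuous h ∧
      ∀ x (v : Fin m → ℤ), h (x + fun k ↦ (v k : ℝ)) = t (Multiplicative.ofAdd v) • h x := by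
  have key (s : Finset (Fin m → Bool)) : ∃ h : (Fin m → ℝ) → E,
      (∀ x (v : Fin m → ℤ), h (x + fun k ↦ (v k : ℝ)) = t (Multiplicative.ofAdd v) • h x) ∧
      ∀ x, (∃ a ∈ s, ∀ i, wave a x i ≤ 0) → ContinuousAt h x := by
    classical
    induction s using Finset.induction_on with
    | empty =>
      obtain ⟨e⟩ : Nonempty E := inferInstance
      -- The start is equivariant but discontinuous; each colour then repairs it on its cores
      -- without losing points of continuity.
      refine ⟨fun x ↦ t (Multiplicative.ofAdd fun k ↦ ⌊x k⌋) • e, fun x v ↦ ?_, by simp⟩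
      rw [← mul_smul, ← map_mul, ← ofAdd_add]
      have : (fun k ↦ ⌊(x + fun k ↦ (v k : ℝ)) k⌋) = v + fun k ↦ ⌊x k⌋ := by
        ext k; simp [add_comm]
      exact congrArg (fun w ↦ t (Multiplicative.ofAdd w) • e) this
    | insert a s _ ih =>
      obtain ⟨h, hh, hc⟩ := ih
      obtain ⟨h', hh', h1, h2⟩ := exists_continuousAt_of_wave_nonpos t h hh a
      refine ⟨h', hh', fun x ⟨b, hb, hx⟩ ↦ ?_⟩
      rcases Finset.mem_insert.1 hb with rfl | hb
      · exact h2 x hx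
      · exact h1 x (hc x ⟨b, hb, hx⟩)
  obtain ⟨h, hh, hc⟩ := key Finset.univ
  refine ⟨h, continuous_iff_continuousAt.2 fun x ↦ hc x ?_, hh⟩
  obtain ⟨a, ha⟩ := exists_wave_nonpos x
  exact ⟨a, Finset.mem_univ a, ha⟩

end EquivariantMap

end

/-! ### The lower bound for the dimension of a classifying space -/

section

open Topology DiscreteCochain

/-- Representatives of the right cosets `H g` are split off. This carries the characters of `H` to
functions on `G`. -/
theorem Subgroup.exists_equivariant_retraction {G : Type*} [Group G] (H : Subgroup G) :
    ∃ r : G → H, ∀ (h : H) (g : G), r (h * g) = h * r g := by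
  have key (g : G) : g * (Quotient.mk (QuotientGroup.rightRel H) g).out⁻¹ ∈ H :=
    QuotientGroup.rightRel_apply.1 (Quotient.exact (Quotient.out_eq _))
  refine ⟨fun g ↦ ⟨_, key g⟩, fun h g ↦ Subtype.ext ?_⟩
  have : (Quotient.mk (QuotientGroup.rightRel H) (h * g)) = Quotient.mk _ g :=
    Quotient.sound (QuotientGroup.rightRel_apply.2 (by
      rw [mul_inv_rev, mul_inv_cancel_left]; exact H.inv_mem h.2))
  simp only [this, Subgroup.coe_mul, mul_assoc]

/-- A CW complex that is a classifying space of a group with a free abelian subgroup of rank `m`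
detected by characters has dimension at least `m`. -/
theorem HasDetectedTorus.le_of_isClassifyingSpace {G : Type u} [Group G] {m : ℕ}
    (ht : HasDetectedTorus G (m + 1)) {X : TopCat.{u}} (hX : IsClassifyingSpace G X)
    (c : TopCat.CWComplex X) {n : ℕ} (hn : ∀ e : c.Cells, e.j ≤ n) : m + 1 ≤ n := by
  classical
  by_contra! hnm
  obtain ⟨E, _, _, p, _, hp⟩ := hX
  obtain ⟨H, θ, φ, hdet⟩ := ht
  refine hdet ?_
  have := hp.toContinuousConstSMul
  have hfree := hp.isCancelSMul
  obtain ⟨s, hs1, hs2, hs3⟩ := TopCat.CWComplex.exists_sections hp c n hn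
  obtain ⟨h, hc, hh⟩ := EquivariantMap.exists_continuous (E := E) (H.subtype.comp θ)
  obtain ⟨r, hr⟩ := H.exists_equivariant_retraction
  let T (v : Fin (m + 1) → ℤ) : G := θ (Multiplicative.ofAdd v)
  have hhT (x) (v : Fin (m + 1) → ℤ) : h (x + fun k ↦ (v k : ℝ)) = T v • h x := hh x v
  have hT (v w) : T (v + w) = T v * T w := by simp [T]
  let Q (i : Fin (m + 1)) (x : Fin (m + 1) → ℝ) (g : G) : Prop :=
    s i (p (h x)) = PartialPoint.of (g⁻¹ • h x)
  have hQ (i x g g') (hg : Q i x g) (hg' : Q i x g') : g = g' := by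
    have := PartialPoint.of.inj (hg.symm.trans hg')
    exact inv_injective (IsCancelSMul.right_cancel _ _ _ this)
  have hQT (i x g) (v : Fin (m + 1) → ℤ) :
      Q i (x + fun k ↦ (v k : ℝ)) (T v * g) ↔ Q i x g := by
    simp only [Q, hhT, hp.map_smul, mul_inv_rev, mul_smul, inv_smul_smul]
  -- `κ` compares `h` with the section of index `i`. Where the section is undefined, the default `T
  -- ⌊x⌋` keeps `κ` equivariant.
  let κ (i : Fin (m + 1)) (x : Fin (m + 1) → ℝ) : G :=
    if h : ∃ g, Q i x g then h.choose else T fun k ↦ ⌊x k⌋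
  have hκ (i x g) (hg : Q i x g) : κ i x = g := by
    have hex : ∃ g, Q i x g := ⟨g, hg⟩
    have : κ i x = hex.choose := dif_pos hex
    rw [this]
    exact hQ i x _ _ hex.choose_spec hg
  have hκT (i x) (v : Fin (m + 1) → ℤ) : κ i (x + fun k ↦ (v k : ℝ)) = T v * κ i x := by
    by_cases hex : ∃ g, Q i x g
    · obtain ⟨g, hg⟩ := hex
      rw [hκ i x g hg, hκ i _ _ ((hQT i x g v).2 hg)]
    · have h1 : κ i x = T fun k ↦ ⌊x k⌋ := dif_neg hex
      have h2 : κ i (x + fun k ↦ (v k : ℝ)) = T fun k ↦ ⌊x k + v k⌋ := dif_neg fun ⟨g, hg⟩ ↦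
        hex ⟨(T v)⁻¹ * g, (hQT i x _ v).1 (by rwa [mul_inv_cancel_left])⟩
      rw [h1, h2, ← hT]
      congr 1
      ext k; simp [add_comm]
  -- Some section of index at most `n` is defined at `p (h x)`, and the deck transformation to it is
  -- locally constant. As `n < m + 1`, the index is one of those of the characters.
  have hloc (x) : ∃ i, ∀ᶠ y in 𝓝 x, κ i y = κ i x := by
    obtain ⟨i, hi, hne⟩ := hs3 (p (h x))
    obtain ⟨e, he⟩ := PartialPoint.exists_of_ne hne
    obtain ⟨g, hg⟩ := hp.exists_smul_eq (hs2 i _ e he).symm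
    have hge : g⁻¹ • h x = e := by rw [← hg, inv_smul_smul]
    refine ⟨⟨i, by omega⟩, ?_⟩
    have hev := hp.eventually_eq (a := fun y ↦ s i (p (h y))) (b := fun y ↦ g⁻¹ • h y) (y := x)
      ((hs1 i).comp (hp.isCoveringMap.continuous.comp hc)) (hc.const_smul g⁻¹).continuousAt
      (fun y e he ↦ by rw [hs2 i _ e he, hp.map_smul]) (by rw [he, hge])
    filter_upwards [hev] with y hy
    rw [hκ ⟨i, by omega⟩ y g hy, hκ ⟨i, by omega⟩ x g (by simp only [Q]; rw [he, hge])]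
  choose i hi using hloc
  -- On a grid of mesh `1 / M < δ`, every simplex lies in a set where one of the `κ i` is constant,
  -- so one factor of its cup product vanishes.
  obtain ⟨δ, hδ, hleb⟩ := lebesgue_number_lemma_of_metric
    (isCompact_Icc (a := (0 : Fin (m + 1) → ℝ)) (b := 1))
    (c := fun x ↦ interior {y | κ (i x) y = κ (i x) x}) (fun _ ↦ isOpen_interior)
    (fun x _ ↦ Set.mem_iUnion.2 ⟨x, mem_interior_iff_mem_nhds.2 (hi x)⟩)
  obtain ⟨N, hN⟩ := exists_nat_one_div_lt hδ
  let M := N + 1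
  have hMpos : (0 : ℝ) < M := by positivity
  let scale (y : Fin (m + 1) → ℤ) (k : Fin (m + 1)) : ℝ := (y k : ℝ) / M
  let ψ (i : Fin (m + 1)) (y : Fin (m + 1) → ℤ) : ℤ := (φ i (r (κ i (scale y)))).toAdd
  rw [← sum_kuhn_cup (N := M) _ ψ (fun i y v ↦ by
    have h1 : scale (y + M • v) = scale y + fun k ↦ (v k : ℝ) := by
      ext k
      change (((y + M • v) k : ℤ) : ℝ) / M = (y k : ℝ) / M + v k
      rw [show (y + M • v) k = y k + M * v k by simp]
      push_cast
      field_simp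
    simp only [ψ, h1, hκT, T, hr, map_mul, toAdd_mul]
    rw [add_comm, toAdd_apply_eq_sum (φ i) θ v]
    rfl)]
  refine Finset.sum_eq_zero fun x _ ↦ Finset.sum_eq_zero fun σ _ ↦ ?_
  obtain ⟨x₀, hx₀⟩ := hleb (scale (boxPoint x)) (by
    refine ⟨fun k ↦ div_nonneg (by simp [boxPoint]) hMpos.le, fun k ↦ ?_⟩
    simp only [scale, boxPoint, Pi.one_apply]
    rw [div_le_one hMpos]
    exact_mod_cast (x k).2.le)
  have hconst (l : Fin (m + 2)) : ψ (i x₀) (kuhn (boxPoint x) σ l) =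
      (φ (i x₀) (r (κ (i x₀) x₀))).toAdd := by
    have hball : scale (kuhn (boxPoint x) σ l) ∈ Metric.ball (scale (boxPoint x)) δ := by
      rw [Metric.mem_ball, dist_pi_lt_iff hδ]
      intro k
      refine lt_of_le_of_lt ?_ hN
      simp only [scale, kuhn, Real.dist_eq]
      rw [← sub_div, abs_div, abs_of_pos hMpos]
      have e : (M : ℝ) = N + 1 := by simp [M]
      rw [e]
      gcongr
      split_ifs <;> simp
    have := interior_subset (hx₀ hball)
    simp only [ψ]
    rw [show κ (i x₀) (scale (kuhn (boxPoint x) σ l)) = κ (i x₀) x₀ from this]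
  rw [cup, Finset.prod_eq_zero (Finset.mem_univ (i x₀)), mul_zero]
  rw [hconst, hconst, sub_self]

end

/-! ### Images of relative cell complexes under functors -/

namespace HomotopicalAlgebra

open Limits

universe w w' t v₁ v₂ u₁ u₂

variable {C : Type u₁} [Category.{v₁} C] {D : Type u₂} [Category.{v₂} D] (F : C ⥤ D)

/-- A functor which preserves coproducts and pushouts preserves the attachment of cells. -/
noncomputable def AttachCells.map {α : Type t} {A B : α → C} {g : ∀ a, A a ⟶ B a} {X₁ X₂ : C}
    {f : X₁ ⟶ X₂} (c : AttachCells.{w} g f)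
    [PreservesColimitsOfShape (Discrete c.ι) F] [PreservesColimitsOfShape WalkingSpan F] :
    AttachCells.{w} (fun a => F.map (g a)) (F.map f) where
  ι := c.ι
  π := c.π
  cofan₁ := Cofan.mk (F.obj c.cofan₁.pt) fun i => F.map (c.cofan₁.inj i)
  cofan₂ := Cofan.mk (F.obj c.cofan₂.pt) fun i => F.map (c.cofan₂.inj i)
  isColimit₁ := isColimitCofanMkObjOfIsColimit F _ _
    (c.isColimit₁.ofIsoColimit (Cofan.ext (Iso.refl _) (by simp)))
  isColimit₂ := isColimitCofanMkObjOfIsColimit F _ _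
    (c.isColimit₂.ofIsoColimit (Cofan.ext (Iso.refl _) (by simp)))
  m := F.map c.m
  hm i := by
    simp only [Cofan.inj, Cofan.mk_ι_app]
    rw [← F.map_comp, ← F.map_comp]
    exact congrArg F.map (c.hm i)
  g₁ := F.map c.g₁
  g₂ := F.map c.g₂
  isPushout := c.isPushout.map F

variable {J : Type w'} [LinearOrder J] [OrderBot J] [SuccOrder J] [WellFoundedLT J]
  {α : J → Type t} {A B : (j : J) → α j → C}
  {basicCell : (j : J) → (i : α j) → A j i ⟶ B j i} {X Y : C} {f : X ⟶ Y}

/-- A functor which preserves colimits sends relative cell complexes to relative cell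
complexes. -/
noncomputable def RelativeCellComplex.map (c : RelativeCellComplex.{w} basicCell f)
    [PreservesWellOrderContinuousOfShape J F] [PreservesColimitsOfShape J F]
    [PreservesColimitsOfSize.{w, w} F] [PreservesColimitsOfShape WalkingSpan F] :
    RelativeCellComplex.{w} (fun j i => F.map (basicCell j i)) (F.map f) where
  toTransfiniteCompositionOfShape := c.toTransfiniteCompositionOfShape.map F
  attachCells j hj := (c.attachCells j hj).map F

/-- Replacement of the basic cells of a relative cell complex by isomorphic ones. -/
noncomputable def RelativeCellComplex.replaceCells (c : RelativeCellComplex.{w} basicCell f)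
    {A' B' : (j : J) → α j → C} {basicCell' : (j : J) → (i : α j) → A' j i ⟶ B' j i}
    (e : ∀ j i, Arrow.mk (basicCell j i) ≅ Arrow.mk (basicCell' j i)) :
    RelativeCellComplex.{w} basicCell' f where
  toTransfiniteCompositionOfShape := c.toTransfiniteCompositionOfShape
  attachCells j hj := (c.attachCells j hj).reindexCellTypes _ id (e j)

/-- A relative cell complex structure can be transported along an isomorphism of arrows. -/
noncomputable def RelativeCellComplex.ofArrowIso (c : RelativeCellComplex.{w} basicCell f)
    {X' Y' : C} {f' : X' ⟶ Y'} (e : Arrow.mk f ≅ Arrow.mk f') :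
    RelativeCellComplex.{w} basicCell f' where
  toTransfiniteCompositionOfShape := c.toTransfiniteCompositionOfShape.ofArrowIso e
  attachCells := c.attachCells

end HomotopicalAlgebra

/-! ### The standard simplex as a disk -/

section SimplexDisk

open Metric

/-- The simplex in `ℝⁿ` of points with nonnegative coordinates of sum at most `1`. -/
def solidSimplex (n : ℕ) : Set (EuclideanSpace ℝ (Fin n)) :=
  {x | (∀ i, 0 ≤ x i) ∧ ∑ i, x i ≤ 1}

theorem convex_solidSimplex (n : ℕ) : Convex ℝ (solidSimplex n) := by
  rintro x ⟨hx, hx'⟩ y ⟨hy, hy'⟩ a b ha hb hab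
  refine ⟨fun i => ?_, ?_⟩
  · simpa using add_nonneg (mul_nonneg ha (hx i)) (mul_nonneg hb (hy i))
  · simp only [PiLp.add_apply, PiLp.smul_apply, smul_eq_mul, Finset.sum_add_distrib,
      ← Finset.mul_sum]
    nlinarith

theorem isClosed_solidSimplex (n : ℕ) : IsClosed (solidSimplex n) := by
  have : solidSimplex n = (⋂ i, {x : EuclideanSpace ℝ (Fin n) | 0 ≤ x i}) ∩
      {x | ∑ i, x i ≤ 1} := by
    ext x
    simp [solidSimplex]
  rw [this]
  exact (isClosed_iInter fun i => isClosed_le (by fun_prop) (by fun_prop)).inter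
    (isClosed_le (by fun_prop) (by fun_prop))

theorem isBounded_solidSimplex (n : ℕ) : Bornology.IsBounded (solidSimplex n) := by
  refine (isBounded_iff_forall_norm_le).2 ⟨1, fun x ⟨hx, hx'⟩ => ?_⟩
  rw [EuclideanSpace.norm_eq, Real.sqrt_le_one]
  have h1 : ∀ i, x i ≤ 1 := fun i =>
    (Finset.single_le_sum (fun j _ => hx j) (Finset.mem_univ i)).trans hx'
  refine le_trans (Finset.sum_le_sum fun i _ => ?_) hx'
  rw [Real.norm_eq_abs, sq_abs]
  nlinarith [hx i, h1 i]

/-- From an interior point one can move a little along `-eᵢ` and along `x` itself, which makes the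
inequalities strict. -/
theorem interior_solidSimplex (n : ℕ) :
    interior (solidSimplex n) = {x | (∀ i, 0 < x i) ∧ ∑ i, x i < 1} := by
  apply Set.Subset.antisymm
  · intro x hx
    have key : ∀ v : EuclideanSpace ℝ (Fin n), ∃ t : ℝ, 0 < t ∧ x + t • v ∈ solidSimplex n := by
      intro v
      have hc : Filter.Tendsto (fun t : ℝ => x + t • v) (nhdsWithin 0 (Set.Ioi 0)) (nhds x) := by
        have : Continuous fun t : ℝ => x + t • v := by fun_prop
        simpa using (this.tendsto 0).mono_left nhdsWithin_le_nhds
      have := (hc.eventually (mem_interior_iff_mem_nhds.1 hx)).and self_mem_nhdsWithin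
      obtain ⟨t, h1, h2⟩ := this.exists
      exact ⟨t, h2, h1⟩
    refine ⟨fun i => ?_, ?_⟩
    · obtain ⟨t, ht, h⟩ := key (-EuclideanSpace.single i 1)
      have := h.1 i
      simp at this
      linarith
    · obtain ⟨t, ht, h⟩ := key x
      have := h.2
      simp only [PiLp.add_apply, PiLp.smul_apply, smul_eq_mul, Finset.sum_add_distrib,
        ← Finset.mul_sum] at this
      by_contra hlt
      nlinarith
  · refine interior_maximal (fun x hx => ⟨fun i => (hx.1 i).le, hx.2.le⟩) ?_
    have : {x : EuclideanSpace ℝ (Fin n) | (∀ i, 0 < x i) ∧ ∑ i, x i < 1} =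
        (⋂ i, {x : EuclideanSpace ℝ (Fin n) | 0 < x i}) ∩ {x | ∑ i, x i < 1} := by
      ext x
      simp
    rw [this]
    exact (isOpen_iInter_of_finite fun i => isOpen_lt (by fun_prop) (by fun_prop)).inter
      (isOpen_lt (by fun_prop) (by fun_prop))

/-- Dropping the first barycentric coordinate identifies the standard simplex with a solid
simplex. -/
noncomputable def stdSimplexHomeomorphSolidSimplex (n : ℕ) :
    stdSimplex ℝ (Fin (n + 1)) ≃ₜ solidSimplex n where
  toFun p := ⟨WithLp.toLp 2 fun i => p i.succ, fun i => p.2.1 _, by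
    have := p.2.2
    rw [Fin.sum_univ_succ] at this
    have h0 := p.2.1 0
    change ∑ i : Fin n, p.1 i.succ ≤ 1
    linarith⟩
  invFun x := ⟨Fin.cons (1 - ∑ i, x.1 i) fun i => x.1 i, fun i => by
    cases i using Fin.cases with
    | zero => simpa using x.2.2
    | succ i => simpa using x.2.1 i, by simp [Fin.sum_univ_succ]⟩
  left_inv p := by
    refine Subtype.ext (funext fun i => ?_)
    cases i using Fin.cases with
    | zero =>
      have := p.2.2
      rw [Fin.sum_univ_succ] at this
      change 1 - ∑ i : Fin n, p.1 i.succ = p.1 0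
      linarith
    | succ i => rfl
  right_inv x := by
    refine Subtype.ext ?_
    ext i
    rfl
  continuous_toFun := by
    refine Continuous.subtype_mk ?_ _
    refine (PiLp.continuous_toLp 2 _).comp (continuous_pi fun i => ?_)
    exact (continuous_apply i.succ).comp continuous_subtype_val
  continuous_invFun := by
    refine Continuous.subtype_mk (continuous_pi fun i => ?_) _
    cases i using Fin.cases with
    | zero => simp only [Fin.cons_zero]; fun_prop
    | succ i => simp only [Fin.cons_succ]; fun_prop

theorem stdSimplexHomeomorphSolidSimplex_mem_interior {n : ℕ} (p : stdSimplex ℝ (Fin (n + 1))) :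
    (stdSimplexHomeomorphSolidSimplex n p : EuclideanSpace ℝ (Fin n)) ∈
      interior (solidSimplex n) ↔ ∀ i, p i ≠ 0 := by
  have h1 := p.2.2
  rw [Fin.sum_univ_succ] at h1
  have h0 := p.2.1
  rw [interior_solidSimplex, Set.mem_ofPred_eq, Fin.forall_fin_succ, and_comm]
  change ∑ i : Fin n, p.1 i.succ < 1 ∧ (∀ i : Fin n, 0 < p.1 i.succ) ↔
    p.1 0 ≠ 0 ∧ ∀ i : Fin n, p.1 i.succ ≠ 0
  refine and_congr ?_ (forall_congr' fun i => (h0 _).lt_iff_ne'.trans Iff.rfl)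
  rw [← (h0 0).lt_iff_ne']
  constructor <;> intro <;> linarith

/-- The standard simplex is homeomorphic to a disk, by a homeomorphism under which the boundary
corresponds to the sphere. -/
theorem exists_stdSimplex_homeomorph_closedBall (n : ℕ) :
    ∃ h : stdSimplex ℝ (Fin (n + 1)) ≃ₜ closedBall (0 : EuclideanSpace ℝ (Fin n)) 1,
      ∀ p, (h p : EuclideanSpace ℝ (Fin n)) ∈ sphere (0 : EuclideanSpace ℝ (Fin n)) 1 ↔
        ∃ i, p i = 0 := by
  have hne : (interior (solidSimplex n)).Nonempty :=
    ⟨_, (stdSimplexHomeomorphSolidSimplex_mem_interior stdSimplex.barycenter).2 fun i => by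
      change (stdSimplex.barycenter : stdSimplex ℝ (Fin (n + 1))).val i ≠ 0
      rw [stdSimplex.barycenter_apply]
      simp
      positivity⟩
  obtain ⟨h, hi, hcl, hf⟩ := exists_homeomorph_image_interior_closure_frontier_eq_unitBall
    (convex_solidSimplex n) hne (isBounded_solidSimplex n)
  rw [(isClosed_solidSimplex n).closure_eq] at hcl
  refine ⟨(stdSimplexHomeomorphSolidSimplex n).trans
    ((h.image _).trans (Homeomorph.setCongr hcl)), fun p => ?_⟩
  change h (stdSimplexHomeomorphSolidSimplex n p) ∈ _ ↔ _
  rw [← hf, h.injective.mem_set_image, (isClosed_solidSimplex n).frontier_eq, Set.mem_sdiff,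
    stdSimplexHomeomorphSolidSimplex_mem_interior]
  simp

end SimplexDisk

/-! ### The realization of the boundary of a standard simplex -/

section BoundaryRealization

open Simplicial Opposite

theorem stdSimplex.map_apply_eq_zero {m n : ℕ} (f : Fin m → Fin n) (p : stdSimplex ℝ (Fin m))
    {j : Fin n} (hj : j ∉ Set.range f) : stdSimplex.map f p j = 0 := by
  rw [stdSimplex.map_coe, FunOnFinite.linearMap_apply_apply]
  exact Finset.sum_eq_zero fun k hk => absurd ⟨k, (Finset.mem_filter.1 hk).2⟩ hj

theorem stdSimplex.map_apply_of_injective {m n : ℕ} {f : Fin m → Fin n}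
    (hf : Function.Injective f) (p : stdSimplex ℝ (Fin m)) (i : Fin m) :
    stdSimplex.map f p (f i) = p i := by
  rw [stdSimplex.map_coe, FunOnFinite.linearMap_apply_apply]
  have : (Finset.univ.filter fun x => f x = f i) = {i} := by
    ext k
    simp [hf.eq_iff]
  rw [this, Finset.sum_singleton]

/-- A point of a standard simplex with a vanishing coordinate comes from a face. -/
theorem stdSimplex.exists_map_succAbove_eq {n : ℕ} (p : stdSimplex ℝ (Fin (n + 2)))
    {i : Fin (n + 2)} (hi : p i = 0) :
    ∃ q : stdSimplex ℝ (Fin (n + 1)), stdSimplex.map i.succAbove q = p := by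
  have hsum : ∑ j, p (i.succAbove j) = 1 := by
    have := stdSimplex.sum_eq_one p
    rwa [Fin.sum_univ_succAbove _ i, hi, zero_add] at this
  refine ⟨⟨fun j => p (i.succAbove j), fun j => stdSimplex.zero_le p _, hsum⟩, ?_⟩
  refine stdSimplex.ext (funext fun j => ?_)
  by_cases hj : j = i
  · subst hj
    rw [hi]
    exact stdSimplex.map_apply_eq_zero _ _ (by simp)
  · obtain ⟨k, rfl⟩ := Fin.exists_succAbove_eq hj
    exact stdSimplex.map_apply_of_injective Fin.succAbove_right_injective _ _

namespace SSet

theorem stdSimplex_map_comp {a b c : SimplexCategory} (f : a ⟶ b) (g : b ⟶ c) :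
    SSet.stdSimplex.{u}.map (f ≫ g) = SSet.stdSimplex.map f ≫ SSet.stdSimplex.map g :=
  stdSimplex.{u}.map_comp f g

/-- Maps out of the realization of a simplicial set are determined by their restrictions to
simplices. -/
theorem toTop_hom_ext {X : SSet.{u}} {Z : TopCat.{u}} {f g : toTop.obj X ⟶ Z}
    (h : ∀ (m : ℕ) (s : Δ[m] ⟶ X), toTop.map s ≫ f = toTop.map s ≫ g) : f = g := by
  apply (sSetTopAdj.homEquiv X Z).injective
  ext ⟨m⟩ x
  induction m using SimplexCategory.rec with | _ m
  obtain ⟨s, rfl⟩ := yonedaEquiv.surjective x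
  have := congrArg (sSetTopAdj.homEquiv _ _) (h m s)
  rw [Adjunction.homEquiv_naturality_left, Adjunction.homEquiv_naturality_left] at this
  have := congrArg yonedaEquiv this
  rwa [yonedaEquiv_comp, yonedaEquiv_comp] at this

/-- Every point of the realization of a simplicial set lies in the image of some simplex. -/
theorem exists_toTop_map_eq {X : SSet.{u}} (x : toTop.obj X) :
    ∃ (m : ℕ) (s : Δ[m] ⟶ X) (p : toTop.obj Δ[m]), toTop.map s p = x := by
  let U : Set (toTop.obj X) := {x | ∃ (m : ℕ) (s : Δ[m] ⟶ X) (p : toTop.obj Δ[m]),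
    toTop.map s p = x}
  let f : toTop.obj X ⟶ @TopCat.of (ULift Prop) ⊤ :=
    @TopCat.ofHom _ _ _ ⊤ (@ContinuousMap.mk _ _ _ ⊤ (fun x => ULift.up (x ∈ U)) continuous_top)
  let g : toTop.obj X ⟶ @TopCat.of (ULift Prop) ⊤ :=
    @TopCat.ofHom _ _ _ ⊤ (@ContinuousMap.mk _ _ _ ⊤ (fun _ => ULift.up True) continuous_top)
  have key : f = g := by
    refine toTop_hom_ext fun m s => ?_
    ext p
    have hp : toTop.map s p ∈ U := ⟨m, s, p, rfl⟩
    exact iff_of_true hp trivial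
  exact of_eq_true (congrArg ULift.down (ConcreteCategory.congr_hom key x))

/-- A point of the realization of a subcomplex of a standard simplex is the image of an interior
point of a standard simplex under an injective order-preserving map. -/
theorem exists_mono_toTop_map_eq {n : ℕ} (A : (Δ[n] : SSet.{u}).Subcomplex)
    (x : toTop.obj (A : SSet.{u})) :
    ∃ (m : ℕ) (f : ⦋m⦌ ⟶ ⦋n⦌) (s : Δ[m] ⟶ (A : SSet.{u})) (p : toTop.obj Δ[m]),
      s ≫ A.ι = SSet.stdSimplex.map f ∧ toTop.map s p = x ∧ Function.Injective f.toOrderHom ∧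
      ∀ i, SimplexCategory.toTopHomeo ⦋m⦌ p i ≠ 0 := by
  classical
  -- The dimension of the simplex is taken minimal. A non-injective `f` would make `s` factor
  -- through a degeneracy, and a vanishing coordinate would put `p` on a face; either lowers the
  -- dimension.
  let P : ℕ → Prop := fun m => ∃ (s : Δ[m] ⟶ (A : SSet.{u})) (p : toTop.obj Δ[m]),
    toTop.map s p = x
  have hP : ∃ m, P m := exists_toTop_map_eq x
  obtain ⟨s, p, hp⟩ := Nat.find_spec hP
  have hmin : ∀ k, P k → Nat.find hP ≤ k := fun k hk => Nat.find_min' hP hk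
  generalize Nat.find hP = m at s p hp hmin
  obtain ⟨f, hf⟩ := stdSimplex.{u}.map_surjective (s ≫ A.ι)
  refine ⟨m, f, s, p, hf.symm, hp, ?_, fun i hi => ?_⟩
  · by_contra hinj
    cases m with
    | zero => exact hinj fun a b _ => Subsingleton.elim (α := Fin 1) a b
    | succ m =>
      obtain ⟨i, f', rfl⟩ := SimplexCategory.eq_σ_comp_of_not_injective f hinj
      have hs : SSet.stdSimplex.map (SimplexCategory.σ i) ≫
          SSet.stdSimplex.map (SimplexCategory.δ i.castSucc) ≫ s = s := by
        rw [← cancel_mono A.ι, Category.assoc, Category.assoc, ← hf, ← stdSimplex_map_comp,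
          ← stdSimplex_map_comp, SimplexCategory.δ_comp_σ_self_assoc]
      have := hmin m ⟨SSet.stdSimplex.map (SimplexCategory.δ i.castSucc) ≫ s,
        toTop.map (SSet.stdSimplex.map (SimplexCategory.σ i)) p, by
          rw [← hp, ← ConcreteCategory.comp_apply, ← Functor.map_comp, hs]⟩
      omega
  · cases m with
    | zero =>
      have h := stdSimplex.sum_eq_one (SimplexCategory.toTopHomeo ⦋0⦌ p)
      have h2 : ∑ i : Fin 1, SimplexCategory.toTopHomeo ⦋0⦌ p i = 1 := h
      rw [Fin.sum_univ_one] at h2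
      have : i = (0 : Fin 1) := Subsingleton.elim (α := Fin 1) _ _
      rw [this] at hi
      exact zero_ne_one (hi.symm.trans h2)
    | succ m =>
      obtain ⟨q, hq⟩ := stdSimplex.exists_map_succAbove_eq (SimplexCategory.toTopHomeo ⦋m + 1⦌ p) hi
      have hpq : p = toTop.map (SSet.stdSimplex.map (SimplexCategory.δ i))
          ((SimplexCategory.toTopHomeo ⦋m⦌).symm q) := by
        apply (SimplexCategory.toTopHomeo ⦋m + 1⦌).injective
        rw [SimplexCategory.toTopHomeo_naturality_apply, Homeomorph.apply_symm_apply]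
        exact hq.symm
      have := hmin m ⟨SSet.stdSimplex.map (SimplexCategory.δ i) ≫ s,
        (SimplexCategory.toTopHomeo ⦋m⦌).symm q, by
          rw [← hp, hpq, ← ConcreteCategory.comp_apply, ← Functor.map_comp]⟩
      omega

/-- In the minimal form of a point, the range of `f` is the set of nonzero barycentric coordinates
of the image. So the image determines `f`, hence `s`, and then `p`. -/
theorem toTop_map_subcomplex_ι_injective {n : ℕ} (A : (Δ[n] : SSet.{u}).Subcomplex) :
    Function.Injective (toTop.map A.ι) := by
  intro x y hxy
  obtain ⟨m, f, s, p, hs, rfl, hf, hp⟩ := exists_mono_toTop_map_eq A x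
  obtain ⟨k, g, t, q, ht, rfl, hg, hq⟩ := exists_mono_toTop_map_eq A y
  have key : stdSimplex.map f.toOrderHom (SimplexCategory.toTopHomeo ⦋m⦌ p) =
      stdSimplex.map g.toOrderHom (SimplexCategory.toTopHomeo ⦋k⦌ q) := by
    rw [← ConcreteCategory.comp_apply, ← Functor.map_comp, hs, ← ConcreteCategory.comp_apply,
      ← Functor.map_comp, ht] at hxy
    have := congrArg (SimplexCategory.toTopHomeo ⦋n⦌) hxy
    rwa [SimplexCategory.toTopHomeo_naturality_apply,
      SimplexCategory.toTopHomeo_naturality_apply] at this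
  have hrange : Set.range f.toOrderHom = Set.range g.toOrderHom := by
    apply Set.Subset.antisymm
    · rintro _ ⟨i, rfl⟩
      by_contra h
      have := stdSimplex.map_apply_of_injective hf (SimplexCategory.toTopHomeo ⦋m⦌ p) i
      rw [key, stdSimplex.map_apply_eq_zero _ _ h] at this
      exact hp i this.symm
    · rintro _ ⟨i, rfl⟩
      by_contra h
      have := stdSimplex.map_apply_of_injective hg (SimplexCategory.toTopHomeo ⦋k⦌ q) i
      rw [← key, stdSimplex.map_apply_eq_zero _ _ h] at this
      exact hq i this.symm
  have hmk : m = k := by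
    have h3 : Nat.card (Set.range f.toOrderHom) = Nat.card (Set.range g.toOrderHom) := by
      rw [hrange]
    rw [Nat.card_range_of_injective hf, Nat.card_range_of_injective hg] at h3
    simpa using h3
  subst hmk
  have hfg : f = g := by
    ext1
    apply OrderHom.ext
    exact ((f.toOrderHom.monotone.strictMono_of_injective hf).range_inj
      (g.toOrderHom.monotone.strictMono_of_injective hg)).1 hrange
  subst hfg
  have hst : s = t := by rw [← cancel_mono A.ι, hs, ht]
  have hpq : p = q := by
    apply (SimplexCategory.toTopHomeo ⦋m⦌).injective
    refine _root_.stdSimplex.ext (funext fun i => ?_)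
    rw [← stdSimplex.map_apply_of_injective hf, key, stdSimplex.map_apply_of_injective hf]
  rw [hst, hpq]

instance compactSpace_toTop_stdSimplex (n : ℕ) : CompactSpace (toTop.obj (Δ[n] : SSet.{u})) :=
  (SimplexCategory.toTopHomeo.{u} ⦋n⦌).symm.compactSpace

instance t2Space_toTop_stdSimplex (n : ℕ) : T2Space (toTop.obj (Δ[n] : SSet.{u})) :=
  (SimplexCategory.toTopHomeo.{u} ⦋n⦌).symm.t2Space

theorem exists_eq_comp_boundary_ι {m n : ℕ} (s : Δ[m] ⟶ (∂Δ[n + 1] : SSet.{u})) :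
    ∃ (i : Fin (n + 2)) (t : Δ[m] ⟶ Δ[n]), s = t ≫ boundary.ι i := by
  obtain ⟨f, hf⟩ := stdSimplex.{u}.map_surjective (s ≫ (∂Δ[n + 1]).ι)
  have hns : ¬ Function.Surjective f.toOrderHom := by
    have h : (yonedaEquiv (s ≫ (∂Δ[n + 1]).ι)) ∈ (∂Δ[n + 1] : (Δ[n + 1] : SSet.{u}).Subcomplex).obj
        (op ⦋m⦌) := (yonedaEquiv s).2
    rw [← hf, yonedaEquiv_map] at h
    exact h
  obtain ⟨i, g, rfl⟩ := SimplexCategory.eq_comp_δ_of_not_surjective f hns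
  refine ⟨i, SSet.stdSimplex.map g, ?_⟩
  rw [← cancel_mono (∂Δ[n + 1]).ι, Category.assoc, boundary.ι_ι, ← hf, stdSimplex_map_comp]
  rfl

instance isEmpty_toTop_boundary_zero : IsEmpty (toTop.obj (∂Δ[0] : SSet.{u})) := by
  refine ⟨fun x => ?_⟩
  obtain ⟨m, s, p, -⟩ := exists_toTop_map_eq x
  have := (yonedaEquiv s).2
  simp at this

instance compactSpace_toTop_boundary (n : ℕ) :
    CompactSpace (toTop.obj (∂Δ[n] : SSet.{u})) := by
  cases n with
  | zero => infer_instance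
  | succ n =>
    refine ⟨?_⟩
    have : (Set.univ : Set (toTop.obj (∂Δ[n + 1] : SSet.{u}))) =
        ⋃ i : Fin (n + 2), Set.range (toTop.map (boundary.ι i)) := by
      refine (Set.eq_univ_of_forall fun x => ?_).symm
      obtain ⟨m, s, p, rfl⟩ := exists_toTop_map_eq x
      obtain ⟨i, t, rfl⟩ := exists_eq_comp_boundary_ι s
      refine Set.mem_iUnion.2 ⟨i, toTop.map t p, ?_⟩
      rw [← ConcreteCategory.comp_apply, ← Functor.map_comp]
    rw [this]
    exact isCompact_iUnion fun i => isCompact_range (toTop.map (boundary.ι i)).hom.continuous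

/-- A continuous injection from a compact space to a Hausdorff space. -/
theorem isClosedEmbedding_toTop_map_boundary_ι (n : ℕ) :
    Topology.IsClosedEmbedding (toTop.map (∂Δ[n] : (Δ[n] : SSet.{u}).Subcomplex).ι) :=
  Topology.IsClosedEmbedding.of_continuous_injective_isClosedMap
    (toTop.map (∂Δ[n] : (Δ[n] : SSet.{u}).Subcomplex).ι).hom.continuous
    (toTop_map_subcomplex_ι_injective _)
    (toTop.map (∂Δ[n] : (Δ[n] : SSet.{u}).Subcomplex).ι).hom.continuous.isClosedMap

theorem mem_range_toTop_map_boundary_ι {n : ℕ} (x : toTop.obj (Δ[n] : SSet.{u})) :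
    x ∈ Set.range (toTop.map (∂Δ[n] : (Δ[n] : SSet.{u}).Subcomplex).ι) ↔
      ∃ i, SimplexCategory.toTopHomeo ⦋n⦌ x i = 0 := by
  cases n with
  | zero =>
    have h2 : ∑ i : Fin 1, SimplexCategory.toTopHomeo ⦋0⦌ x i = 1 :=
      stdSimplex.sum_eq_one (SimplexCategory.toTopHomeo ⦋0⦌ x)
    rw [Fin.sum_univ_one] at h2
    refine iff_of_false ?_ ?_
    · rintro ⟨y, -⟩
      exact isEmptyElim y
    · rintro ⟨i, hi⟩
      have : i = (0 : Fin 1) := Subsingleton.elim (α := Fin 1) _ _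
      rw [this] at hi
      exact zero_ne_one (hi.symm.trans h2)
  | succ n =>
    constructor
    · rintro ⟨y, rfl⟩
      obtain ⟨m, s, p, rfl⟩ := exists_toTop_map_eq y
      obtain ⟨i, t, rfl⟩ := exists_eq_comp_boundary_ι s
      refine ⟨i, ?_⟩
      rw [← ConcreteCategory.comp_apply, ← Functor.map_comp, Category.assoc, boundary.ι_ι,
        Functor.map_comp, ConcreteCategory.comp_apply]
      refine (congrFun (congrArg DFunLike.coe
        (SimplexCategory.toTopHomeo_naturality_apply (SimplexCategory.δ i) _)) i).trans ?_
      exact stdSimplex.map_apply_eq_zero _ _ (by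
        rintro ⟨j, hj⟩
        exact i.succAbove_ne j hj)
    · rintro ⟨i, hi⟩
      obtain ⟨q, hq⟩ := stdSimplex.exists_map_succAbove_eq (SimplexCategory.toTopHomeo ⦋n + 1⦌ x) hi
      refine ⟨toTop.map (boundary.ι i) ((SimplexCategory.toTopHomeo ⦋n⦌).symm q), ?_⟩
      rw [← ConcreteCategory.comp_apply, ← Functor.map_comp, boundary.ι_ι]
      apply (SimplexCategory.toTopHomeo ⦋n + 1⦌).injective
      refine (SimplexCategory.toTopHomeo_naturality_apply (SimplexCategory.δ i) _).trans ?_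
      rw [Homeomorph.apply_symm_apply]
      exact hq

end SSet
end BoundaryRealization

/-! ### The CW structure on the realization of a simplicial set -/

section RealizationCW

open Simplicial Opposite Limits TopCat HomotopicalAlgebra

namespace SSet

/-- The realization of the boundary inclusion of the standard `n`-simplex is isomorphic to the
inclusion of the boundary of the `n`-disk. -/
theorem nonempty_toTop_map_boundary_ι_iso (n : ℕ) :
    Nonempty (Arrow.mk (toTop.map (∂Δ[n] : (Δ[n] : SSet.{u}).Subcomplex).ι) ≅
      Arrow.mk (diskBoundaryInclusion.{u} n)) := by
  obtain ⟨h, hh⟩ := exists_stdSimplex_homeomorph_closedBall n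
  let e : toTop.obj (Δ[n] : SSet.{u}) ≃ₜ 𝔻 n :=
    (SimplexCategory.toTopHomeo ⦋n⦌).trans (h.trans Homeomorph.ulift.symm)
  have hi := isClosedEmbedding_toTop_map_boundary_ι.{u} n
  have hr : ∀ x : toTop.obj (Δ[n] : SSet.{u}),
      x ∈ Set.range (toTop.map (∂Δ[n] : (Δ[n] : SSet.{u}).Subcomplex).ι) ↔
        ((e x).down : EuclideanSpace ℝ (Fin n)) ∈
          Metric.sphere (0 : EuclideanSpace ℝ (Fin n)) 1 := fun x => by
    rw [mem_range_toTop_map_boundary_ι]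
    exact (hh _).symm
  let b : toTop.obj (∂Δ[n] : SSet.{u}) ≃ₜ ∂𝔻 n :=
    hi.isEmbedding.toHomeomorph.trans
      { toFun := fun x => ⟨⟨(e x.1).down.1, (hr x.1).1 x.2⟩⟩
        invFun := fun y => ⟨e.symm ⟨⟨y.down.1, Metric.sphere_subset_closedBall y.down.2⟩⟩, by
          rw [hr]
          exact (congrArg (fun z : 𝔻 n => z.down.1) (e.apply_symm_apply _)).symm ▸ y.down.2⟩
        left_inv := fun x => Subtype.ext (e.symm_apply_apply x.1)
        right_inv := fun y => by
          apply ULift.down_injective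
          apply Subtype.ext
          exact congrArg (fun z : 𝔻 n => z.down.1) (e.apply_symm_apply _)
        continuous_toFun := by
          refine continuous_uliftUp.comp (Continuous.subtype_mk ?_ _)
          exact continuous_subtype_val.comp (continuous_uliftDown.comp
            (e.continuous.comp continuous_subtype_val))
        continuous_invFun := by
          refine Continuous.subtype_mk (e.symm.continuous.comp (continuous_uliftUp.comp
            (Continuous.subtype_mk ?_ _))) _
          exact continuous_subtype_val.comp continuous_uliftDown }
  exact ⟨Arrow.isoMk (TopCat.isoOfHomeo b) (TopCat.isoOfHomeo e) (by ext x; rfl)⟩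

instance : PreservesWellOrderContinuousOfShape ℕ toTop.{u} where
  preservesColimitsOfShape _ _ := inferInstance

/-- The realization of a simplicial set is a CW complex, with one cell of dimension `n` for each
nondegenerate simplex of dimension `n`. -/
noncomputable def toTopCWComplex (X : SSet.{u}) : TopCat.CWComplex (toTop.obj X) :=
  (((relativeCellComplex X).map toTop).replaceCells (basicCell' := RelativeCWComplex.basicCell)
    fun n _ => (nonempty_toTop_map_boundary_ι_iso n).some).ofArrowIso
      (Arrow.isoMk (((Subcomplex.isInitialBot).isInitialObj toTop _).uniqueUpToIso initialIsInitial)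
        (Iso.refl _) (((Subcomplex.isInitialBot).isInitialObj toTop _).hom_ext _ _))

theorem toTopCWComplex_cell_le {X : SSet.{u}} {n : ℕ} (h : ∀ k, n < k → X.nonDegenerate k = ∅)
    (e : X.toTopCWComplex.Cells) : e.j ≤ n := by
  by_contra hlt
  let c : (relativeCellComplex X).Cells := ⟨e.j, e.hj, e.k⟩
  have := c.k.nonDegenerate
  rw [h _ (not_le.1 hlt)] at this
  exact this

end SSet

end RealizationCW

/-! ### Dimensions of the Salvetti complex and of the nerve -/

namespace CoxeterMatrix

open Simplicial Opposite

variable {B : Type u} {M : CoxeterMatrix B}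

/-- If the types agree, `b.elt⁻¹ * a.elt` lies in the special subgroup and is shortest in its coset,
so it is `1` and the pairs coincide. -/
theorem SalvettiPoset.card_lt_card {a b : M.SalvettiPoset} (h : a < b) :
    a.type.card < b.type.card := by
  refine Finset.card_lt_card (h.le.1.ssubset_of_ne fun ht => h.not_ge ?_)
  obtain ⟨h₁, h₂, h₃⟩ := SalvettiPoset.le_def.1 h.le
  have hl := h₃ (b.elt⁻¹ * a.elt)⁻¹ (inv_mem (ht ▸ h₂))
  rw [mul_inv_cancel, M.toCoxeterSystem.length_one] at hl
  have h0 : M.toCoxeterSystem.length (b.elt⁻¹ * a.elt) = 0 := by omega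
  have h1 := M.toCoxeterSystem.length_eq_zero_iff.1 h0
  exact (SalvettiPoset.ext (inv_mul_eq_one.1 h1).symm ht : a = b).ge

/-- The dimension of the Salvetti complex is at most the maximal cardinality of a spherical
subset. -/
theorem nonDegenerate_salvettiSSet_eq_empty {n : ℕ} (hn : ∀ T, M.IsSpherical T → T.card ≤ n)
    {k : ℕ} (hk : n < k) : M.salvettiSSet.nonDegenerate k = ∅ := by
  refine Set.eq_empty_of_forall_notMem fun x hx => ?_
  induction x using Quot.ind with | _ x
  -- A degenerate chain has a degenerate orbit; so a nondegenerate orbit comes from a strict chain,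
  -- along which the cardinalities of the types increase from at least `0` to at least `k`.
  have hx' : x ∈ (CategoryTheory.nerve M.SalvettiPoset).nonDegenerate k := by
    intro hdeg
    obtain ⟨m, hm, f, y, rfl⟩ := hdeg
    exact hx ⟨m, hm, f, Quot.mk _ y, rfl⟩
  rw [PartialOrder.mem_nerve_nonDegenerate_iff_strictMono] at hx'
  have hmono : StrictMono fun i => (x.obj i).type.card := fun i j hij =>
    SalvettiPoset.card_lt_card (hx' hij)
  have key : ∀ i : Fin (k + 1), (i : ℕ) ≤ (x.obj i).type.card := by
    intro i
    induction i using Fin.induction with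
    | zero => simp
    | succ i ih =>
      have := hmono (Fin.castSucc_lt_succ (i := i))
      simp only [Fin.val_castSucc, Fin.val_succ] at ih ⊢
      dsimp only at this
      omega
  have := (key (Fin.last k)).trans (hn _ (x.obj (Fin.last k)).spherical)
  simp only [Fin.val_last] at this
  omega

end CoxeterMatrix

namespace CoxeterMatrix

variable {B : Type u} {M : CoxeterMatrix B} {d : ℕ}

theorem card_le_of_dim_nerve_eq (hd : M.nerve.dim = (d : WithBot ℕ∞)) {T : Finset B}
    (hT : M.IsSpherical T) : T.card ≤ d + 1 := by
  rcases T.eq_empty_or_nonempty with rfl | hne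
  · simp
  have : ((T.card - 1 : ℕ) : WithBot ℕ∞) ≤ M.nerve.dim :=
    le_iSup (fun σ : M.nerve.faces => (((σ : Finset B).card - 1 : ℕ) : WithBot ℕ∞)) ⟨T, hne, hT⟩
  rw [hd] at this
  have : T.card - 1 ≤ d := by exact_mod_cast this
  omega

theorem exists_isSpherical_card_eq (hd : M.nerve.dim = (d : WithBot ℕ∞)) :
    ∃ T, M.IsSpherical T ∧ T.card = d + 1 := by
  by_contra! hcon
  have hlt : ∀ σ : M.nerve.faces, (σ : Finset B).card < d + 1 := fun σ =>
    (card_le_of_dim_nerve_eq hd σ.2.2).lt_of_ne (hcon _ σ.2.2)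
  have hpos : ∀ σ : M.nerve.faces, 0 < (σ : Finset B).card := fun σ => σ.2.1.card_pos
  cases d with
  | zero =>
    -- For `d = 0` the assumption leaves no simplices, and the supremum is `⊥` instead of `0`.
    have : M.nerve.dim = ⊥ := by
      refine iSup_eq_bot.2 fun σ => ?_
      have := hlt σ
      have := hpos σ
      omega
    rw [hd] at this
    exact WithBot.coe_ne_bot this
  | succ d =>
    have : M.nerve.dim ≤ (d : WithBot ℕ∞) := iSup_le fun σ => by
      have := hlt σ
      have h : (σ : Finset B).card - 1 ≤ d := by omega
      exact_mod_cast h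
    rw [hd] at this
    have : d + 1 ≤ d := by exact_mod_cast this
    omega

end CoxeterMatrix

theorem corollary2p6 {B : Type u} (M : CoxeterMatrix B) (d : ℕ)
    (hd : M.nerve.dim = (d : WithBot ℕ∞)) :
    ((d + 1 : ℕ) : WithBot ℕ∞) ≤ cohomologicalDimension M.ArtinGroup ∧
      (M.KPiOneConjecture → geometricDimension M.ArtinGroup = ((d + 1 : ℕ) : ℕ∞)) := by
  obtain ⟨T, hT, hcard⟩ := CoxeterMatrix.exists_isSpherical_card_eq hd
  have htorus : HasDetectedTorus M.ArtinGroup (d + 1) :=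
    hcard ▸ CoxeterMatrix.hasDetectedTorus_artinGroup M hT
  refine ⟨htorus.le_cohomologicalDimension, fun hM => le_antisymm ?_ ?_⟩
  · refine sInf_le ⟨M.salvettiComplex, M.salvettiSSet.toTopCWComplex, hM, fun e => ?_⟩
    have := SSet.toTopCWComplex_cell_le (fun k hk =>
      CoxeterMatrix.nonDegenerate_salvettiSSet_eq_empty
        (fun _ => CoxeterMatrix.card_le_of_dim_nerve_eq hd) hk) e
    exact_mod_cast this
  · refine le_sInf fun n hn => ?_
    obtain ⟨X, c, hX, hc⟩ := hn
    induction n with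
    | top => exact le_top
    | coe n =>
      have := htorus.le_of_isClassifyingSpace hX c (n := n) fun e => by exact_mod_cast hc e
      exact_mod_cast this
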